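/- Let $(Q,\mathfrak n,k)$ be a commutative Noetherian local ring, $R=Q/I$ with $I$ a proper ideal, and $M\neq 0$ a finitely generated $R$-module. Let $A\xrightarrow{\simeq}R$ and $G\xrightarrow{\simeq}M$ be minimal $Q$-free resolutions (resolutions by free modules whose differentials have image in $\mathfrak n$ times the target), with $A_0=Q$, and put $A_+=A_{\ge 1}$. Write $X[1]_n=X_{n-1}$, $d_{X[1]}=-d_X$; unmarked tensor products are over $Q$, and $(f\otimes g)(x\otimes y)=(-1)^{|g||x|}f(x)\otimes g(y)$. View $d_1^A:A_1\to A_0=Q$ as a degree $-2$ map $A_+[1]\to Q$. Let $m=(m_n)_{n\ge1}$ be an $A_\infty$-algebra structure on $A$, that is, $Q$-linear maps $m_n:A_+[1]^{\otimes n}\to A_+[1]$ of degree $-1$ with $m_1=d^{A[1]}|_{A_+[1]}$ (with zero component into $A_0[1]$), $m_1m_2+m_2(m_1\otimes1+1\otimes m_1)=d_1^A\otimes1-1\otimes d_1^A$, and $$\sum_{i=1}^n\sum_{j=0}^{n-i}m_{n-i+1}(1^{\otimes j}\otimes m_i\otimes1^{\otimes n-i-j})=0\quad\text{for } n\ge3.$$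 Let $m^G=(m_n^G)_{n\ge1}$ be an $A_\infty$ $A$-module structure on $G$, that is, $Q$-linear maps $m^G_n:A_+[1]^{\otimes n-1}\otimes G\to G$ of degree $-1$ with $m_1^G=d^G$, $m_1^Gm_2^G+m_2^G(m_1\otimes1+1\otimes m_1^G)=d_1^A\otimes1$, and $$\sum_{i=1}^n\sum_{j=0}^{n-i}m^G_{n-i+1}(1^{\otimes j}\otimes m_i\otimes1^{\otimes n-i-j})=0\quad\text{for } n\ge3,$$ where $m_i$ is read as $m_i^G$ when $j=n-i$. Let $\Omega M=\ker(R\otimes G_0\to M)$ be the first $R$-syzygy of $M$. For an $R$-module $N$, the change of rings map $\mathrm{Tor}^Q_*(N,k)\to\mathrm{Tor}^R_*(N,k)$ is the one induced by a morphism of complexes from a $Q$-projective resolution to an $R$-projective resolution of $N$ that lifts the identity of $N$. Then the change of rings maps $$\nu:\mathrm{Tor}^Q_*(M,k)\to\mathrm{Tor}^R_*(M,k)\quad\text{and}\quad\nu':\mathrm{Tor}^Q_*(\Omega M,k)\to\mathrm{Tor}^R_*(\Omega M,k)$$ are both injective (in every degree) if and only if $m_n\otimes k=0$ and $m_n^G\otimes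 k=0$ for all $n\ge1$. -/

import Mathlib

open CategoryTheory MonoidalCategory

universe u

/-! ### Change of rings maps on Tor -/

namespace TorChange

variable (Q R : Type u) [CommRing Q] [CommRing R] [Algebra Q R]

/-- Restriction of scalars along the structure map `Q → R`. -/
noncomputable abbrev res : ModuleCat.{u} R ⥤ ModuleCat.{u} Q :=
  ModuleCat.restrictScalars (algebraMap Q R)

variable {Q R}

/-- The complex of `Q`-modules underlying a complex of `R`-modules. -/
noncomputable abbrev resComplex (C : ChainComplex (ModuleCat.{u} R) ℕ) :
    ChainComplex (ModuleCat.{u} Q) ℕ :=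
  ((res Q R).mapHomologicalComplex _).obj C

/-- `Tor_n^S(M, N)`, computed by resolving the first variable `M`. -/
noncomputable abbrev tor {S : Type u} [CommRing S] (n : ℕ) (M N : ModuleCat.{u} S) :
    ModuleCat.{u} S :=
  ((Tor' (ModuleCat.{u} S) n).obj M).obj N

/-- The augmentation `P₀ → Z` of a resolution of `Z`. -/
noncomputable def aug {S : Type u} [CommRing S] {Z : ModuleCat.{u} S}
    (P : ProjectiveResolution Z) : P.complex.X 0 ⟶ Z :=
  P.π.f 0

variable (Q) in
/-- The augmentation of a resolution of the `R`-module `M`, as a map of `Q`-modules. -/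
noncomputable def resAug {M : ModuleCat.{u} R} (P' : ProjectiveResolution M) :
    (resComplex (Q := Q) P'.complex).X 0 ⟶ (res Q R).obj M :=
  (res Q R).map (aug P')

/-- The identity of `M` lifts to a morphism of complexes from any `Q`-projective resolution to
any `R`-projective resolution of `M`. -/
theorem exists_lift (M : ModuleCat.{u} R) (P : ProjectiveResolution ((res Q R).obj M))
    (P' : ProjectiveResolution M) :
    ∃ φ : P.complex ⟶ resComplex P'.complex, φ.f 0 ≫ resAug Q P' = aug P := by
  have hzP : P.complex.d 1 0 ≫ aug P = 0 := P.complex_d_comp_π_f_zero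
  have hz : P'.complex.d 1 0 ≫ aug P' = 0 := P'.complex_d_comp_π_f_zero
  have he : (ShortComplex.mk _ _ hz).Exact := P'.exact₀
  have hz' : (resComplex (Q := Q) P'.complex).d 1 0 ≫ resAug Q P' = 0 := by
    show (res Q R).map (P'.complex.d 1 0) ≫ (res Q R).map (aug P') = 0
    rw [← Functor.map_comp, hz, Functor.map_zero]
  have h0 : (ShortComplex.mk _ _ hz').Exact := he.map (res Q R)
  have hs : ∀ n, (ShortComplex.mk _ _
      ((resComplex (Q := Q) P'.complex).d_comp_d (n + 2) (n + 1) n)).Exact :=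
    fun n => (P'.exact_succ n).map (res Q R)
  have hepi' : Epi (aug P') := inferInstanceAs (Epi (P'.π.f 0))
  have hepi : Epi (resAug Q P') := (ModuleCat.epi_iff_surjective _).2
    (show Function.Surjective (aug P') from (ModuleCat.epi_iff_surjective (aug P')).1 hepi')
  let f0 : P.complex.X 0 ⟶ (resComplex (Q := Q) P'.complex).X 0 :=
    Projective.factorThru (aug P) (resAug Q P')
  have hf0 : f0 ≫ resAug Q P' = aug P := Projective.factorThru_comp _ _
  let f1 : P.complex.X 1 ⟶ (resComplex (Q := Q) P'.complex).X 1 :=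
    h0.liftFromProjective (P.complex.d 1 0 ≫ f0) (by
      show (P.complex.d 1 0 ≫ f0) ≫ resAug Q P' = 0
      rw [Category.assoc, hf0, hzP])
  have hf1 : f1 ≫ (resComplex (Q := Q) P'.complex).d 1 0 = P.complex.d 1 0 ≫ f0 :=
    h0.liftFromProjective_comp _ _
  refine ⟨ChainComplex.mkHom _ _ f0 f1 hf1 fun n p =>
    ⟨(hs n).liftFromProjective (P.complex.d (n + 2) (n + 1) ≫ p.2.1) ?_,
      (hs n).liftFromProjective_comp _ _⟩, ?_⟩
  · show (P.complex.d (n + 2) (n + 1) ≫ p.2.1) ≫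
      (resComplex (Q := Q) P'.complex).d (n + 1) n = 0
    rw [Category.assoc, p.2.2, ← Category.assoc, P.complex.d_comp_d, Limits.zero_comp]
  · exact hf0

/-- The natural maps `X ⊗_Q N → X ⊗_R N`, `x ⊗ y ↦ x ⊗ y`, for an `R`-module `X`. -/
noncomputable def tensorMap (N : ModuleCat.{u} R) :
    res Q R ⋙ (tensoringRight (ModuleCat.{u} Q)).obj ((res Q R).obj N) ⟶
      (tensoringRight (ModuleCat.{u} R)).obj N ⋙ res Q R where
  app X := Functor.LaxMonoidal.μ (res Q R) X N
  naturality X Y g := by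
    simp

/-- The map `Tor^Q(M, N) → Tor^R(M, N)` induced by a morphism of complexes `φ` from a
`Q`-projective resolution `P` to an `R`-projective resolution `P'` of `M`: the map
`H_n(P ⊗_Q N) → H_n(P' ⊗_Q N) → H_n(P' ⊗_R N)`. -/
noncomputable def torMap {M : ModuleCat.{u} R} (P : ProjectiveResolution ((res Q R).obj M))
    (P' : ProjectiveResolution M) (φ : P.complex ⟶ resComplex P'.complex)
    (N : ModuleCat.{u} R) (n : ℕ) :
    tor n ((res Q R).obj M) ((res Q R).obj N) ⟶ (res Q R).obj (tor n M N) :=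
  (P.isoLeftDerivedObj ((tensoringRight (ModuleCat.{u} Q)).obj ((res Q R).obj N)) n).hom ≫
    HomologicalComplex.homologyMap
      ((((tensoringRight (ModuleCat.{u} Q)).obj ((res Q R).obj N)).mapHomologicalComplex _).map φ ≫
        (NatTrans.mapHomologicalComplex (tensorMap (Q := Q) N) _).app P'.complex) n ≫
    (ShortComplex.mapHomologyIso (((((tensoringRight (ModuleCat.{u} R)).obj N).mapHomologicalComplex
      _).obj P'.complex).sc n) (res Q R)).hom ≫
    (res Q R).map
      (P'.isoLeftDerivedObj ((tensoringRight (ModuleCat.{u} R)).obj N) n).inv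

variable (Q) in
/-- The change of rings map `Tor_n^Q(M, N) → Tor_n^R(M, N)`, induced by a morphism of complexes
from a `Q`-projective to an `R`-projective resolution of `M` that lifts the identity of `M`. -/
noncomputable def changeOfRings (M N : ModuleCat.{u} R) (n : ℕ) :
    tor n ((res Q R).obj M) ((res Q R).obj N) ⟶ (res Q R).obj (tor n M N) :=
  torMap (projectiveResolution ((res Q R).obj M)) (projectiveResolution M)
    (exists_lift M _ _).choose N n

/-- The first syzygy of `M` over `R`, with respect to a `Q`-resolution `G` of `M`: the kernel of the
`R`-linear map `R ⊗_Q G₀ → M`, `r ⊗ g ↦ r • ε(g)`, that corresponds to the augmentation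
`ε : G₀ → M`. -/
noncomputable def syzygy {M : ModuleCat.{u} R} (G : ProjectiveResolution ((res Q R).obj M)) :
    ModuleCat.{u} R :=
  ModuleCat.of R (LinearMap.ker
    (((ModuleCat.extendRestrictScalarsAdj (algebraMap Q R)).homEquiv _ _).symm (aug G)).hom)

end TorChange

/-! ### A-infinity structures -/

namespace AInf

open scoped DirectSum TensorProduct

variable {Q : Type u} [CommRing Q]

/-- The total module of `A₊[1]`, where `A₊ = A_{≥ 1}`. The `i`-th summand is `A_{i+1}`, which sits
in degree `i + 1` of `A` and so in degree `i + 2` of `A₊[1]`. -/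
abbrev PlusShift (A : ChainComplex (ModuleCat.{u} Q) ℕ) : Type u :=
  ⨁ i : ℕ, A.X (i + 1)

/-- The total module of a complex; the `i`-th summand is the part of degree `i`. -/
abbrev Tot (G : ChainComplex (ModuleCat.{u} Q) ℕ) : Type u :=
  ⨁ i : ℕ, G.X i

/-- The differential `d^{A[1]}` restricted to `A₊[1]`: it is `-d^A`, except that it vanishes on the
lowest piece `A₁` (for `i = 0` the map `A.d 1 1` used below is zero). -/
noncomputable def dPlus (A : ChainComplex (ModuleCat.{u} Q) ℕ) :
    PlusShift A →ₗ[Q] PlusShift A :=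
  DirectSum.toModule Q ℕ _ fun i =>
    -((DirectSum.lof Q ℕ (fun i => A.X (i + 1)) (i - 1)) ∘ₗ (A.d (i + 1) (i - 1 + 1)).hom)

/-- The differential of the total module of `G` (for `i = 0` the map `G.d 0 0` is zero). -/
noncomputable def dTot (G : ChainComplex (ModuleCat.{u} Q) ℕ) : Tot G →ₗ[Q] Tot G :=
  DirectSum.toModule Q ℕ _ fun i =>
    (DirectSum.lof Q ℕ (fun i => G.X i) (i - 1)) ∘ₗ (G.d i (i - 1)).hom

/-- The map `d₁^A : A₊[1] → A₀ = Q` of degree `-2`, where `e` is the identification `A₀ = Q`. -/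
noncomputable def dOne (A : ChainComplex (ModuleCat.{u} Q) ℕ) (e : A.X 0 ≃ₗ[Q] Q) :
    PlusShift A →ₗ[Q] Q :=
  e.toLinearMap ∘ₗ (A.d 1 0).hom ∘ₗ DirectSum.component Q ℕ (fun i => A.X (i + 1)) 0

/-- The Koszul sign operator `x ↦ (-1)^{|x|} x` on `A₊[1]`. -/
noncomputable def sgn (A : ChainComplex (ModuleCat.{u} Q) ℕ) : PlusShift A →ₗ[Q] PlusShift A :=
  DirectSum.toModule Q ℕ _ fun i =>
    (-1 : Q) ^ (i + 2) • DirectSum.lof Q ℕ (fun i => A.X (i + 1)) i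

/-- The arguments `(u x₀, …, u x_{j-1}, y, x_{j+i}, x_{j+i+1}, …)`: the `i` arguments
`x_j, …, x_{j+i-1}` are replaced by the single argument `y`, and `u` is applied to those before. -/
def splice {X : Type*} (u : X → X) (x : ℕ → X) (j i : ℕ) (y : X) : ℕ → X :=
  fun l => if l < j then u (x l) else if l = j then y else x (l + i - 1)

/-- The value on `x₀ ⊗ ⋯ ⊗ x_{n-1}` of
`∑_{i=1}^{n} ∑_{j=0}^{n-i} m_{n-i+1} (1^{⊗ j} ⊗ m_i ⊗ 1^{⊗ n-i-j})`. As `m_i` has degree `-1`, the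
sign convention `(f ⊗ g)(x ⊗ y) = (-1)^{|g||x|} f(x) ⊗ g(y)` puts `sgn` on the first `j`
arguments. Of the sequence `x` only the first `n` terms are used. -/
noncomputable def algSum {A : ChainComplex (ModuleCat.{u} Q) ℕ}
    (m : ∀ n : ℕ, MultilinearMap Q (fun _ : Fin n => PlusShift A) (PlusShift A))
    (n : ℕ) (x : ℕ → PlusShift A) : PlusShift A :=
  ∑ i ∈ Finset.Icc 1 n, ∑ j ∈ Finset.range (n - i + 1),
    m (n - i + 1) fun l => splice (sgn A) x j i (m i fun t => x (j + t)) l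

/-- An A-infinity algebra structure on a complex `A` with `A₀ = Q` (the identification is `e`):
maps `m_n : A₊[1]^{⊗ n} → A₊[1]` of degree `-1` for `n ≥ 1`, given as multilinear maps.
(There is no `m_0` in the theory; the value of the family `m` at `0` is set to `0`.) -/
structure AlgStr (A : ChainComplex (ModuleCat.{u} Q) ℕ) (e : A.X 0 ≃ₗ[Q] Q) where
  /-- the structure maps `m_n` -/
  m : ∀ n : ℕ, MultilinearMap Q (fun _ : Fin n => PlusShift A) (PlusShift A)
  m_zero : m 0 = 0
  /-- `m_n` has degree `-1` -/
  degree : ∀ n : ℕ, 1 ≤ n → ∀ (a : Fin n → ℕ) (x : ∀ l, A.X (a l + 1)) (t : ℕ),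
    (t + 2) + 1 ≠ ∑ l, (a l + 2) →
    m n (fun l => DirectSum.lof Q ℕ (fun i => A.X (i + 1)) (a l) (x l)) t = 0
  m_one : ∀ x : Fin 1 → PlusShift A, m 1 x = dPlus A (x 0)
  /-- `m_1 m_2 + m_2 (m_1 ⊗ 1 + 1 ⊗ m_1) = d₁ ⊗ 1 - 1 ⊗ d₁` -/
  rel_two : ∀ x : ℕ → PlusShift A, algSum m 2 x = dOne A e (x 0) • x 1 - dOne A e (x 1) • x 0
  rel : ∀ n : ℕ, 3 ≤ n → ∀ x : ℕ → PlusShift A, algSum m n x = 0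

/-- The value on `x₀ ⊗ ⋯ ⊗ x_{p-1} ⊗ g`, where `p = n - 1`, of
`∑_{i=1}^{n} ∑_{j=0}^{n-i} m^G_{n-i+1} (1^{⊗ j} ⊗ m_i ⊗ 1^{⊗ n-i-j})`, where `m_i` is read as `m^G_i`
when `j = n - i`. Here `mG p` stands for `m^G_{p+1}`. The first double sum has the terms with
`j < n - i`, the second sum those with `j = n - i`. -/
noncomputable def modSum {A G : ChainComplex (ModuleCat.{u} Q) ℕ}
    (m : ∀ n : ℕ, MultilinearMap Q (fun _ : Fin n => PlusShift A) (PlusShift A))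
    (mG : ∀ p : ℕ, MultilinearMap Q (fun _ : Fin p => PlusShift A) (Tot G →ₗ[Q] Tot G))
    (p : ℕ) (x : ℕ → PlusShift A) (g : Tot G) : Tot G :=
  (∑ i ∈ Finset.Icc 1 p, ∑ j ∈ Finset.range (p + 1 - i),
    mG (p + 1 - i) (fun l => splice (sgn A) x j i (m i fun t => x (j + t)) l) g) +
  ∑ j ∈ Finset.range (p + 1),
    mG j (fun l => sgn A (x l)) (mG (p - j) (fun t => x (j + t)) g)

/-- An A-infinity module structure on a complex `G` over `A` with the structure `s`: maps
`m^G_{p+1} : A₊[1]^{⊗ p} ⊗ G → G` of degree `-1` for `p ≥ 0`, given as multilinear maps. -/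
structure ModStr {A : ChainComplex (ModuleCat.{u} Q) ℕ} {e : A.X 0 ≃ₗ[Q] Q} (s : AlgStr A e)
    (G : ChainComplex (ModuleCat.{u} Q) ℕ) where
  /-- `mG p` is the structure map `m^G_{p+1}` -/
  mG : ∀ p : ℕ, MultilinearMap Q (fun _ : Fin p => PlusShift A) (Tot G →ₗ[Q] Tot G)
  /-- `m^G_{p+1}` has degree `-1` -/
  degree : ∀ (p : ℕ) (a : Fin p → ℕ) (x : ∀ l, A.X (a l + 1)) (q : ℕ) (g : G.X q) (t : ℕ),
    t + 1 ≠ ∑ l, (a l + 2) + q →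
    mG p (fun l => DirectSum.lof Q ℕ (fun i => A.X (i + 1)) (a l) (x l))
      (DirectSum.lof Q ℕ (fun i => G.X i) q g) t = 0
  m_one : ∀ x : Fin 0 → PlusShift A, mG 0 x = dTot G
  /-- `m^G_1 m^G_2 + m^G_2 (m_1 ⊗ 1 + 1 ⊗ m^G_1) = d₁ ⊗ 1` -/
  rel_two : ∀ (x : ℕ → PlusShift A) (g : Tot G), modSum s.m mG 1 x g = dOne A e (x 0) • g
  /-- the relation for `n = p + 1` -/
  rel : ∀ p : ℕ, 2 ≤ p → ∀ (x : ℕ → PlusShift A) (g : Tot G), modSum s.m mG p x g = 0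

/-- `m_n` as a linear map `A₊[1]^{⊗ n} → A₊[1]`. -/
noncomputable def AlgStr.lin {A : ChainComplex (ModuleCat.{u} Q) ℕ} {e : A.X 0 ≃ₗ[Q] Q}
    (s : AlgStr A e) (n : ℕ) : (⨂[Q] _ : Fin n, PlusShift A) →ₗ[Q] PlusShift A :=
  PiTensorProduct.lift (s.m n)

/-- `m^G_{p+1}` as a linear map `A₊[1]^{⊗ p} ⊗ G → G`. -/
noncomputable def ModStr.lin {A : ChainComplex (ModuleCat.{u} Q) ℕ} {e : A.X 0 ≃ₗ[Q] Q}
    {s : AlgStr A e} {G : ChainComplex (ModuleCat.{u} Q) ℕ} (t : ModStr s G) (p : ℕ) :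
    (⨂[Q] _ : Fin p, PlusShift A) ⊗[Q] Tot G →ₗ[Q] Tot G :=
  TensorProduct.lift (PiTensorProduct.lift (t.mG p))

/-- A linear map `φ : E → F` over a local ring `(Q, 𝔫)` is minimal if `φ(E) ⊆ 𝔫 F`. -/
def IsMinimalMap [IsLocalRing Q] {E F : Type*} [AddCommGroup E] [Module Q E] [AddCommGroup F]
    [Module Q F] (φ : E →ₗ[Q] F) : Prop :=
  LinearMap.range φ ≤ IsLocalRing.maximalIdeal Q • (⊤ : Submodule Q F)

/-- A complex over a local ring that consists of free modules and has minimal differentials.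
A minimal free resolution is a resolution whose complex has this property. -/
def IsMinimalFree [IsLocalRing Q] (C : ChainComplex (ModuleCat.{u} Q) ℕ) : Prop :=
  (∀ i, Module.Free Q (C.X i)) ∧ ∀ i, IsMinimalMap (C.d (i + 1) i).hom

end AInf

/-! ### Comparing resolutions: change of rings maps on homology, independent of choices -/

namespace TorChange

/-! Put `V = A₊[1]` and `W = G`. On the words `T(V) ⊗ W` the structure maps assemble into a bar
differential `D`: apply some `m_i` to consecutive letters, or some `m^G_i` to a final segment, with
Koszul signs. The A-infinity relations amount to `D² = δ`, where `δ` contracts the first letter with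
`d₁` (`BarData.D_D`). As `d₁` has image `I`, `D` becomes a differential over `R`.

Exactness comes from filtering words by the degree of the tail, that is, of what follows the first
letter. The leading part of `D` is `m₁` on the first letter (`D_cons_sub_mem_short`), and `A` is
exact in positive degrees, so the letters of a cycle can be removed tail degree by tail degree until
only a cycle of `G` is left (`exists_uncons_D_K`, `exists_D_eq`). Hence `R ⊗ T(V) ⊗ G` is an
`R`-free resolution of `M`, and its part in degrees at least `1` resolves `ΩM`.

Two inclusions compute the two maps. Words without letters form `G`, and their inclusion lifts the
identity of `M`; this gives `ν`. Call a word short if it has no letter, or one letter followed by an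
element of `G₀`. Short words are stable under `D`, and `δ` vanishes on them in degrees at least `1`,
so there they form a complex over `Q` itself, namely `G_{≥1} ⊕ A₊[1] ⊗ G₀`. It resolves `ΩM` over
`Q`, and its inclusion into the bar resolution gives `ν'`. After tensoring with `k`, injectivity of
`ν` and `ν'` becomes `WInjective` and `ShortInjective` for the maximal ideal.

If all structure maps vanish modulo the maximal ideal, so does `D`, and both conditions are
immediate. For the converse, `wordDiff_mem_idealWords` shows by induction on the degree that `D`
vanishes modulo the maximal ideal on every word. By induction, `D` of a word reduces to a
combination of short words (`wordDiff_sub_leading_mem`), which is a boundary in the bar complex. By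
`ShortInjective` it is then `D` of a short combination. But `D` vanishes on short words too: `d^G`
and `m₁` are minimal, and what `m^G_2` contributes is an element of `G` that becomes a boundary,
hence zero by `WInjective`. Finally, the structure maps are read off from the coefficients of `D`.
-/

theorem mono_comp_comp_comp_iff {C : Type*} [Category* C] {X Y Z W T : C} (i : X ≅ Y) (h : Y ⟶ Z)
    (j : Z ≅ W) (k : W ≅ T) : Mono (i.hom ≫ h ≫ j.hom ≫ k.hom) ↔ Mono h := by
  constructor
  · intro hm
    have : h = i.inv ≫ (i.hom ≫ h ≫ j.hom ≫ k.hom) ≫ (j ≪≫ k).inv := by simp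
    rw [this]
    infer_instance
  · intro hm
    infer_instance

section Homotopy

variable {C : Type*} [Category* C] [Abelian C]

/-- A morphism from a complex of projectives to an exact augmented complex that induces zero on
augmentations is null-homotopic. -/
theorem nonempty_homotopy_zero {P K : ChainComplex C ℕ} [∀ n, Projective (P.X n)] {Z : C}
    (ε : K.X 0 ⟶ Z) (hz : K.d 1 0 ≫ ε = 0) (h0 : (ShortComplex.mk _ _ hz).Exact)
    (hs : ∀ n, (ShortComplex.mk _ _ (K.d_comp_d (n + 2) (n + 1) n)).Exact)
    (f : P ⟶ K) (hf : f.f 0 ≫ ε = 0) : Nonempty (Homotopy f 0) := by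
  let z : P.X 0 ⟶ K.X 1 := h0.liftFromProjective (f.f 0) hf
  have hz' : z ≫ K.d 1 0 = f.f 0 := h0.liftFromProjective_comp _ _
  have h1 : (f.f 1 - P.d 1 0 ≫ z) ≫ K.d 1 0 = 0 := by
    rw [Preadditive.sub_comp, Category.assoc, hz', f.comm, sub_self]
  let o : P.X 1 ⟶ K.X 2 := (hs 0).liftFromProjective (f.f 1 - P.d 1 0 ≫ z) h1
  have ho : o ≫ K.d 2 1 = f.f 1 - P.d 1 0 ≫ z := (hs 0).liftFromProjective_comp _ _
  refine ⟨Homotopy.mkInductive _ z hz'.symm o ?_ fun n p =>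
    ⟨(hs (n + 1)).liftFromProjective (f.f (n + 2) - P.d _ _ ≫ p.2.1) ?_, ?_⟩⟩
  · rw [ho]; abel
  · obtain ⟨g, g', w⟩ := p
    simp only [Preadditive.sub_comp, Category.assoc]
    rw [f.comm, w]
    simp
  · have := (hs (n + 1)).liftFromProjective_comp (f.f (n + 2) - P.d _ _ ≫ p.2.1) (by
      obtain ⟨g, g', w⟩ := p
      simp only [Preadditive.sub_comp, Category.assoc]
      rw [f.comm, w]
      simp)
    erw [this]
    abel

end Homotopy

variable {Q R : Type u} [CommRing Q] [CommRing R] [Algebra Q R]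

/-- The map `P' ⊗_Q N → P' ⊗_R N`. -/
noncomputable def tensorComplexNat (P' : ChainComplex (ModuleCat.{u} R) ℕ) (N : ModuleCat.{u} R) :
    (((tensoringRight (ModuleCat.{u} Q)).obj ((res Q R).obj N)).mapHomologicalComplex _).obj
        (resComplex P') ⟶
      (((tensoringRight (ModuleCat.{u} R)).obj N ⋙ res Q R).mapHomologicalComplex _).obj P' :=
  (NatTrans.mapHomologicalComplex (tensorMap (Q := Q) N) _).app P'

theorem tensorComplexNat_naturality {P' P'' : ChainComplex (ModuleCat.{u} R) ℕ} (g : P' ⟶ P'')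
    (N : ModuleCat.{u} R) :
    (((tensoringRight (ModuleCat.{u} Q)).obj ((res Q R).obj N)).mapHomologicalComplex _).map
        (((res Q R).mapHomologicalComplex _).map g) ≫ tensorComplexNat P'' N =
      tensorComplexNat P' N ≫
        (((tensoringRight (ModuleCat.{u} R)).obj N ⋙ res Q R).mapHomologicalComplex _).map g :=
  (NatTrans.mapHomologicalComplex (tensorMap (Q := Q) N) (ComplexShape.down ℕ)).naturality g

/-- The map `P ⊗_Q N → P' ⊗_R N` induced by a morphism `φ : P → P'`. -/
noncomputable def tensorComplexMap {P : ChainComplex (ModuleCat.{u} Q) ℕ}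
    {P' : ChainComplex (ModuleCat.{u} R) ℕ} (φ : P ⟶ resComplex P') (N : ModuleCat.{u} R) :
    (((tensoringRight (ModuleCat.{u} Q)).obj ((res Q R).obj N)).mapHomologicalComplex _).obj P ⟶
      (((tensoringRight (ModuleCat.{u} R)).obj N ⋙ res Q R).mapHomologicalComplex _).obj P' :=
  (((tensoringRight (ModuleCat.{u} Q)).obj ((res Q R).obj N)).mapHomologicalComplex _).map φ ≫
    tensorComplexNat P' N

/-- Homotopy equivalences between the two pairs of resolutions make the square of lifts commute up
to homotopy, so the two maps on homology differ by isomorphisms. -/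
theorem homologyMap_tensorComplexMap_mono_iff {M : ModuleCat.{u} R}
    (P₁ P₂ : ProjectiveResolution ((res Q R).obj M)) (P₁' P₂' : ProjectiveResolution M)
    (φ₁ : P₁.complex ⟶ resComplex P₁'.complex) (φ₂ : P₂.complex ⟶ resComplex P₂'.complex)
    (h₁ : φ₁.f 0 ≫ resAug Q P₁' = aug P₁) (h₂ : φ₂.f 0 ≫ resAug Q P₂' = aug P₂)
    (N : ModuleCat.{u} R) (n : ℕ) :
    Mono (HomologicalComplex.homologyMap (tensorComplexMap φ₁ N) n) ↔
      Mono (HomologicalComplex.homologyMap (tensorComplexMap φ₂ N) n) := by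
  let f := ProjectiveResolution.homotopyEquiv P₁ P₂
  let g := ProjectiveResolution.homotopyEquiv P₁' P₂'
  let rg : resComplex (Q := Q) P₁'.complex ⟶ resComplex P₂'.complex :=
    ((res Q R).mapHomologicalComplex _).map g.hom
  have hf : f.hom.f 0 ≫ aug P₂ = aug P₁ :=
    HomologicalComplex.congr_hom (ProjectiveResolution.homotopyEquiv_hom_π P₁ P₂) 0
  have hg : g.hom.f 0 ≫ aug P₂' = aug P₁' :=
    HomologicalComplex.congr_hom (ProjectiveResolution.homotopyEquiv_hom_π P₁' P₂') 0
  have hrg : rg.f 0 ≫ resAug Q P₂' = resAug Q P₁' := by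
    show (res Q R).map (g.hom.f 0) ≫ (res Q R).map (aug P₂') = (res Q R).map (aug P₁')
    rw [← Functor.map_comp, hg]
  have hz : P₂'.complex.d 1 0 ≫ aug P₂' = 0 := P₂'.complex_d_comp_π_f_zero
  have he : (ShortComplex.mk _ _ hz).Exact := P₂'.exact₀
  have hz' : (resComplex (Q := Q) P₂'.complex).d 1 0 ≫ resAug Q P₂' = 0 := by
    show (res Q R).map (P₂'.complex.d 1 0) ≫ (res Q R).map (aug P₂') = 0
    rw [← Functor.map_comp, hz, Functor.map_zero]
  have h0 : (ShortComplex.mk _ _ hz').Exact := he.map (res Q R)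
  have hs : ∀ n, (ShortComplex.mk _ _
      ((resComplex (Q := Q) P₂'.complex).d_comp_d (n + 2) (n + 1) n)).Exact :=
    fun n => (P₂'.exact_succ n).map (res Q R)
  -- Both composites lift the identity of `M`, so their difference vanishes on augmentations.
  obtain ⟨H0⟩ := nonempty_homotopy_zero (resAug Q P₂') hz' h0 hs (φ₁ ≫ rg - f.hom ≫ φ₂) (by
    rw [HomologicalComplex.sub_f_apply, Preadditive.sub_comp, HomologicalComplex.comp_f,
      HomologicalComplex.comp_f, Category.assoc, Category.assoc, hrg, h₁, h₂, hf, sub_self])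
  have H : Homotopy (φ₁ ≫ rg) (f.hom ≫ φ₂) := Homotopy.equivSubZero.symm H0
  let T := (tensoringRight (ModuleCat.{u} Q)).obj ((res Q R).obj N)
  let T' := (tensoringRight (ModuleCat.{u} R)).obj N ⋙ res Q R
  let ef := T.mapHomotopyEquiv f
  let eg := T'.mapHomotopyEquiv g
  have H2 : Homotopy (tensorComplexMap φ₁ N ≫ eg.hom) (ef.hom ≫ tensorComplexMap φ₂ N) := by
    have e1 : tensorComplexMap φ₁ N ≫ eg.hom = (T.mapHomologicalComplex _).map (φ₁ ≫ rg) ≫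
        tensorComplexNat P₂'.complex N := by
      rw [Functor.map_comp, Category.assoc, tensorComplexMap, Category.assoc]
      congr 1
      exact (tensorComplexNat_naturality g.hom N).symm
    have e2 : ef.hom ≫ tensorComplexMap φ₂ N = (T.mapHomologicalComplex _).map (f.hom ≫ φ₂) ≫
        tensorComplexNat P₂'.complex N := by
      rw [Functor.map_comp, Category.assoc]
      rfl
    rw [e1, e2]
    exact (T.mapHomotopy H).compRight _
  have key := H2.homologyMap_eq n
  rw [HomologicalComplex.homologyMap_comp, HomologicalComplex.homologyMap_comp] at key
  have i1 : IsIso (HomologicalComplex.homologyMap ef.hom n) := (ef.toHomologyIso n).isIso_hom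
  have i2 : IsIso (HomologicalComplex.homologyMap eg.hom n) := (eg.toHomologyIso n).isIso_hom
  constructor
  · intro h
    have : HomologicalComplex.homologyMap (tensorComplexMap φ₂ N) n =
        inv (HomologicalComplex.homologyMap ef.hom n) ≫
        HomologicalComplex.homologyMap (tensorComplexMap φ₁ N) n ≫
        HomologicalComplex.homologyMap eg.hom n := by
      rw [key, IsIso.inv_hom_id_assoc]
    rw [this]
    infer_instance
  · intro h
    have : HomologicalComplex.homologyMap (tensorComplexMap φ₁ N) n =
        HomologicalComplex.homologyMap ef.hom n ≫
        HomologicalComplex.homologyMap (tensorComplexMap φ₂ N) n ≫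
        inv (HomologicalComplex.homologyMap eg.hom n) := by
      rw [← Category.assoc, ← key, Category.assoc, IsIso.hom_inv_id, Category.comp_id]
    rw [this]
    infer_instance

/-- The change of rings map is injective iff the map in homology induced by any lift, between any
resolutions, is. -/
theorem changeOfRings_injective_iff {M : ModuleCat.{u} R}
    (P : ProjectiveResolution ((res Q R).obj M)) (P' : ProjectiveResolution M)
    (φ : P.complex ⟶ resComplex P'.complex) (h : φ.f 0 ≫ resAug Q P' = aug P)
    (N : ModuleCat.{u} R) (n : ℕ) :
    Function.Injective (changeOfRings Q M N n) ↔
      Mono (HomologicalComplex.homologyMap (tensorComplexMap φ N) n) := by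
  rw [← homologyMap_tensorComplexMap_mono_iff _ _ _ _ _ _ (exists_lift M
    (projectiveResolution ((res Q R).obj M)) (projectiveResolution M)).choose_spec h N n]
  rw [← ModuleCat.mono_iff_injective]
  exact mono_comp_comp_comp_iff _ _ _ ((res Q R).mapIso _).symm

/-- Monomorphisms on homology are detected on cycles up to refinement, and for modules the
refinements can be traded for elements. The form `n = j + 1` makes the cycle condition empty in
degree `0`. -/
theorem mono_homologyMap_iff_elements {K L : ChainComplex (ModuleCat.{u} Q) ℕ} (ψ : K ⟶ L)
    (n : ℕ) : Mono (HomologicalComplex.homologyMap ψ n) ↔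
      ∀ x : K.X n, (∀ j, n = j + 1 → K.d n j x = 0) → ∀ y : L.X (n + 1),
        ψ.f n x = L.d (n + 1) n y → ∃ z : K.X (n + 1), K.d (n + 1) n z = x := by
  rw [HomologicalComplex.mono_homologyMap_iff_up_to_refinements ψ (n + 1) n
    ((ComplexShape.down ℕ).next n) (by simp) rfl]
  have hd : ∀ x : K.X n, (∀ j, n = j + 1 → K.d n j x = 0) →
      K.d n ((ComplexShape.down ℕ).next n) x = 0 := by
    intro x hx
    cases n with
    | zero =>
      rw [K.shape _ _ (by simp)]
      rfl
    | succ n =>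
      rw [ChainComplex.next_nat_succ]
      exact hx n rfl
  constructor
  · intro h x hx y hxy
    -- The elements `x` and `y` enter as maps out of the free module of rank one.
    obtain ⟨A', π, hπ, x₁, h1⟩ := h (A := ModuleCat.of Q (ULift.{u} Q))
      (ModuleCat.ofHom ((LinearMap.toSpanSingleton Q _ x) ∘ₗ ULift.moduleEquiv.toLinearMap))
      (ModuleCat.hom_ext (LinearMap.ext fun r => (map_smul (K.d n _).hom r.down x).trans
        ((congrArg _ (hd x hx)).trans (smul_zero _))))
      (ModuleCat.ofHom ((LinearMap.toSpanSingleton Q _ y) ∘ₗ ULift.moduleEquiv.toLinearMap))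
      (ModuleCat.hom_ext (LinearMap.ext fun r => (map_smul (ψ.f n).hom r.down x).trans
          ((congrArg _ hxy).trans (map_smul (L.d (n + 1) n).hom r.down y).symm)))
    obtain ⟨a, ha⟩ := (ModuleCat.epi_iff_surjective π).1 hπ ⟨1⟩
    refine ⟨x₁ a, ?_⟩
    have := ConcreteCategory.congr_hom h1 a
    rw [ModuleCat.comp_apply, ModuleCat.comp_apply, ha] at this
    rw [← this]
    exact one_smul Q x
  · intro h A x₂ hx y₁ hy
    have hz : ∀ a : A, ∃ z : K.X (n + 1), K.d (n + 1) n z = x₂ a := fun a =>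
      h (x₂ a) (fun j hj => by
        subst hj
        rw [ChainComplex.next_nat_succ] at hx
        exact ConcreteCategory.congr_hom hx a) (y₁ a) (ConcreteCategory.congr_hom hy a)
    choose z hz using hz
    -- The refinement is the free module on the underlying set of `A`, to which the pointwise choice
    -- `z` extends linearly.
    refine ⟨ModuleCat.of Q (A →₀ Q), ModuleCat.ofHom (Finsupp.linearCombination Q id), ?_,
      ModuleCat.ofHom (Finsupp.linearCombination Q z), ?_⟩
    · rw [ModuleCat.epi_iff_surjective]
      exact Finsupp.linearCombination_id_surjective Q A
    · apply ModuleCat.hom_ext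
      refine Finsupp.lhom_ext fun a r => ?_
      show x₂.hom (Finsupp.linearCombination Q id (Finsupp.single a r)) =
        (K.d (n + 1) n).hom (Finsupp.linearCombination Q z (Finsupp.single a r))
      rw [Finsupp.linearCombination_single, Finsupp.linearCombination_single, map_smul, map_smul]
      exact congrArg _ (hz a).symm

/-- Constructor for projective resolutions of modules, from exactness on elements. -/
noncomputable def resolutionOfExact {Z : ModuleCat.{u} Q} (K : ChainComplex (ModuleCat.{u} Q) ℕ)
    (hp : ∀ n, Projective (K.X n)) (ε : K.X 0 ⟶ Z) (hε : Function.Surjective ε)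
    (hz : K.d 1 0 ≫ ε = 0) (h0 : ∀ x, ε x = 0 → ∃ y, K.d 1 0 y = x)
    (h : ∀ n x, K.d (n + 1) n x = 0 → ∃ y, K.d (n + 2) (n + 1) y = x) :
    ProjectiveResolution Z where
  complex := K
  projective := hp
  π := (ChainComplex.toSingle₀Equiv _ _).symm ⟨ε, hz⟩
  quasiIso := ⟨fun n => by
    cases n with
    | zero =>
      have hf : ((ChainComplex.toSingle₀Equiv K Z).symm ⟨ε, hz⟩).f 0 = ε :=
        ChainComplex.toSingle₀Equiv_symm_apply_f_zero ε hz
      rw [ChainComplex.quasiIsoAt₀_iff, ShortComplex.quasiIso_iff_of_zeros']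
      · refine ⟨?_, ?_⟩
        · rw [ShortComplex.moduleCat_exact_iff]
          intro x hx
          exact h0 x ((ConcreteCategory.congr_hom hf x).symm.trans hx)
        · rw [ModuleCat.epi_iff_surjective]
          intro z
          obtain ⟨x, hx⟩ := hε z
          exact ⟨x, (ConcreteCategory.congr_hom hf x).trans hx⟩
      · exact K.shape _ _ (by simp)
      all_goals rfl
    | succ n =>
      rw [quasiIsoAt_iff_exactAt']
      · rw [HomologicalComplex.exactAt_iff' _ (n + 2) (n + 1) n (by simp) (by simp),
          ShortComplex.moduleCat_exact_iff]
        exact h n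
      · apply ChainComplex.exactAt_succ_single_obj⟩

theorem aug_resolutionOfExact {Z : ModuleCat.{u} Q} (K : ChainComplex (ModuleCat.{u} Q) ℕ)
    (hp : ∀ n, Projective (K.X n)) (ε : K.X 0 ⟶ Z) (hε : Function.Surjective ε)
    (hz : K.d 1 0 ≫ ε = 0) (h0 : ∀ x, ε x = 0 → ∃ y, K.d 1 0 y = x)
    (h : ∀ n x, K.d (n + 1) n x = 0 → ∃ y, K.d (n + 2) (n + 1) y = x) :
    aug (resolutionOfExact K hp ε hε hz h0 h) = ε :=
  ChainComplex.toSingle₀Equiv_symm_apply_f_zero ε hz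

theorem resolution_exact_zero {Z : ModuleCat.{u} Q} (P : ProjectiveResolution Z)
    (x : P.complex.X 0) (hx : aug P x = 0) : ∃ y, P.complex.d 1 0 y = x :=
  (ShortComplex.moduleCat_exact_iff _).1 P.exact₀ x hx

theorem resolution_exact_succ {Z : ModuleCat.{u} Q} (P : ProjectiveResolution Z) (n : ℕ)
    (x : P.complex.X (n + 1)) (hx : P.complex.d (n + 1) n x = 0) :
    ∃ y, P.complex.d (n + 2) (n + 1) y = x :=
  (ShortComplex.moduleCat_exact_iff _).1 (P.exact_succ n) x hx

theorem aug_surjective {Z : ModuleCat.{u} Q} (P : ProjectiveResolution Z) :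
    Function.Surjective (aug P) :=
  (ModuleCat.epi_iff_surjective (P.π.f 0)).1 inferInstance

theorem aug_d {Z : ModuleCat.{u} Q} (P : ProjectiveResolution Z) (x : P.complex.X 1) :
    aug P (P.complex.d 1 0 x) = 0 :=
  ConcreteCategory.congr_hom P.complex_d_comp_π_f_zero x

/-! ### Residue field coefficients in terms of elements -/

section ResidueField

open IsLocalRing TensorProduct

theorem exists_tmul_eq {S N X : Type*} [CommRing S] [AddCommGroup N] [Module S N]
    [AddCommGroup X] [Module S X] {o : N} (ho : ∀ a : N, ∃ s : S, s • o = a) (z : X ⊗[S] N) :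
    ∃ x : X, x ⊗ₜ[S] o = z := by
  induction z with
  | zero => exact ⟨0, TensorProduct.zero_tmul _ _⟩
  | tmul x a =>
    obtain ⟨s, rfl⟩ := ho a
    exact ⟨s • x, TensorProduct.smul_tmul _ _ _⟩
  | add a b ha hb =>
    obtain ⟨x, rfl⟩ := ha
    obtain ⟨y, rfl⟩ := hb
    exact ⟨x + y, TensorProduct.add_tmul _ _ _⟩

/-- The generator `o` identifies `N` with `S ⧸ I`, and `X ⊗ S ⧸ I` is `X ⧸ I X`. Working with a
generator covers the residue field of `R` over both rings, and also `R` as a `Q`-module. -/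
theorem tmul_eq_zero_iff_of_cyclic {S N X : Type*} [CommRing S] [AddCommGroup N] [Module S N]
    [AddCommGroup X] [Module S X] {o : N} (ho : ∀ a : N, ∃ s : S, s • o = a) {I : Ideal S}
    (hI : ∀ s : S, s • o = 0 ↔ s ∈ I) (x : X) :
    x ⊗ₜ[S] o = 0 ↔ x ∈ I • (⊤ : Submodule S X) := by
  have hker : LinearMap.ker (LinearMap.toSpanSingleton S N o) = I := by
    ext s
    exact hI s
  subst hker
  let e := LinearMap.quotKerEquivOfSurjective (LinearMap.toSpanSingleton S N o) ho
  let E := (TensorProduct.congr (LinearEquiv.refl S X) e.symm) ≪≫ₗ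
    TensorProduct.tensorQuotEquivQuotSMul X (LinearMap.ker (LinearMap.toSpanSingleton S N o))
  have he : e.symm o = Ideal.Quotient.mk _ 1 := by
    rw [LinearEquiv.symm_apply_eq]
    exact (one_smul S o).symm
  have : E (x ⊗ₜ o) = Submodule.Quotient.mk x := by
    rw [LinearEquiv.trans_apply, TensorProduct.congr_tmul, he,
      TensorProduct.tensorQuotEquivQuotSMul_tmul_mk, one_smul]
    rfl
  rw [← E.map_eq_zero_iff, this, Submodule.Quotient.mk_eq_zero]

/-- The map on homology after tensoring with the residue field, in terms of elements. -/
theorem mono_homologyMap_residueField_iff [IsLocalRing Q] [IsLocalRing R]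
    (hR : Function.Surjective (algebraMap Q R))
    {P : ChainComplex (ModuleCat.{u} Q) ℕ} {P' : ChainComplex (ModuleCat.{u} R) ℕ}
    (φ : P ⟶ resComplex P') (n : ℕ) :
    Mono (HomologicalComplex.homologyMap
      (tensorComplexMap φ (ModuleCat.of R (ResidueField R))) n) ↔
      ∀ x : P.X n,
        (∀ j, n = j + 1 → P.d n j x ∈ maximalIdeal Q • (⊤ : Submodule Q (P.X j))) →
        ∀ y : P'.X (n + 1),
          @HSub.hSub (P'.X n) (P'.X n) _ _ (φ.f n x) (P'.d (n + 1) n y) ∈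
            maximalIdeal R • (⊤ : Submodule R (P'.X n)) →
        ∃ z : P.X (n + 1), x - P.d (n + 1) n z ∈ maximalIdeal Q • (⊤ : Submodule Q (P.X n)) := by
  have hoR : ∀ a : ResidueField R, ∃ s : R, s • (1 : ResidueField R) = a := fun a => by
    obtain ⟨s, rfl⟩ := residue_surjective a
    exact ⟨s, by rw [Algebra.smul_def, mul_one]; rfl⟩
  have hIR : ∀ s : R, s • (1 : ResidueField R) = 0 ↔ s ∈ maximalIdeal R := fun s => by
    rw [Algebra.smul_def, mul_one]
    exact residue_eq_zero_iff s
  let o : (res Q R).obj (ModuleCat.of R (ResidueField R)) := (1 : ResidueField R)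
  have hoQ : ∀ a : (res Q R).obj (ModuleCat.of R (ResidueField R)), ∃ s : Q, s • o = a :=
    fun a => by
      obtain ⟨s, hs⟩ := hoR a
      obtain ⟨q, rfl⟩ := hR s
      exact ⟨q, hs⟩
  have : IsLocalHom (algebraMap Q R) := hR.isLocalHom
  have hIQ : ∀ s : Q, s • o = 0 ↔ s ∈ maximalIdeal Q := fun s =>
    (hIR (algebraMap Q R s)).trans (by
      rw [mem_maximalIdeal, mem_maximalIdeal, mem_nonunits_iff, mem_nonunits_iff,
        isUnit_map_iff])
  rw [mono_homologyMap_iff_elements]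
  have hφ : ∀ x : P.X n, (tensorComplexMap φ (ModuleCat.of R (ResidueField R))).f n
      (x ⊗ₜ[Q] o) = TensorProduct.tmul R (M := P'.X n) (φ.f n x) (1 : ResidueField R) :=
    fun x => ModuleCat.restrictScalars_μ_tmul (f := algebraMap Q R) (P'.X n)
      (ModuleCat.of R (ResidueField R)) (φ.f n x) (1 : ResidueField R)
  constructor
  · intro h x hx y hy
    obtain ⟨z, hz⟩ := h (x ⊗ₜ[Q] o) (fun j hj => (tmul_eq_zero_iff_of_cyclic hoQ hIQ _).2 (hx j hj))
      (y ⊗ₜ[R] (1 : ResidueField R)) (by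
        rw [hφ]
        refine sub_eq_zero.1 (Eq.trans ?_ ((tmul_eq_zero_iff_of_cyclic hoR hIR _).2 hy))
        exact (TensorProduct.sub_tmul _ _ _).symm)
    obtain ⟨z, rfl⟩ := exists_tmul_eq hoQ z
    refine ⟨z, (tmul_eq_zero_iff_of_cyclic hoQ hIQ _).1 ?_⟩
    rw [TensorProduct.sub_tmul, sub_eq_zero]
    exact hz.symm
  · intro h x hx y hy
    obtain ⟨x, rfl⟩ := exists_tmul_eq hoQ x
    obtain ⟨y, rfl⟩ := exists_tmul_eq hoR y
    obtain ⟨z, hz⟩ := h x (fun j hj => (tmul_eq_zero_iff_of_cyclic hoQ hIQ _).1 (hx j hj)) y (by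
      refine (tmul_eq_zero_iff_of_cyclic hoR hIR _).1 ?_
      refine (TensorProduct.sub_tmul (M := P'.X n) _ _ _).trans (sub_eq_zero.2 ?_)
      exact (hφ x).symm.trans hy)
    refine ⟨z ⊗ₜ[Q] o, Eq.symm (sub_eq_zero.1 ?_)⟩
    exact (TensorProduct.sub_tmul _ _ _).symm.trans ((tmul_eq_zero_iff_of_cyclic hoQ hIQ _).2 hz)

end ResidueField

end TorChange

/-! ### Reindexing of sums over splittings of a word -/

namespace Finset

theorem sum_antidiagonal_assoc {K : Type*} [AddCommMonoid K] (n : ℕ) (f : ℕ → ℕ → ℕ → K) :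
    ∑ p ∈ antidiagonal n, ∑ q ∈ antidiagonal p.1, f q.1 q.2 p.2 =
      ∑ p ∈ antidiagonal n, ∑ q ∈ antidiagonal p.2, f p.1 q.1 q.2 := by
  rw [sum_sigma', sum_sigma']
  refine sum_nbij' (fun x => ⟨(x.2.1, x.2.2 + x.1.2), (x.2.2, x.1.2)⟩)
    (fun x => ⟨(x.1.1 + x.2.1, x.2.2), (x.1.1, x.2.1)⟩) ?_ ?_ ?_ ?_ ?_
  all_goals
    rintro ⟨⟨a, b⟩, ⟨c, d⟩⟩ h
    simp only [mem_sigma, HasAntidiagonal.mem_antidiagonal, and_true] at h ⊢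
  · omega
  · omega
  · obtain ⟨h1, h2⟩ := h
    subst h2
    rfl
  · obtain ⟨h1, h2⟩ := h
    subst h2
    rfl

/-- Prefixes of a word of length `j + 1 + r` either stop before the letter in position `j` or
contain it. In the square of `D`, that letter is the output of the inner structure map. -/
theorem sum_antidiagonal_split {K : Type*} [AddCommMonoid K] (j r : ℕ) (f : ℕ → ℕ → K) :
    ∑ p ∈ antidiagonal (j + 1 + r), f p.1 p.2 =
      ∑ p ∈ antidiagonal j, f p.1 (p.2 + 1 + r) + ∑ p ∈ antidiagonal r, f (j + 1 + p.1) p.2 := by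
  induction j generalizing f with
  | zero =>
    rw [zero_add, add_comm 1 r, Nat.sum_antidiagonal_succ]
    simp [add_comm]
  | succ j ih =>
    rw [show j + 1 + 1 + r = (j + 1 + r) + 1 by omega, Nat.sum_antidiagonal_succ,
      Nat.sum_antidiagonal_succ, ih (fun a b => f (a + 1) b)]
    refine Eq.trans (add_assoc _ _ _).symm (congrArg₂ _ (congrArg₂ _ ?_ rfl) ?_)
    · have e : j + 1 + r + 1 = j + 1 + 1 + r := by omega
      dsimp only
      rw [e]
    · refine sum_congr rfl fun p _ => ?_
      have e : j + 1 + p.1 + 1 = j + 1 + 1 + p.1 := by omega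
      rw [e]

/-- Replaces the indices of an A-infinity relation by splittings of a word into the parts before,
inside and behind the inner operation. The extra terms with an empty inner part vanish by `hf`. -/
theorem sum_Icc_range_eq_sum_antidiagonal {K : Type*} [AddCommMonoid K] (n : ℕ) (f : ℕ → ℕ → ℕ → K)
    (hf : ∀ j c, f 0 j c = 0) :
    ∑ i ∈ Icc 1 n, ∑ j ∈ range (n - i + 1), f i j (n - i - j) =
      ∑ p ∈ antidiagonal n, ∑ q ∈ antidiagonal p.2, f q.1 p.1 q.2 := by
  have h1 : ∑ i ∈ Icc 1 n, ∑ j ∈ range (n - i + 1), f i j (n - i - j) =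
      ∑ i ∈ range (n + 1), ∑ j ∈ range (n - i + 1), f i j (n - i - j) := by
    refine sum_subset (fun i hi => ?_) fun i hi hi' => ?_
    · rw [mem_Icc] at hi
      rw [mem_range]
      omega
    · rw [mem_Icc] at hi'
      rw [mem_range] at hi
      have : i = 0 := by omega
      subst this
      simp [hf]
  rw [h1, sum_sigma', sum_sigma']
  refine sum_nbij' (fun x => ⟨(x.2, n - x.2), (x.1, n - x.1 - x.2)⟩)
    (fun x => ⟨x.2.1, x.1.1⟩) ?_ ?_ ?_ ?_ ?_
  · rintro ⟨a, b⟩ h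
    simp only [mem_sigma, HasAntidiagonal.mem_antidiagonal, mem_range] at h ⊢
    omega
  · rintro ⟨⟨a, b⟩, ⟨c, d⟩⟩ h
    simp only [mem_sigma, HasAntidiagonal.mem_antidiagonal, mem_range] at h ⊢
    omega
  · rintro ⟨a, b⟩ h
    rfl
  · rintro ⟨⟨a, b⟩, ⟨c, d⟩⟩ h
    simp only [mem_sigma, HasAntidiagonal.mem_antidiagonal] at h ⊢
    obtain ⟨rfl, rfl⟩ := h
    have e1 : a + (c + d) - a = c + d := by omega
    have e2 : a + (c + d) - c - a = d := by omega
    simp [e1, e2]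
  · rintro ⟨a, b⟩ h
    rfl

end Finset

namespace AInf

open Finset

/-! ### Multilinear functions of finitely many terms of a sequence -/

section SeqMultilinear

variable {Q : Type*} [CommRing Q] {V K L N : Type*} [AddCommGroup V] [Module Q V]
  [AddCommGroup K] [Module Q K] [AddCommGroup L] [Module Q L] [AddCommGroup N] [Module Q N]

variable (Q) in
/-- A function of a sequence that depends on the first `p` terms only, in a multilinear way. -/
def SeqMultilinear (p : ℕ) (F : (ℕ → V) → K) : Prop :=
  (∀ x y, (∀ i < p, x i = y i) → F x = F y) ∧
    ∀ x, ∀ i < p, ∃ f : V →ₗ[Q] K, ∀ v, F (Function.update x i v) = f v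

/-- The arguments are reduced to basis vectors one position at a time; `k` counts the leading
positions that are still arbitrary. -/
theorem SeqMultilinear.ext {ι : Type*} (b : Module.Basis ι Q V) {p : ℕ} {F F' : (ℕ → V) → K}
    (hF : SeqMultilinear Q p F) (hF' : SeqMultilinear Q p F')
    (h : ∀ l : List ι, l.length = p → ∀ x, (∀ i c, l[i]? = some c → x i = b c) → F x = F' x)
    (x : ℕ → V) : F x = F' x := by
  have key : ∀ k ≤ p, ∀ x : ℕ → V, (∀ i, k ≤ i → i < p → ∃ c, x i = b c) → F x = F' x := by
    intro k
    induction k with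
    | zero =>
      intro _ x hx
      have hx' : ∀ i : Fin p, ∃ c, x i = b c := fun i => hx i (Nat.zero_le _) i.2
      choose c hc using hx'
      refine h (List.ofFn c) (by simp) x fun i d hd => ?_
      rw [List.getElem?_eq_some_iff] at hd
      obtain ⟨hi, rfl⟩ := hd
      rw [List.length_ofFn] at hi
      simpa using hc ⟨i, hi⟩
    | succ k ih =>
      intro hk x hx
      obtain ⟨f, hf⟩ := hF.2 x k hk
      obtain ⟨f', hf'⟩ := hF'.2 x k hk
      have : f = f' := b.ext fun c => by
        rw [← hf, ← hf']
        refine ih (by omega) _ fun i hi hip => ?_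
        rcases eq_or_ne i k with rfl | hne
        · exact ⟨c, by simp⟩
        · rw [Function.update_of_ne hne]
          exact hx i (by omega) hip
      rw [← Function.update_eq_self k x, hf, hf', this]
  exact key p le_rfl x fun i h1 h2 => by omega

theorem seqMultilinear_multilinearMap (n : ℕ) (m : MultilinearMap Q (fun _ : Fin n => V) K) :
    SeqMultilinear Q n fun x => m fun l => x l := by
  refine ⟨fun x y h => ?_, fun x i hi => ⟨m.toLinearMap (fun l => x l) ⟨i, hi⟩, fun v => ?_⟩⟩
  · dsimp only
    congr 1
    exact funext fun l => h l l.2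
  · rw [MultilinearMap.toLinearMap_apply]
    dsimp only
    congr 1
    funext l
    rcases eq_or_ne l ⟨i, hi⟩ with rfl | hne
    · simp
    · rw [Function.update_of_ne hne, Function.update_of_ne]
      exact fun h => hne (Fin.ext h)

theorem SeqMultilinear.comp {p : ℕ} {F : (ℕ → V) → K} (hF : SeqMultilinear Q p F) (f : K →ₗ[Q] L) :
    SeqMultilinear Q p fun x => f (F x) := by
  refine ⟨fun x y h => by dsimp only; rw [hF.1 x y h], fun x i hi => ?_⟩
  obtain ⟨g, hg⟩ := hF.2 x i hi
  exact ⟨f ∘ₗ g, fun v => congrArg f (hg v)⟩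

theorem SeqMultilinear.sum {ι : Type*} {p : ℕ} {F : ι → (ℕ → V) → K} {s : Finset ι}
    (hF : ∀ i ∈ s, SeqMultilinear Q p (F i)) : SeqMultilinear Q p fun x => ∑ i ∈ s, F i x := by
  refine ⟨fun x y h => Finset.sum_congr rfl fun i hi => (hF i hi).1 x y h, fun x i hi => ?_⟩
  choose! f hf using fun j hj => (hF j hj).2 x i hi
  refine ⟨∑ j ∈ s, f j, fun v => ?_⟩
  rw [LinearMap.sum_apply]
  exact Finset.sum_congr rfl fun j hj => hf j hj v

theorem SeqMultilinear.add {p : ℕ} {F G : (ℕ → V) → K} (hF : SeqMultilinear Q p F)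
    (hG : SeqMultilinear Q p G) : SeqMultilinear Q p fun x => F x + G x := by
  refine ⟨fun x y h => by dsimp only; rw [hF.1 x y h, hG.1 x y h], fun x i hi => ?_⟩
  obtain ⟨f, hf⟩ := hF.2 x i hi
  obtain ⟨g, hg⟩ := hG.2 x i hi
  exact ⟨f + g, fun v => congrArg₂ (· + ·) (hf v) (hg v)⟩

/-- The factors read disjoint blocks of the sequence, so changing one term affects only one of them.
-/
theorem SeqMultilinear.mul {a r : ℕ} {F : (ℕ → V) → K} {G : (ℕ → V) → L}
    (hF : SeqMultilinear Q a F) (hG : SeqMultilinear Q r G) (B : K →ₗ[Q] L →ₗ[Q] N) :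
    SeqMultilinear Q (a + r) fun x => B (F x) (G fun t => x (a + t)) := by
  refine ⟨fun x y h => ?_, fun x i hi => ?_⟩
  · dsimp only
    rw [hF.1 x y fun i hi => h i (by omega), hG.1 _ _ fun i hi => h (a + i) (by omega)]
  · by_cases hia : i < a
    · obtain ⟨f, hf⟩ := hF.2 x i hia
      refine ⟨B.flip (G fun t => x (a + t)) ∘ₗ f, fun v => ?_⟩
      dsimp only
      rw [hf, hG.1 _ (fun t => x (a + t)) fun t _ => Function.update_of_ne (by omega) _ _]
      rfl
    · obtain ⟨g, hg⟩ := hG.2 (fun t => x (a + t)) (i - a) (by omega)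
      refine ⟨B (F x) ∘ₗ g, fun v => ?_⟩
      dsimp only
      rw [hF.1 (Function.update x i v) x fun t _ => Function.update_of_ne (by omega) _ _,
        LinearMap.comp_apply, ← hg]
      congr 2
      funext t
      rcases eq_or_ne (a + t) i with h | h
      · have : t = i - a := by omega
        subst this
        rw [h]; simp
      · rw [Function.update_of_ne h, Function.update_of_ne (by omega)]

theorem seqMultilinear_zero_const (k : K) : SeqMultilinear Q 0 fun _ : ℕ → V => k :=
  ⟨fun _ _ _ => rfl, fun _ i hi => absurd hi (Nat.not_lt_zero i)⟩

end SeqMultilinear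

end AInf

/-! ### The bar construction on words -/

namespace AInf

open Finset

/-- The data of an A-infinity algebra and module structure in terms of homogeneous bases, together
with the exactness of the underlying complexes. The letters `β` index a basis of `V = A₊[1]`, and
`γ` indexes a basis of the module `W`. -/
structure BarData (Q V W β γ : Type*) [CommRing Q] [AddCommGroup V] [Module Q V] [AddCommGroup W]
    [Module Q W] where
  bV : Module.Basis β Q V
  bW : Module.Basis γ Q W
  m : ∀ n : ℕ, MultilinearMap Q (fun _ : Fin n => V) V
  mG : ∀ n : ℕ, MultilinearMap Q (fun _ : Fin n => V) (W →ₗ[Q] W)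
  s : V →ₗ[Q] V
  d1 : V →ₗ[Q] Q
  m_zero : m 0 = 0
  s_s : ∀ v, s (s v) = v
  s_m : ∀ n (x : Fin n → V), s (m n x) = -m n fun l => s (x l)
  rel : ∀ n (x : ℕ → V), (∑ i ∈ Icc 1 n, ∑ j ∈ range (n - i + 1),
    m (n - i + 1) fun l => splice s x j i (m i fun t => x (j + t)) l) =
      if n = 2 then d1 (x 0) • x 1 - d1 (x 1) • x 0 else 0
  relG : ∀ p (x : ℕ → V) (g : W), (∑ i ∈ Icc 1 p, ∑ j ∈ range (p + 1 - i),
    mG (p + 1 - i) (fun l => splice s x j i (m i fun t => x (j + t)) l) g) +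
    ∑ j ∈ range (p + 1), mG j (fun l => s (x l)) (mG (p - j) (fun t => x (j + t)) g) =
      if p = 1 then d1 (x 0) • g else 0
  degV : β → ℕ
  degW : γ → ℕ
  two_le : ∀ b, 2 ≤ degV b
  m_deg : ∀ n (a : Fin n → β) c, bV.repr (m n fun l => bV (a l)) c ≠ 0 →
    degV c + 1 = ∑ l, degV (a l)
  mG_deg : ∀ n (a : Fin n → β) g c, bW.repr (mG n (fun l => bV (a l)) (bW g)) c ≠ 0 →
    degW c + 1 = ∑ l, degV (a l) + degW g
  s_basis : ∀ b, s (bV b) = (-1 : Q) ^ degV b • bV b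
  exact_V : ∀ v, m 1 (fun _ => v) = 0 → d1 v = 0 → ∃ v', m 1 (fun _ => v') = v ∧ d1 v' = 0
  exact_W : ∀ w, mG 0 Fin.elim0 w = 0 → (∀ c, degW c = 0 → bW.repr w c = 0) →
    ∃ w', mG 0 Fin.elim0 w' = w

namespace BarData

variable {Q V W β γ : Type*} [CommRing Q] [AddCommGroup V] [Module Q V] [AddCommGroup W]
    [Module Q W] (B : BarData Q V W β γ)

/-- The free module on words in the basis letters, that is, `T(V) ⊗ W`. -/
abbrev _root_.AInf.Words (Q β γ : Type*) [CommRing Q] : Type _ := (List β × γ) →₀ Q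

/-- The value of `m n` on the first `n` terms of a sequence. -/
def M (n : ℕ) (x : ℕ → V) : V := B.m n fun l => x l

/-- The value of `mG n` on the first `n` terms of a sequence. -/
def MG (n : ℕ) (x : ℕ → V) : W →ₗ[Q] W := B.mG n fun l => x l

/-- The inclusion of the empty words. -/
noncomputable def ι : W →ₗ[Q] Words Q β γ :=
  Finsupp.lmapDomain Q Q (fun c : γ => (([] : List β), c)) ∘ₗ B.bW.repr.toLinearMap

/-- Adding a letter in front of a word. -/
noncomputable def cons : V →ₗ[Q] Words Q β γ →ₗ[Q] Words Q β γ :=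
  B.bV.constr Q fun b => Finsupp.lmapDomain Q Q (fun l : List β × γ => (b :: l.1, l.2))

/-- Adding the first `p` terms of a sequence in front of a word. -/
noncomputable def pre : ℕ → (ℕ → V) → Words Q β γ →ₗ[Q] Words Q β γ
  | 0, _ => LinearMap.id
  | p + 1, x => B.cons (x 0) ∘ₗ pre p fun t => x (1 + t)

/-- The sequence of vectors given by a list of letters. -/
noncomputable def seq (l : List β) (i : ℕ) : V := (l[i]?).elim 0 B.bV

/-- `∑ m_i(x₀, …, x_{i-1}) ⊗ x_i ⊗ ⋯ ⊗ g + m^G(x₀, …, x_{p-1}, g)`. -/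
noncomputable def prefixForm (p : ℕ) (x : ℕ → V) (g : W) : Words Q β γ :=
  ∑ a ∈ antidiagonal p, B.cons (B.M a.1 x) (B.pre a.2 (fun t => x (a.1 + t)) (B.ι g)) +
    B.ι (B.MG p x g)

/-- The part of the bar differential where the structure maps are applied to a prefix. -/
noncomputable def P : Words Q β γ →ₗ[Q] Words Q β γ :=
  Finsupp.linearCombination Q fun l : List β × γ => B.prefixForm l.1.length (B.seq l.1) (B.bW l.2)

/-- The bar differential on basis words. -/
noncomputable def wordDiff : List β → γ → Words Q β γ
  | [], c => B.P (Finsupp.single ([], c) 1)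
  | b :: l, c => B.P (Finsupp.single (b :: l, c) 1) + B.cons (B.s (B.bV b)) (wordDiff l c)

/-- The bar differential. -/
noncomputable def D : Words Q β γ →ₗ[Q] Words Q β γ :=
  Finsupp.linearCombination Q fun l : List β × γ => B.wordDiff l.1 l.2

/-- Contraction of the first letter with `d1` on basis words. -/
noncomputable def wordContr : List β → γ → Words Q β γ
  | [], _ => 0
  | b :: l, c => B.d1 (B.bV b) • Finsupp.single (l, c) 1

/-- Contraction of the first letter with `d1`. -/
noncomputable def δ : Words Q β γ →ₗ[Q] Words Q β γ :=
  Finsupp.linearCombination Q fun l : List β × γ => B.wordContr l.1 l.2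

@[simp]
theorem ι_basis (c : γ) : B.ι (B.bW c) = Finsupp.single ([], c) 1 := by
  simp [ι, Finsupp.lmapDomain_apply, Finsupp.mapDomain_single]

@[simp]
theorem cons_basis (b : β) (l : List β × γ) (q : Q) :
    B.cons (B.bV b) (Finsupp.single l q) = Finsupp.single (b :: l.1, l.2) q := by
  simp [cons, Module.Basis.constr_basis, Finsupp.lmapDomain_apply, Finsupp.mapDomain_single]

theorem pre_succ (p : ℕ) (x : ℕ → V) (u : Words Q β γ) :
    B.pre (p + 1) x u = B.cons (x 0) (B.pre p (fun t => x (1 + t)) u) := rfl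

@[simp]
theorem pre_zero (x : ℕ → V) (u : Words Q β γ) : B.pre 0 x u = u := rfl

theorem pre_congr {p : ℕ} {x y : ℕ → V} (h : ∀ i < p, x i = y i) : B.pre p x = B.pre p y := by
  induction p generalizing x y with
  | zero => rfl
  | succ p ih =>
    rw [pre, pre, h 0 (Nat.succ_pos p), ih fun i hi => h (1 + i) (by omega)]

theorem M_congr {p : ℕ} {x y : ℕ → V} (h : ∀ i < p, x i = y i) : B.M p x = B.M p y :=
  congrArg (B.m p) (funext fun l => h l l.2)

theorem pre_add (i j : ℕ) (x : ℕ → V) (u : Words Q β γ) :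
    B.pre (i + j) x u = B.pre i x (B.pre j (fun t => x (i + t)) u) := by
  induction i generalizing x with
  | zero => simp
  | succ i ih =>
    rw [show i + 1 + j = (i + j) + 1 by omega, pre_succ, pre_succ, ih]
    simp only [show ∀ t, i + 1 + t = 1 + (i + t) by intro t; omega]

theorem pre_seq (l : List β) (x : ℕ → V) (hx : ∀ i c, l[i]? = some c → x i = B.bV c)
    (l' : List β) (c : γ) : B.pre l.length x (Finsupp.single (l', c) 1) =
      Finsupp.single (l ++ l', c) 1 := by
  induction l generalizing x with
  | nil => rfl
  | cons b l ih =>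
    rw [List.length_cons, pre_succ, hx 0 b rfl, ih]
    · simp
    · intro i c hc
      refine hx (1 + i) c ?_
      rwa [add_comm, List.getElem?_cons_succ]

theorem seq_spec (l : List β) (i : ℕ) (c : β) (h : l[i]? = some c) : B.seq l i = B.bV c := by
  simp [seq, h]

theorem pre_seq_basis (l : List β) (c : γ) :
    B.pre l.length (B.seq l) (B.ι (B.bW c)) = Finsupp.single (l, c) 1 := by
  rw [ι_basis, B.pre_seq l _ (B.seq_spec l), List.append_nil]

theorem seqMultilinear_M (n : ℕ) : SeqMultilinear Q n (B.M n) :=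
  seqMultilinear_multilinearMap n (B.m n)

theorem seqMultilinear_MG (n : ℕ) : SeqMultilinear Q n (B.MG n) :=
  seqMultilinear_multilinearMap n (B.mG n)

theorem seqMultilinear_pre (n : ℕ) (u : Words Q β γ) :
    SeqMultilinear Q n fun x => B.pre n x u := by
  induction n with
  | zero => exact seqMultilinear_zero_const u
  | succ n ih =>
    rw [add_comm]
    have h1 : SeqMultilinear Q 1 fun x : ℕ → V => x 0 :=
      ⟨fun x y h => h 0 one_pos, fun x i hi => ⟨LinearMap.id, fun v => by
        obtain rfl : i = 0 := by omega
        simp⟩⟩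
    have := h1.mul ih B.cons
    rw [add_comm 1 n] at this ⊢
    exact this

/-- `P` is defined on basis words, but both sides are multilinear in the letters and linear in `g`.
The formula is needed for arbitrary vectors because iterating `D` produces letters of the form
`m_i(…)`. -/
theorem P_pre (p : ℕ) (x : ℕ → V) (g : W) :
    B.P (B.pre p x (B.ι g)) = B.prefixForm p x g := by
  have h1 : ∀ g, SeqMultilinear Q p fun x => B.P (B.pre p x (B.ι g)) := fun g =>
    (B.seqMultilinear_pre p _).comp B.P
  have h2 : ∀ g, SeqMultilinear Q p fun x => B.prefixForm p x g := fun g => by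
    refine SeqMultilinear.add (SeqMultilinear.sum fun a ha => ?_)
      ((B.seqMultilinear_MG p).comp (B.ι ∘ₗ LinearMap.applyₗ g))
    rw [HasAntidiagonal.mem_antidiagonal] at ha
    rw [← ha]
    exact (B.seqMultilinear_M a.1).mul (B.seqMultilinear_pre a.2 (B.ι g)) B.cons
  have h3 : ∀ c, B.P (B.pre p x (B.ι (B.bW c))) = B.prefixForm p x (B.bW c) := by
    intro c
    refine (h1 (B.bW c)).ext B.bV (h2 (B.bW c)) (fun l hl x hx => ?_) x
    subst hl
    rw [ι_basis, B.pre_seq l x hx, List.append_nil, P, Finsupp.linearCombination_single, one_smul]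
    refine (h2 (B.bW c)).1 _ _ fun i hi => ?_
    have : l[i]? = some l[i] := List.getElem?_eq_getElem hi
    rw [hx i _ this, B.seq_spec l i _ this]
  let F : W →ₗ[Q] Words Q β γ :=
    ∑ a ∈ antidiagonal p, B.cons (B.M a.1 x) ∘ₗ B.pre a.2 (fun t => x (a.1 + t)) ∘ₗ B.ι +
      B.ι ∘ₗ B.MG p x
  have hF : ∀ g, F g = B.prefixForm p x g := fun g => by
    simp [F, prefixForm, LinearMap.sum_apply]
  rw [← hF]
  refine LinearMap.congr_fun (f := B.P ∘ₗ B.pre p x ∘ₗ B.ι) (B.bW.ext fun c => ?_) g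
  rw [hF]
  exact h3 c

@[simp]
theorem M_zero (x : ℕ → V) : B.M 0 x = 0 := by
  simp [M, B.m_zero]

theorem P_ι (x : ℕ → V) (g : W) : B.P (B.ι g) = B.ι (B.MG 0 x g) := by
  have := B.P_pre 0 x g
  rw [pre_zero] at this
  rw [this]
  simp [prefixForm]

theorem _root_.AInf.words_induction {p : Words Q β γ → Prop} (u : Words Q β γ)
    (h0 : ∀ l, p (Finsupp.single l 1)) (ha : ∀ u v, p u → p v → p (u + v))
    (hs : ∀ (q : Q) u, p u → p (q • u)) (hz : p 0) : p u := by
  induction u using Finsupp.induction_linear with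
  | zero => exact hz
  | add f g hf hg => exact ha f g hf hg
  | single a b =>
    have := hs b _ (h0 a)
    rwa [Finsupp.smul_single, smul_eq_mul, mul_one] at this

@[simp]
theorem D_single (l : List β × γ) : B.D (Finsupp.single l 1) = B.wordDiff l.1 l.2 := by
  simp [D]

theorem D_ι (x : ℕ → V) (g : W) : B.D (B.ι g) = B.ι (B.MG 0 x g) := by
  rw [← B.P_ι x]
  refine LinearMap.congr_fun (f := B.D ∘ₗ B.ι) (g := B.P ∘ₗ B.ι) (B.bW.ext fun c => ?_) g
  simp [wordDiff]

/-- An operation either starts at the first letter or acts behind it, and then passes that letter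
with a Koszul sign. -/
theorem D_cons (v : V) (u : Words Q β γ) :
    B.D (B.cons v u) = B.P (B.cons v u) + B.cons (B.s v) (B.D u) := by
  have : B.cons.compr₂ B.D = B.cons.compr₂ B.P + (B.cons ∘ₗ B.s).compl₂ B.D := by
    refine B.bV.ext fun b => Finsupp.lhom_ext' fun l => LinearMap.ext_ring ?_
    simp [wordDiff]
  exact LinearMap.congr_fun₂ this v u

theorem δ_cons (v : V) (u : Words Q β γ) : B.δ (B.cons v u) = B.d1 v • u := by
  have : B.cons.compr₂ B.δ = (LinearMap.lsmul Q (Words Q β γ)) ∘ₗ B.d1 := by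
    refine B.bV.ext fun b => Finsupp.lhom_ext' fun l => LinearMap.ext_ring ?_
    simp [δ, wordContr]
  exact LinearMap.congr_fun₂ this v u

@[simp]
theorem δ_ι (g : W) : B.δ (B.ι g) = 0 := by
  have : B.δ ∘ₗ B.ι = 0 := B.bW.ext fun c => by simp [δ, wordContr]
  exact LinearMap.congr_fun this g

/-- The terms of `D` are sorted by the number `a.1` of letters passed before the operation starts.
-/
theorem D_pre (p : ℕ) (x : ℕ → V) (g : W) : B.D (B.pre p x (B.ι g)) =
    ∑ a ∈ antidiagonal p, B.pre a.1 (fun t => B.s (x t))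
      (B.prefixForm a.2 (fun t => x (a.1 + t)) g) := by
  induction p generalizing x with
  | zero => simp [prefixForm, B.D_ι x]
  | succ p ih =>
    rw [Nat.sum_antidiagonal_succ, pre_succ, D_cons, ← pre_succ, P_pre, ih, map_sum]
    simp only [pre_succ, pre_zero, zero_add]
    congr 1
    refine sum_congr rfl fun a _ => ?_
    simp only [show ∀ t, a.1 + 1 + t = 1 + (a.1 + t) by intro t; omega]

end BarData

end AInf

/-! ### The square of the bar differential -/

namespace AInf

open Finset

namespace BarData

variable {Q V W β γ : Type*} [CommRing Q] [AddCommGroup V] [Module Q V] [AddCommGroup W]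
    [Module Q W] (B : BarData Q V W β γ)

theorem prefixForm_eq_add (p : ℕ) (x : ℕ → V) (g : W) : B.prefixForm p x g =
    ∑ a ∈ antidiagonal p, B.cons (B.M a.1 x) (B.pre a.2 (fun t => x (a.1 + t)) (B.ι g)) +
    B.ι (B.MG p x g) := rfl

theorem splice_lt {X : Type*} (s : X → X) (x : ℕ → X) (j i : ℕ) (y : X) {l : ℕ} (h : l < j) :
    splice s x j i y l = s (x l) := if_pos h

theorem splice_eq {X : Type*} (s : X → X) (x : ℕ → X) (j i : ℕ) (y : X) :
    splice s x j i y j = y := by simp [splice]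

theorem splice_gt {X : Type*} (s : X → X) (x : ℕ → X) (j i : ℕ) (y : X) (t : ℕ) :
    splice s x j i y (j + 1 + t) = x (j + i + t) := by
  rw [splice, if_neg (by omega), if_neg (by omega)]
  congr 1
  omega

/-- The sequence `s x₀, …, s x_{j-1}, m_i (x_j, …, x_{j+i-1}), x_{j+i}, …`. -/
def spl (x : ℕ → V) (j i : ℕ) : ℕ → V := splice B.s x j i (B.M i fun t => x (j + t))

theorem pre_spl_aux (x : ℕ → V) (j i a b r : ℕ) (h : a + b = j) (u : Words Q β γ) :
    B.pre (b + 1 + r) (fun t => B.spl x j i (a + t)) u =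
      B.pre b (fun t => B.s (x (a + t))) (B.cons (B.M i fun t => x (j + t))
        (B.pre r (fun t => x (j + i + t)) u)) := by
  rw [add_assoc, pre_add, add_comm 1 r, pre_succ]
  rw [B.pre_congr (x := fun t => B.spl x j i (a + t)) (y := fun t => B.s (x (a + t)))
    fun t ht => splice_lt _ _ _ _ _ (by omega)]
  have e1 : B.spl x j i (a + (b + 0)) = B.M i fun t => x (j + t) := by
    rw [add_zero, h]
    exact splice_eq _ _ _ _ _
  have e2 : ∀ t, B.spl x j i (a + (b + (1 + t))) = x (j + i + t) := fun t => by
    rw [show a + (b + (1 + t)) = j + 1 + t by omega]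
    exact splice_gt _ _ _ _ _ _
  simp only [e1, e2]

theorem pre_spl (x : ℕ → V) (j i r : ℕ) (u : Words Q β γ) :
    B.pre (j + 1 + r) (B.spl x j i) u =
      B.pre j (fun t => B.s (x t)) (B.cons (B.M i fun t => x (j + t))
        (B.pre r (fun t => x (j + i + t)) u)) := by
  have := B.pre_spl_aux x j i 0 j r (zero_add j) u
  simpa only [zero_add] using this

/-- The nested part of the square of the differential, for an algebra word. -/
def nested (n : ℕ) (x : ℕ → V) : V :=
  ∑ p ∈ antidiagonal n, ∑ q ∈ antidiagonal p.2, B.M (p.1 + 1 + q.2) (B.spl x p.1 q.1)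

/-- The nested part of the square of the differential, for a full word. -/
def nestedG (n : ℕ) (x : ℕ → V) (g : W) : W :=
  ∑ p ∈ antidiagonal n, ((∑ q ∈ antidiagonal p.2, B.MG (p.1 + 1 + q.2) (B.spl x p.1 q.1) g) +
    B.MG p.1 (fun t => B.s (x t)) (B.MG p.2 (fun t => x (p.1 + t)) g))

theorem M_spl_zero (x : ℕ → V) (j c : ℕ) : B.M (j + 1 + c) (B.spl x j 0) = 0 := by
  refine (B.m (j + 1 + c)).map_coord_zero ⟨j, by omega⟩ ?_
  rw [spl, M_zero]
  exact splice_eq _ _ _ _ _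

theorem MG_spl_zero (x : ℕ → V) (j c : ℕ) : B.MG (j + 1 + c) (B.spl x j 0) = 0 := by
  refine (B.mG (j + 1 + c)).map_coord_zero ⟨j, by omega⟩ ?_
  rw [spl, M_zero]
  exact splice_eq _ _ _ _ _

theorem nested_eq (n : ℕ) (x : ℕ → V) :
    B.nested n x = if n = 2 then B.d1 (x 0) • x 1 - B.d1 (x 1) • x 0 else 0 := by
  rw [← B.rel, nested, ← sum_Icc_range_eq_sum_antidiagonal n
    (fun i j c => B.M (j + 1 + c) (B.spl x j i)) (B.M_spl_zero x)]
  refine sum_congr rfl fun i hi => sum_congr rfl fun j hj => ?_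
  rw [mem_Icc] at hi
  rw [mem_range] at hj
  rw [show j + 1 + (n - i - j) = n - i + 1 by omega]
  rfl

theorem nestedG_eq (n : ℕ) (x : ℕ → V) (g : W) :
    B.nestedG n x g = if n = 1 then B.d1 (x 0) • g else 0 := by
  rw [← B.relG, nestedG, sum_add_distrib, ← sum_Icc_range_eq_sum_antidiagonal n
    (fun i j c => B.MG (j + 1 + c) (B.spl x j i) g) (fun j c => by rw [MG_spl_zero]; rfl)]
  congr 1
  · refine sum_congr rfl fun i hi => ?_
    rw [mem_Icc] at hi
    rw [show n - i + 1 = n + 1 - i by omega]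
    refine sum_congr rfl fun j hj => ?_
    rw [mem_range] at hj
    rw [show j + 1 + (n - i - j) = n + 1 - i by omega]
    rfl
  · rw [Nat.sum_antidiagonal_eq_sum_range_succ_mk]
    rfl

theorem s_M (n : ℕ) (x : ℕ → V) : B.s (B.M n x) = -B.M n fun t => B.s (x t) := B.s_m _ _

/-- The outer operation either stops before the letter produced by the inner one, which gives the
first sum, or takes it as an argument, which gives the nested terms. -/
theorem P_prefix (p : ℕ) (x : ℕ → V) (g : W) (j q : ℕ) (h : j + q = p) :
    B.P (B.pre j (fun t => B.s (x t)) (B.prefixForm q (fun t => x (j + t)) g)) =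
      ∑ a ∈ antidiagonal j, B.cons (B.M a.1 fun t => B.s (x t))
        (B.pre a.2 (fun t => B.s (x (a.1 + t))) (B.prefixForm q (fun t => x (j + t)) g)) +
      ∑ b ∈ antidiagonal q, ∑ c ∈ antidiagonal b.2, B.cons (B.M (j + 1 + c.1) (B.spl x j b.1))
        (B.pre c.2 (fun t => x (j + b.1 + c.1 + t)) (B.ι g)) +
      B.ι ((∑ b ∈ antidiagonal q, B.MG (j + 1 + b.2) (B.spl x j b.1) g) +
        B.MG j (fun t => B.s (x t)) (B.MG q (fun t => x (j + t)) g)) := by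
  have h1 : ∀ i r, B.P (B.pre (j + 1 + r) (B.spl x j i) (B.ι g)) =
      ∑ a ∈ antidiagonal j, B.cons (B.M a.1 fun t => B.s (x t))
        (B.pre a.2 (fun t => B.s (x (a.1 + t))) (B.cons (B.M i fun t => x (j + t))
        (B.pre r (fun t => x (j + i + t)) (B.ι g)))) +
      ∑ c ∈ antidiagonal r, B.cons (B.M (j + 1 + c.1) (B.spl x j i))
        (B.pre c.2 (fun t => x (j + i + c.1 + t)) (B.ι g)) +
      B.ι (B.MG (j + 1 + r) (B.spl x j i) g) := by
    intro i r
    rw [P_pre, prefixForm, sum_antidiagonal_split j r fun a b =>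
      B.cons (B.M a (B.spl x j i)) (B.pre b (fun t => B.spl x j i (a + t)) (B.ι g))]
    congr 2
    · refine sum_congr rfl fun a ha => ?_
      rw [HasAntidiagonal.mem_antidiagonal] at ha
      rw [B.pre_spl_aux x j i a.1 a.2 r ha]
      congr 2
      exact B.M_congr fun t ht => splice_lt _ _ _ _ _ (by omega)
    · refine sum_congr rfl fun c _ => ?_
      have : ∀ t, B.spl x j i (j + 1 + c.1 + t) = x (j + i + c.1 + t) := fun t => by
        rw [add_assoc (j + 1), add_assoc (j + i)]
        exact splice_gt _ _ _ _ _ _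
      simp only [this]
  have h2 : B.pre j (fun t => B.s (x t)) (B.prefixForm q (fun t => x (j + t)) g) =
      ∑ b ∈ antidiagonal q, B.pre (j + 1 + b.2) (B.spl x j b.1) (B.ι g) +
        B.pre j (fun t => B.s (x t)) (B.ι (B.MG q (fun t => x (j + t)) g)) := by
    rw [prefixForm, map_add, map_sum]
    congr 1
    refine sum_congr rfl fun b _ => ?_
    rw [pre_spl]
    simp only [add_assoc]
  rw [h2, map_add, map_sum, P_pre, prefixForm_eq_add]
  simp only [h1, sum_add_distrib, map_add, map_sum]
  have h3 : ∑ a ∈ antidiagonal j, B.cons (B.M a.1 fun t => B.s (x t))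
        (B.pre a.2 (fun t => B.s (x (a.1 + t))) (B.prefixForm q (fun t => x (j + t)) g)) =
      ∑ b ∈ antidiagonal q, ∑ a ∈ antidiagonal j, B.cons (B.M a.1 fun t => B.s (x t))
        (B.pre a.2 (fun t => B.s (x (a.1 + t))) (B.cons (B.M b.1 fun t => x (j + t))
        (B.pre b.2 (fun t => x (j + b.1 + t)) (B.ι g)))) +
      ∑ a ∈ antidiagonal j, B.cons (B.M a.1 fun t => B.s (x t))
        (B.pre a.2 (fun t => B.s (x (a.1 + t))) (B.ι (B.MG q (fun t => x (j + t)) g))) := by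
    rw [sum_comm, ← sum_add_distrib]
    refine sum_congr rfl fun a _ => ?_
    rw [prefixForm, map_add, map_add, map_sum, map_sum]
    simp only [add_assoc]
  rw [h3]
  abel

/-- Disjoint pairs of operations reassemble into an operation on a prefix followed by `D` of the
rest; nested pairs add up to the left sides of the A-infinity relations. -/
theorem P_D_pre (p : ℕ) (x : ℕ → V) (g : W) : B.P (B.D (B.pre p x (B.ι g))) =
    ∑ a ∈ antidiagonal p, B.cons (B.M a.1 fun t => B.s (x t))
      (B.D (B.pre a.2 (fun t => x (a.1 + t)) (B.ι g))) +
    ∑ a ∈ antidiagonal p, B.cons (B.nested a.1 x) (B.pre a.2 (fun t => x (a.1 + t)) (B.ι g)) +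
    B.ι (B.nestedG p x g) := by
  rw [D_pre, map_sum, sum_congr rfl fun a ha =>
    B.P_prefix p x g a.1 a.2 (HasAntidiagonal.mem_antidiagonal.1 ha), sum_add_distrib,
    sum_add_distrib, nestedG, map_sum]
  congr 2
  · have h1 : ∀ a ∈ antidiagonal p, B.cons (B.M a.1 fun t => B.s (x t))
        (B.D (B.pre a.2 (fun t => x (a.1 + t)) (B.ι g))) =
        ∑ b ∈ antidiagonal a.2, B.cons (B.M a.1 fun t => B.s (x t))
          (B.pre b.1 (fun t => B.s (x (a.1 + t)))
            (B.prefixForm b.2 (fun t => x (a.1 + b.1 + t)) g)) := fun a _ => by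
      rw [D_pre, map_sum]
      simp only [add_assoc]
    rw [sum_congr rfl h1, ← sum_antidiagonal_assoc p fun a b c => B.cons (B.M a fun t => B.s (x t))
          (B.pre b (fun t => B.s (x (a + t)))
            (B.prefixForm c (fun t => x (a + b + t)) g))]
    refine sum_congr rfl fun a _ => sum_congr rfl fun b hb => ?_
    rw [HasAntidiagonal.mem_antidiagonal.1 hb]
  · have h2 : ∀ a ∈ antidiagonal p,
        B.cons (B.nested a.1 x) (B.pre a.2 (fun t => x (a.1 + t)) (B.ι g)) =
        ∑ b ∈ antidiagonal a.1, ∑ c ∈ antidiagonal b.2,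
          B.cons (B.M (b.1 + 1 + c.2) (B.spl x b.1 c.1))
            (B.pre a.2 (fun t => x (b.1 + (c.1 + c.2) + t)) (B.ι g)) := fun a _ => by
      simp only [nested, map_sum, LinearMap.sum_apply]
      refine sum_congr rfl fun b hb => sum_congr rfl fun c hc => ?_
      rw [HasAntidiagonal.mem_antidiagonal.1 hc, HasAntidiagonal.mem_antidiagonal.1 hb]
    rw [sum_congr rfl h2, sum_antidiagonal_assoc p fun b e d => ∑ c ∈ antidiagonal e,
          B.cons (B.M (b + 1 + c.2) (B.spl x b c.1))
            (B.pre d (fun t => x (b + (c.1 + c.2) + t)) (B.ι g))]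
    refine sum_congr rfl fun a _ => ?_
    rw [sum_antidiagonal_assoc a.2 fun c e d =>
          B.cons (B.M (a.1 + 1 + e) (B.spl x a.1 c))
            (B.pre d (fun t => x (a.1 + (c + e) + t)) (B.ι g))]
    simp only [add_assoc]

/-- The minus sign is `s_M`: since `m_i` is odd, `D` passing its output picks up the sign that
cancels the disjoint pairs of `P_D_pre`. -/
theorem D_P_pre (p : ℕ) (x : ℕ → V) (g : W) : B.D (B.P (B.pre p x (B.ι g))) =
    B.P (B.P (B.pre p x (B.ι g))) - ∑ a ∈ antidiagonal p, B.cons (B.M a.1 fun t => B.s (x t))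
      (B.D (B.pre a.2 (fun t => x (a.1 + t)) (B.ι g))) := by
  rw [P_pre, prefixForm, map_add, map_add, map_sum, map_sum, B.D_ι x, B.P_ι x]
  simp only [D_cons, s_M, map_neg, LinearMap.neg_apply, sum_add_distrib, sum_neg_distrib]
  abel

/-- Once disjoint pairs cancel, the relations leave `(d₁(x₀) x₁ - d₁(x₁) x₀) ⊗ ⋯`, and induction on
the word behind `x₀` adds `x₀ ⊗ d₁(x₁) ⋯`. The last two terms cancel. For a single letter only
`d₁(x₀) g` occurs. -/
theorem D_D_pre (p : ℕ) (x : ℕ → V) (g : W) :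
    B.D (B.D (B.pre p x (B.ι g))) = B.δ (B.pre p x (B.ι g)) := by
  induction p generalizing x with
  | zero =>
    have := B.nestedG_eq 0 x g
    rw [pre_zero, B.D_ι x, B.D_ι x, δ_ι]
    simp only [nestedG, Nat.antidiagonal_zero, sum_singleton] at this
    have h0 : ∀ y, B.MG 0 y = B.MG 0 x := fun y => congrArg (B.mG 0) (Subsingleton.elim _ _)
    have h1 := B.MG_spl_zero x 0 0
    rw [h1] at this
    simp only [LinearMap.zero_apply, zero_add, h0, if_neg (show ¬ 0 = 1 by omega)] at this
    rw [this]
    simp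
  | succ p ih =>
    have h1 : B.D (B.pre (p + 1) x (B.ι g)) = B.P (B.pre (p + 1) x (B.ι g)) +
      B.cons (B.s (x 0)) (B.D (B.pre p (fun t => x (1 + t)) (B.ι g))) := by
      rw [pre_succ, D_cons]
    have h2 : B.D (B.D (B.pre (p + 1) x (B.ι g))) =
        B.P (B.D (B.pre (p + 1) x (B.ι g))) -
        ∑ a ∈ antidiagonal (p + 1), B.cons (B.M a.1 fun t => B.s (x t))
          (B.D (B.pre a.2 (fun t => x (a.1 + t)) (B.ι g))) +
        B.cons (x 0) (B.D (B.D (B.pre p (fun t => x (1 + t)) (B.ι g)))) := by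
      conv_lhs => rw [h1, map_add, D_P_pre, D_cons, B.s_s]
      conv_rhs => rw [h1, map_add]
      abel
    rw [h2, ih, P_D_pre, nestedG_eq, pre_succ, δ_cons]
    simp only [nested_eq]
    cases p with
    | zero => simp [Nat.sum_antidiagonal_succ]
    | succ p =>
      have h3 : ∑ a ∈ antidiagonal (p + 1 + 1),
          B.cons (if a.1 = 2 then B.d1 (x 0) • x 1 - B.d1 (x 1) • x 0 else 0)
            (B.pre a.2 (fun t => x (a.1 + t)) (B.ι g)) =
          B.cons (B.d1 (x 0) • x 1 - B.d1 (x 1) • x 0)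
            (B.pre p (fun t => x (2 + t)) (B.ι g)) := by
        rw [sum_eq_single (2, p)]
        · rw [if_pos rfl]
        · rintro ⟨a, b⟩ h h'
          rw [HasAntidiagonal.mem_antidiagonal] at h
          rw [if_neg, map_zero, LinearMap.zero_apply]
          rintro h2
          dsimp only at h2 h
          exact h' (by ext <;> dsimp only <;> omega)
        · intro h
          exact absurd (HasAntidiagonal.mem_antidiagonal.2 (by dsimp only; omega)) h
      have h4 : ∀ t, 1 + (1 + t) = 2 + t := fun t => by omega
      rw [h3, pre_succ, δ_cons, if_neg (show ¬ p + 1 + 1 = 1 by omega)]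
      simp only [map_sub, map_smul, LinearMap.sub_apply, LinearMap.smul_apply, map_zero, h4,
        add_zero]
      abel

theorem D_D (u : Words Q β γ) : B.D (B.D u) = B.δ u := by
  refine LinearMap.congr_fun (f := B.D ∘ₗ B.D) (Finsupp.lhom_ext' fun l => LinearMap.ext_ring ?_) u
  have := B.D_D_pre l.1.length (B.seq l.1) (B.bW l.2)
  rwa [pre_seq_basis] at this

end BarData

end AInf

/-! ### Acyclicity of the bar construction -/

namespace AInf

open Finset

namespace BarData

variable {Q V W β γ : Type*} [CommRing Q] [AddCommGroup V] [Module Q V] [AddCommGroup W]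
    [Module Q W] (B : BarData Q V W β γ)

/-! ### Coordinates -/

theorem ι_apply_nil (g : W) (c : γ) : B.ι g ([], c) = B.bW.repr g c := by
  have : Finsupp.lapply ([], c) ∘ₗ B.ι = Finsupp.lapply c ∘ₗ B.bW.repr.toLinearMap :=
    B.bW.ext fun d => by
      classical
      simp [Finsupp.single_apply]
  exact LinearMap.congr_fun this g

theorem ι_apply_cons (g : W) (b : β) (l : List β) (c : γ) : B.ι g (b :: l, c) = 0 := by
  have : Finsupp.lapply (b :: l, c) ∘ₗ B.ι = 0 :=
    B.bW.ext fun d => by simp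
  exact LinearMap.congr_fun this g

theorem ι_injective : Function.Injective B.ι := fun x y h => B.bW.repr.injective <|
  Finsupp.ext fun c => by rw [← ι_apply_nil, h, ι_apply_nil]

theorem cons_apply_nil (v : V) (u : Words Q β γ) (c : γ) : B.cons v u ([], c) = 0 := by
  have : B.cons.compr₂ (Finsupp.lapply (R := Q) ([], c)) = 0 := by
    refine B.bV.ext fun b => Finsupp.lhom_ext' fun l => LinearMap.ext_ring ?_
    simp
  exact LinearMap.congr_fun₂ this v u

theorem cons_apply_cons (v : V) (u : Words Q β γ) (b : β) (l : List β) (c : γ) :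
    B.cons v u (b :: l, c) = B.bV.repr v b * u (l, c) := by
  have : B.cons.compr₂ (Finsupp.lapply (R := Q) (b :: l, c)) =
      (LinearMap.mul Q Q).compl₁₂ (Finsupp.lapply b ∘ₗ B.bV.repr.toLinearMap)
        (Finsupp.lapply (l, c)) := by
    refine B.bV.ext fun b' => Finsupp.lhom_ext' fun l' => LinearMap.ext_ring ?_
    classical
    obtain ⟨l', c'⟩ := l'
    by_cases h : b' = b
    · subst h
      simp [Finsupp.single_apply]
    · simp [Finsupp.single_apply, h]
  exact LinearMap.congr_fun₂ this v u

/-- Splitting off the first letter. -/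
noncomputable def uncons : Words Q β γ →ₗ[Q] (List β × γ) →₀ V :=
  Finsupp.linearCombination Q fun l : List β × γ =>
    match l.1 with
    | [] => 0
    | b :: l' => Finsupp.single (l', l.2) (B.bV b)

/-- Putting a first letter in front. -/
noncomputable def K : ((List β × γ) →₀ V) →ₗ[Q] Words Q β γ :=
  Finsupp.lsum Q fun l => B.cons.flip (Finsupp.single l 1)

theorem repr_uncons (u : Words Q β γ) (b : β) (l : List β × γ) :
    B.bV.repr (B.uncons u l) b = u (b :: l.1, l.2) := by
  have : Finsupp.lapply b ∘ₗ B.bV.repr.toLinearMap ∘ₗ Finsupp.lapply l ∘ₗ B.uncons =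
      Finsupp.lapply (R := Q) (b :: l.1, l.2) := by
    refine Finsupp.lhom_ext' fun l' => LinearMap.ext_ring ?_
    classical
    obtain ⟨_ | ⟨b', l'⟩, c'⟩ := l'
    · simp [uncons]
    · obtain ⟨l, c⟩ := l
      by_cases h : (l', c') = (l, c)
      · obtain ⟨rfl, rfl⟩ := Prod.mk.inj h
        simp [uncons, Finsupp.single_apply]
      · have h' : ¬ (l' = l ∧ c' = c) := fun h' => h (Prod.ext h'.1 h'.2)
        have h'' : ¬ ((b' = b ∧ l' = l) ∧ c' = c) := fun h'' => h' ⟨h''.1.2, h''.2⟩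
        simp [uncons, h', h'']
  exact LinearMap.congr_fun this u

theorem uncons_cons (v : V) (u : Words Q β γ) (l : List β × γ) :
    B.uncons (B.cons v u) l = u l • v := B.bV.repr.injective <| Finsupp.ext fun b => by
  rw [repr_uncons, cons_apply_cons, map_smul, Finsupp.smul_apply, smul_eq_mul, mul_comm]

theorem uncons_ι (g : W) : B.uncons (B.ι g) = 0 := Finsupp.ext fun l =>
  B.bV.repr.injective <| Finsupp.ext fun b => by
    rw [repr_uncons, ι_apply_cons]
    simp

@[simp]
theorem K_single (l : List β × γ) (v : V) :
    B.K (Finsupp.single l v) = B.cons v (Finsupp.single l 1) := by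
  simp [K]

theorem K_eq_sum (h : (List β × γ) →₀ V) :
    B.K h = ∑ l ∈ h.support, B.cons (h l) (Finsupp.single l 1) := by
  conv_lhs => rw [← Finsupp.sum_single h, Finsupp.sum, map_sum]
  simp

theorem uncons_K (h : (List β × γ) →₀ V) : B.uncons (B.K h) = h := by
  have : B.uncons ∘ₗ B.K = LinearMap.id := by
    refine Finsupp.lhom_ext fun l v => Finsupp.ext fun l' => ?_
    classical
    by_cases hl : l = l'
    · subst hl
      simp [uncons_cons]
    · simp [uncons_cons, hl]
  exact LinearMap.congr_fun this h

theorem exists_eq_ι_add_K (u : Words Q β γ) : ∃ g, u = B.ι g + B.K (B.uncons u) := by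
  refine words_induction (p := fun u => ∃ g, u = B.ι g + B.K (B.uncons u)) u ?_ ?_ ?_ ?_
  · rintro ⟨_ | ⟨b, l⟩, c⟩
    · exact ⟨B.bW c, by simp [uncons]⟩
    · exact ⟨0, by simp [uncons]⟩
  · rintro u v ⟨g, hg⟩ ⟨g', hg'⟩
    refine ⟨g + g', ?_⟩
    conv_lhs => rw [hg, hg']
    simp only [map_add]
    abel
  · rintro q u ⟨g, hg⟩
    refine ⟨q • g, ?_⟩
    conv_lhs => rw [hg]
    simp only [map_smul, smul_add]
  · exact ⟨0, by simp⟩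

theorem δ_K_apply (h : (List β × γ) →₀ V) (l : List β × γ) : B.δ (B.K h) l = B.d1 (h l) := by
  have : Finsupp.lapply l ∘ₗ B.δ ∘ₗ B.K = B.d1 ∘ₗ Finsupp.lapply l := by
    refine Finsupp.lhom_ext fun l' v => ?_
    classical
    by_cases hl : l' = l
    · subst hl
      simp [δ_cons]
    · simp [δ_cons, hl]
  exact LinearMap.congr_fun this h

/-! ### Degrees -/

/-- The degree of a word. -/
def wdeg (l : List β × γ) : ℕ := (l.1.map B.degV).sum + B.degW l.2

theorem wdeg_cons (b : β) (l : List β × γ) : B.wdeg (b :: l.1, l.2) = B.degV b + B.wdeg l := by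
  simp [wdeg, add_assoc]

/-- Combinations of words of degree `n - k`. -/
def homog (k n : ℕ) : Submodule Q (Words Q β γ) := Finsupp.supported Q Q {l | B.wdeg l + k = n}

theorem mem_homog {k n : ℕ} {u : Words Q β γ} :
    u ∈ B.homog k n ↔ ∀ l, u l ≠ 0 → B.wdeg l + k = n := by
  rw [homog, Finsupp.mem_supported]
  exact ⟨fun h l hl => h (Finsupp.mem_support_iff.2 hl),
    fun h l hl => h l (Finsupp.mem_support_iff.1 hl)⟩

theorem cons_mem_homog {k k' a b : ℕ} {v : V} {u : Words Q β γ}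
    (hv : ∀ c, B.bV.repr v c ≠ 0 → B.degV c + k = a) (hu : u ∈ B.homog k' b) :
    B.cons v u ∈ B.homog (k + k') (a + b) := by
  rw [mem_homog] at hu ⊢
  rintro ⟨_ | ⟨b', l⟩, c⟩ h
  · exact absurd (B.cons_apply_nil v u c) h
  · rw [cons_apply_cons] at h
    have h1 := hv b' (left_ne_zero_of_mul h)
    have h2 := hu (l, c) (right_ne_zero_of_mul h)
    have := B.wdeg_cons b' (l, c)
    dsimp only at this
    omega

theorem ι_mem_homog {k a : ℕ} {g : W} (hg : ∀ c, B.bW.repr g c ≠ 0 → B.degW c + k = a) :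
    B.ι g ∈ B.homog k a := by
  rw [mem_homog]
  rintro ⟨_ | ⟨b', l⟩, c⟩ h
  · rw [ι_apply_nil] at h
    simpa [wdeg] using hg c h
  · exact absurd (B.ι_apply_cons g b' l c) h

theorem pre_mem_homog (p : ℕ) (x : ℕ → V) (d : ℕ → ℕ)
    (hx : ∀ i < p, ∀ c, B.bV.repr (x i) c ≠ 0 → B.degV c = d i) {k n : ℕ} {u : Words Q β γ}
    (hu : u ∈ B.homog k n) : B.pre p x u ∈ B.homog k (∑ i ∈ range p, d i + n) := by
  induction p generalizing x d with
  | zero => simpa using hu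
  | succ p ih =>
    rw [pre_succ, sum_range_succ', add_comm _ (d 0), add_assoc, ← zero_add k]
    refine B.cons_mem_homog (fun c hc => hx 0 (by omega) c hc) ?_
    refine ih _ (fun i => d (i + 1)) fun i hi c hc => ?_
    rw [add_comm 1 i] at hc
    exact hx (i + 1) (by omega) c hc

/-- The sequence of degrees of the letters of a list. -/
def dseq (l : List β) (i : ℕ) : ℕ := (l[i]?).elim 0 B.degV

theorem sum_dseq (l : List β) : ∑ i ∈ range l.length, B.dseq l i = (l.map B.degV).sum := by
  induction l with
  | nil => rfl
  | cons b l ih =>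
    rw [List.length_cons, sum_range_succ', List.map_cons, List.sum_cons, ← ih, add_comm]
    simp [dseq]

theorem repr_seq (l : List β) (i : ℕ) (c : β) (h : B.bV.repr (B.seq l i) c ≠ 0) :
    B.degV c = B.dseq l i := by
  unfold seq dseq at *
  cases hl : l[i]? with
  | none => simp [hl] at h
  | some b =>
    classical
    simp only [hl, Option.elim, Module.Basis.repr_self, Finsupp.single_apply] at h ⊢
    by_cases hb : b = c
    · rw [hb]
    · simp [hb] at h

theorem two_le_dseq (l : List β) (i : ℕ) (hi : i < l.length) : 2 ≤ B.dseq l i := by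
  simp [dseq, List.getElem?_eq_getElem hi, B.two_le]

theorem repr_M_seq (l : List β) (n : ℕ) (hn : n ≤ l.length) (c : β)
    (h : B.bV.repr (B.M n (B.seq l)) c ≠ 0) : B.degV c + 1 = ∑ i ∈ range n, B.dseq l i := by
  have hs : (fun i : Fin n => B.seq l i) = fun i : Fin n => B.bV (l[i.1]'(by omega)) :=
    funext fun i => B.seq_spec l i _ (List.getElem?_eq_getElem _)
  rw [M, hs] at h
  rw [B.m_deg n _ c h, ← Fin.sum_univ_eq_sum_range]
  refine Fintype.sum_congr _ _ fun i => ?_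
  simp [dseq, List.getElem?_eq_getElem (show i.1 < l.length by omega)]

theorem repr_MG_seq (l : List β) (c : γ) (d : γ)
    (h : B.bW.repr (B.MG l.length (B.seq l) (B.bW c)) d ≠ 0) :
    B.degW d + 1 = B.wdeg (l, c) := by
  have hs : (fun i : Fin l.length => B.seq l i) = fun i : Fin l.length => B.bV (l[i.1]) :=
    funext fun i => B.seq_spec l i _ (List.getElem?_eq_getElem _)
  rw [MG, hs] at h
  rw [B.mG_deg _ _ _ d h, wdeg, ← sum_dseq, ← Fin.sum_univ_eq_sum_range]
  congr 1
  refine Fintype.sum_congr _ _ fun i => ?_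
  simp [dseq]

theorem single_mem_homog (l : List β × γ) (q : Q) : Finsupp.single l q ∈ B.homog 0 (B.wdeg l) :=
  Finsupp.single_mem_supported _ _ rfl

theorem pre_seq_mem_homog (l : List β) (c : γ) (i r : ℕ) :
    B.pre r (fun t => B.seq l (i + t)) (B.ι (B.bW c)) ∈
      B.homog 0 (∑ t ∈ range r, B.dseq l (i + t) + B.degW c) := by
  refine B.pre_mem_homog r _ (fun t => B.dseq l (i + t)) (fun t _ b hb => B.repr_seq l _ b hb) ?_
  rw [ι_basis]
  have := B.single_mem_homog ([], c) (1 : Q)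
  simpa [wdeg] using this

theorem P_single (l : List β) (c : γ) : B.P (Finsupp.single (l, c) 1) =
    B.prefixForm l.length (B.seq l) (B.bW c) := by
  simp [P]

theorem P_mem_homog (l : List β) (c : γ) :
    B.P (Finsupp.single (l, c) 1) ∈ B.homog 1 (B.wdeg (l, c)) := by
  rw [P_single, prefixForm]
  refine Submodule.add_mem _ (Submodule.sum_mem _ fun a ha => ?_)
    (B.ι_mem_homog fun d hd => B.repr_MG_seq l c d hd)
  rw [HasAntidiagonal.mem_antidiagonal] at ha
  have := B.cons_mem_homog (B.repr_M_seq l a.1 (by omega)) (B.pre_seq_mem_homog l c a.1 a.2)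
  rwa [← add_assoc, ← sum_range_add, ha, sum_dseq] at this

theorem wordDiff_mem_homog (l : List β) (c : γ) : B.wordDiff l c ∈ B.homog 1 (B.wdeg (l, c)) := by
  induction l with
  | nil => exact B.P_mem_homog [] c
  | cons b l ih =>
    refine Submodule.add_mem _ (B.P_mem_homog (b :: l) c) ?_
    rw [s_basis, map_smul, LinearMap.smul_apply]
    have := B.wdeg_cons b (l, c)
    dsimp only at this
    rw [this, ← zero_add 1]
    refine Submodule.smul_mem _ _ (B.cons_mem_homog (fun d hd => ?_) ih)
    classical
    rw [Module.Basis.repr_self, Finsupp.single_apply] at hd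
    by_cases h : b = d
    · rw [h]; rfl
    · simp [h] at hd

theorem D_apply (u : Words Q β γ) (l' : List β × γ) :
    B.D u l' = ∑ l ∈ u.support, u l * B.wordDiff l.1 l.2 l' := by
  rw [D, Finsupp.linearCombination_apply, Finsupp.sum, Finsupp.finsetSum_apply]
  rfl

theorem D_apply_eq_zero (u : Words Q β γ) (l' : List β × γ)
    (h : ∀ l, B.wdeg l = B.wdeg l' + 1 → u l = 0) : B.D u l' = 0 := by
  rw [D_apply]
  refine sum_eq_zero fun l _ => ?_
  by_contra h0
  exact left_ne_zero_of_mul h0 (h l (B.mem_homog.1 (B.wordDiff_mem_homog l.1 l.2) l'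
    (right_ne_zero_of_mul h0)).symm)

theorem D_mem_homog {n : ℕ} {u : Words Q β γ} (hu : u ∈ B.homog 0 n) : B.D u ∈ B.homog 1 n := by
  rw [mem_homog] at hu ⊢
  intro l' hl'
  by_contra h
  refine hl' (B.D_apply_eq_zero u l' fun l hl => ?_)
  by_contra h0
  have := hu l h0
  omega

/-! ### The filtration by the degree of the tail -/

/-- Words whose tail (what follows the first letter) has degree less than `t`. -/
def IsShort (t : ℕ) : List β × γ → Prop
  | ([], _) => True
  | (_ :: l, c) => B.wdeg (l, c) < t

/-- Combinations of words whose tail has degree less than `t`. -/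
def short (t : ℕ) : Submodule Q (Words Q β γ) := Finsupp.supported Q Q {l | B.IsShort t l}

theorem mem_short {t : ℕ} {u : Words Q β γ} :
    u ∈ B.short t ↔ ∀ l, u l ≠ 0 → B.IsShort t l := by
  rw [short, Finsupp.mem_supported]
  exact ⟨fun h l hl => h (Finsupp.mem_support_iff.2 hl),
    fun h l hl => h l (Finsupp.mem_support_iff.1 hl)⟩

theorem mem_short_iff_uncons {t : ℕ} {u : Words Q β γ} :
    u ∈ B.short t ↔ ∀ l, t ≤ B.wdeg l → B.uncons u l = 0 := by
  rw [mem_short]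
  constructor
  · intro h l hl
    refine B.bV.repr.injective (Finsupp.ext fun b => ?_)
    rw [repr_uncons, map_zero, Finsupp.zero_apply]
    by_contra h0
    exact absurd (h _ h0) (not_lt.2 hl)
  · rintro h ⟨_ | ⟨b, l⟩, c⟩ hl
    · trivial
    · by_contra h0
      refine hl ?_
      have := B.repr_uncons u b (l, c)
      rw [h (l, c) (not_lt.1 h0)] at this
      simpa using this.symm

theorem short_mono {t t' : ℕ} (h : t ≤ t') : B.short t ≤ B.short t' := fun u hu => by
  rw [mem_short_iff_uncons] at hu ⊢
  exact fun l hl => hu l (h.trans hl)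

theorem ι_mem_short (t : ℕ) (g : W) : B.ι g ∈ B.short t := by
  rw [mem_short_iff_uncons, uncons_ι]
  exact fun _ _ => rfl

theorem K_mem_short {t : ℕ} {h : (List β × γ) →₀ V} :
    B.K h ∈ B.short t ↔ ∀ l, t ≤ B.wdeg l → h l = 0 := by
  rw [mem_short_iff_uncons, uncons_K]

theorem cons_mem_short {t n k : ℕ} {u : Words Q β γ} (v : V) (hu : u ∈ B.homog k n)
    (hn : n < t + k) : B.cons v u ∈ B.short t := by
  rw [mem_short_iff_uncons]
  intro l hl
  rw [uncons_cons]
  by_cases h : u l = 0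
  · rw [h, zero_smul]
  · have := B.mem_homog.1 hu l h
    omega

/-- The operation `m 1` as a linear map. -/
def M1 : V →ₗ[Q] V := (MultilinearMap.ofSubsingleton Q V V (0 : Fin 1)).symm (B.m 1)

theorem M_one (x : ℕ → V) : B.M 1 x = B.M1 (x 0) := by
  refine congrArg (B.m 1) (funext fun i => ?_)
  rw [Subsingleton.elim i 0]
  rfl

/-- Every other term of `D` lowers the tail degree: `m_i` with `i ≥ 2` absorbs letters of degree at
least `2` from the tail, operations behind the first letter lower the tail by one degree, and `m^G`
on the whole word leaves no letter. So the leading part of `D` for this filtration is `m₁ ⊗ 1`. -/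
theorem D_cons_sub_mem_short (v : V) (l : List β × γ) :
    B.D (B.cons v (Finsupp.single l 1)) - B.cons (B.M1 v) (Finsupp.single l 1) ∈
      B.short (B.wdeg l) := by
  obtain ⟨l, c⟩ := l
  let F : V →ₗ[Q] Words Q β γ := (B.cons.compr₂ B.D).flip (Finsupp.single (l, c) 1) -
    B.cons.flip (Finsupp.single (l, c) 1) ∘ₗ B.M1
  suffices h : ∀ b, F (B.bV b) ∈ B.short (B.wdeg (l, c)) by
    change F v ∈ _
    rw [← B.bV.linearCombination_repr v, Finsupp.linearCombination_apply, Finsupp.sum, map_sum]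
    refine Submodule.sum_mem _ fun b _ => ?_
    rw [map_smul]
    exact Submodule.smul_mem _ _ (h b)
  intro b
  change B.D (B.cons (B.bV b) (Finsupp.single (l, c) 1)) -
    B.cons (B.M1 (B.bV b)) (Finsupp.single (l, c) 1) ∈ _
  have hseq : ∀ t, B.seq (b :: l) (1 + t) = B.seq l t := fun t => by
    rw [add_comm]
    rfl
  have hmain : B.pre l.length (fun t => B.seq (b :: l) (0 + 1 + t)) (B.ι (B.bW c)) =
      Finsupp.single (l, c) 1 := by
    simp only [zero_add, hseq]
    exact B.pre_seq_basis l c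
  rw [D_cons, cons_basis, P_single, prefixForm, List.length_cons, Nat.sum_antidiagonal_succ,
    M_zero, map_zero, LinearMap.zero_apply, zero_add, D_single]
  dsimp only
  have h0 : ((0, l.length) : ℕ × ℕ) ∈ antidiagonal l.length :=
    HasAntidiagonal.mem_antidiagonal.2 (zero_add _)
  classical
  rw [← add_sum_erase _ _ h0]
  dsimp only
  rw [hmain, zero_add, M_one, show B.seq (b :: l) 0 = B.bV b from rfl]
  have h1 : ∑ x ∈ (antidiagonal l.length).erase (0, l.length),
      B.cons (B.M (x.1 + 1) (B.seq (b :: l)))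
        (B.pre x.2 (fun t => B.seq (b :: l) (x.1 + 1 + t)) (B.ι (B.bW c))) ∈
      B.short (B.wdeg (l, c)) := by
    refine Submodule.sum_mem _ fun a ha => ?_
    rw [mem_erase, HasAntidiagonal.mem_antidiagonal] at ha
    refine B.cons_mem_short _ (B.pre_seq_mem_homog (b :: l) c (a.1 + 1) a.2) ?_
    have ha1 : a.1 ≠ 0 := fun h => ha.1 (by ext <;> dsimp only <;> omega)
    obtain ⟨i, hi⟩ := Nat.exists_eq_succ_of_ne_zero ha1
    have e1 := sum_range_add (B.dseq (b :: l)) (a.1 + 1) a.2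
    rw [show a.1 + 1 + a.2 = (b :: l).length by simp; omega, sum_dseq, hi, sum_range_succ',
      sum_range_succ'] at e1
    have e2 := B.two_le_dseq (b :: l) 1 (by simp; omega)
    have e3 : B.dseq (b :: l) 0 = B.degV b := rfl
    simp only [List.map_cons, List.sum_cons, zero_add, e3] at e1
    rw [hi]
    dsimp only [wdeg]
    omega
  have h2 := B.ι_mem_short (B.wdeg (l, c)) (B.MG (l.length + 1) (B.seq (b :: l)) (B.bW c))
  have h3 : B.cons (B.s (B.bV b)) (B.wordDiff l c) ∈ B.short (B.wdeg (l, c)) :=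
    B.cons_mem_short _ (B.wordDiff_mem_homog l c) (by omega)
  have := Submodule.add_mem _ (Submodule.add_mem _ h1 h2) h3
  convert this using 1
  abel

/-- By maximality of the tail degree of `l`, all contributions to `l` come from leading parts, and
only the summand with tail `l` itself has one there. -/
theorem uncons_D_K_apply (h : (List β × γ) →₀ V) (l : List β × γ)
    (hl : ∀ l', B.wdeg l < B.wdeg l' → h l' = 0) : B.uncons (B.D (B.K h)) l = B.M1 (h l) := by
  have h1 : ∀ l' ∈ h.support, B.uncons (B.D (B.cons (h l') (Finsupp.single l' 1))) l =
      Finsupp.single l' (1 : Q) l • B.M1 (h l') := fun l' hl' => by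
    have h2 := B.mem_short_iff_uncons.1 (B.D_cons_sub_mem_short (h l') l') l (by
      by_contra h3
      exact Finsupp.mem_support_iff.1 hl' (hl l' (not_le.1 h3)))
    rwa [map_sub, Finsupp.sub_apply, sub_eq_zero, uncons_cons] at h2
  rw [K_eq_sum, map_sum, map_sum, Finsupp.finsetSum_apply, sum_congr rfl h1]
  classical
  rw [sum_eq_single l]
  · simp
  · intro l' _ hne
    rw [Finsupp.single_eq_of_ne hne.symm, zero_smul]
  · intro hl
    rw [Finsupp.notMem_support_iff.1 hl]
    simp

theorem D_mem_short {t : ℕ} {u : Words Q β γ} (hu : u ∈ B.short t) : B.D u ∈ B.short t := by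
  obtain ⟨g, hg⟩ := B.exists_eq_ι_add_K u
  rw [hg, map_add, B.D_ι 0, K_eq_sum, map_sum]
  refine Submodule.add_mem _ (B.ι_mem_short t _) (Submodule.sum_mem _ fun l hl => ?_)
  have hlt : B.wdeg l < t := by
    by_contra h
    exact Finsupp.mem_support_iff.1 hl (B.mem_short_iff_uncons.1 hu l (not_lt.1 h))
  have := Submodule.add_mem _ (B.short_mono hlt.le (B.D_cons_sub_mem_short (B.uncons u l) l))
    (B.cons_mem_short (B.M1 (B.uncons u l)) (B.single_mem_homog l 1) (by omega))
  simpa using this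

/-! ### Exactness -/

theorem D_δ (u : Words Q β γ) : B.D (B.δ u) = B.δ (B.D u) := by
  rw [← D_D, ← D_D]

/-- The choice is normalised at `0` so that it can be applied to the values of a finitely supported
function. -/
theorem exists_section_M1 : ∃ c : V → V, c 0 = 0 ∧
    ∀ v, B.M1 v = 0 → B.d1 v = 0 → B.M1 (c v) = v ∧ B.d1 (c v) = 0 := by
  classical
  have h : ∀ v, ∃ w, B.M1 v = 0 → B.d1 v = 0 → B.M1 w = v ∧ B.d1 w = 0 := fun v => by
    by_cases hv : B.M1 v = 0 ∧ B.d1 v = 0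
    · obtain ⟨w, hw⟩ := B.exact_V v hv.1 hv.2
      exact ⟨w, fun _ _ => hw⟩
    · exact ⟨0, fun h1 h2 => absurd ⟨h1, h2⟩ hv⟩
  choose c hc using h
  refine ⟨fun v => if v = 0 then 0 else c v, if_pos rfl, fun v h1 h2 => ?_⟩
  by_cases hv : v = 0
  · simp [hv]
  · simpa [hv] using hc v h1 h2

/-- Coefficients at tails of the highest degree `t` are killed by both `m₁` and `d₁`, so exactness
of `A` yields preimages. Correcting by `D` of these preimages lowers the bound on the tails. -/
theorem exists_uncons_D_K (t : ℕ) (h : (List β × γ) →₀ V) (ht : ∀ l, t ≤ B.wdeg l → h l = 0)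
    (hδ : B.δ (B.K h) = 0) (hD : B.uncons (B.D (B.K h)) = 0) :
    ∃ h', (∀ l, t ≤ B.wdeg l → h' l = 0) ∧ B.δ (B.K h') = 0 ∧ h + B.uncons (B.D (B.K h')) = 0 := by
  classical
  induction t generalizing h with
  | zero =>
    have : h = 0 := Finsupp.ext fun l => ht l (Nat.zero_le _)
    subst this
    exact ⟨0, fun _ _ => rfl, by simp, by simp⟩
  | succ t ih =>
    obtain ⟨c, hc0, hc⟩ := B.exists_section_M1
    have hd : ∀ l, B.d1 (h l) = 0 := fun l => by rw [← δ_K_apply, hδ]; rfl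
    have hm : ∀ l, B.wdeg l = t → B.M1 (h l) = 0 := fun l hl => by
      rw [← B.uncons_D_K_apply h l fun l' hl' => ht l' (by omega), hD]
      rfl
    -- Minus the chosen preimages at tails of degree `t`, and zero elsewhere.
    let k : (List β × γ) →₀ V :=
      (h.filter fun l => B.wdeg l = t).mapRange (fun v => -c v) (by simp [hc0])
    have hk1 : ∀ l, B.wdeg l = t → k l = -c (h l) := fun l hl => by
      simp [k, hl]
    have hk2 : ∀ l, B.wdeg l ≠ t → k l = 0 := fun l hl => by
      simp [k, hl, hc0]
    have hδk : B.δ (B.K k) = 0 := Finsupp.ext fun l => by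
      rw [δ_K_apply]
      by_cases hl : B.wdeg l = t
      · rw [hk1 l hl, map_neg, (hc _ (hm l hl) (hd l)).2, neg_zero]
        rfl
      · rw [hk2 l hl, map_zero]
        rfl
    obtain ⟨g, hg⟩ := B.exists_eq_ι_add_K (B.D (B.K k))
    have hg' : B.K (B.uncons (B.D (B.K k))) = B.D (B.K k) - B.ι g := by
      conv_rhs => rw [hg]
      abel
    -- The correction cancels the coefficients at tails of degree `t`; the two hypotheses survive it
    -- by `D_δ` and `D_D`, since `δ (K k) = 0`.
    obtain ⟨h', ht', hδ', hh'⟩ := ih (h + B.uncons (B.D (B.K k))) (fun l hl => by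
        rw [Finsupp.add_apply, B.uncons_D_K_apply k l fun l' hl' => hk2 l' (by omega)]
        rcases eq_or_ne (B.wdeg l) t with h1 | h1
        · rw [hk1 l h1, map_neg, (hc _ (hm l h1) (hd l)).1, add_neg_cancel]
        · rw [hk2 l h1, ht l (by omega), map_zero, add_zero]) (by
        rw [map_add, map_add, hδ, hg', map_sub, ← D_δ, hδk, δ_ι]
        simp) (by
        rw [map_add, map_add, map_add, hD, hg', map_sub, map_sub, D_D, hδk, B.D_ι 0, uncons_ι]
        simp)
    refine ⟨k + h', fun l hl => ?_, ?_, ?_⟩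
    · rw [Finsupp.add_apply, hk2 l (by omega), ht' l (by omega), add_zero]
    · rw [map_add, map_add, hδk, hδ', add_zero]
    · rw [map_add, map_add, map_add, ← add_assoc, hh']

/-- Exactness of the bar complex modulo the image of `d1`, and of the pieces of the filtration. -/
theorem exists_D_eq (t : ℕ) (u : Words Q β γ) (hu : u ∈ B.short t) (h : (List β × γ) →₀ V)
    (ht : ∀ l, t ≤ B.wdeg l → h l = 0) (hD : B.D u + B.δ (B.K h) = 0)
    (h0 : ∀ l, B.wdeg l = 0 → u l = 0) : ∃ u' ∈ B.short t, B.D u' = u := by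
  -- Since `D (D (K h)) = δ (K h)`, this correction makes `u` a cycle without any error term.
  let w := u + B.D (B.K h)
  obtain ⟨g, hg⟩ := B.exists_eq_ι_add_K w
  have hg' : B.K (B.uncons w) = w - B.ι g := by
    conv_rhs => rw [hg]
    abel
  have hDw : B.D w = 0 := by rw [map_add, D_D, hD]
  have hw : w ∈ B.short t := Submodule.add_mem _ hu (B.D_mem_short (B.K_mem_short.2 ht))
  obtain ⟨h', ht', hδ', hh'⟩ := B.exists_uncons_D_K t (B.uncons w) (B.mem_short_iff_uncons.1 hw)
    (by rw [hg', map_sub, ← D_D, hDw, δ_ι]; simp)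
    (by rw [hg', map_sub, map_sub, hDw, B.D_ι 0, uncons_ι]; simp)
  -- All letters have now been removed, so `x` comes from a cycle of `W`.
  let x := w + B.D (B.K h')
  obtain ⟨g0, hx⟩ := B.exists_eq_ι_add_K x
  rw [show B.uncons x = 0 by rw [map_add, hh'], map_zero, add_zero] at hx
  have hDx : B.D x = 0 := by rw [map_add, hDw, D_D, hδ', add_zero]
  -- A word with a letter has degree at least `2`, so its differential does not reach degree `0`;
  -- the corrections therefore respect `h0`.
  have hKzero : ∀ (k : (List β × γ) →₀ V) (c : γ), B.degW c = 0 → B.D (B.K k) ([], c) = 0 := by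
    intro k c hc
    refine B.D_apply_eq_zero _ _ ?_
    rintro ⟨_ | ⟨b, l⟩, c'⟩ hl
    · rw [K_eq_sum, Finsupp.finsetSum_apply]
      exact sum_eq_zero fun l _ => B.cons_apply_nil _ _ _
    · have h1 := B.wdeg_cons b (l, c')
      have h2 := B.two_le b
      have h3 : B.wdeg ([], c) = 0 := by simp [wdeg, hc]
      dsimp only at h1
      omega
  have hG : B.MG 0 0 g0 = 0 := B.ι_injective (by rw [← B.D_ι 0, ← hx, hDx, map_zero])
  have hMG : ∀ g, B.MG 0 0 g = B.mG 0 Fin.elim0 g := fun g => by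
    have : (fun l : Fin 0 => (0 : ℕ → V) l) = Fin.elim0 := Subsingleton.elim _ _
    rw [MG, this]
  obtain ⟨g', hg'⟩ := B.exact_W g0 (by rw [← hMG, hG]) fun c hc => by
    rw [← ι_apply_nil, ← hx]
    change u ([], c) + B.D (B.K h) ([], c) + B.D (B.K h') ([], c) = 0
    rw [hKzero _ _ hc, hKzero _ _ hc, h0 _ (by simp [wdeg, hc])]
    simp
  refine ⟨B.ι g' - B.K (h + h'), Submodule.sub_mem _ (B.ι_mem_short t _)
    (B.K_mem_short.2 fun l hl => ?_), ?_⟩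
  · rw [Finsupp.add_apply, ht l hl, ht' l hl, add_zero]
  · rw [map_sub, B.D_ι 0, hMG, hg', ← hx, map_add, map_add]
    simp only [x, w]
    abel

end BarData

end AInf

/-! ### Bar complexes with reduced coefficients -/

namespace AInf

open Finset

namespace BarData

section Reduction

variable {Q V W β γ : Type*} [CommRing Q] [AddCommGroup V] [Module Q V] [AddCommGroup W]
    [Module Q W] (B : BarData Q V W β γ) (S : Type*) [CommRing S] [Algebra Q S]
    (Sh : Set (List β × γ))

/-- The words of degree `n` in a set of words. -/
def Idx (n : ℕ) : Set (List β × γ) := {l | l ∈ Sh ∧ B.wdeg l = n}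

/-- The reduction of the degree `n` part to coefficients in `S`. -/
noncomputable def red (n : ℕ) : Words Q β γ →ₗ[Q] (B.Idx Sh n →₀ S) :=
  Finsupp.mapRange.linearMap (Algebra.linearMap Q S) ∘ₗ Finsupp.lsubtypeDomain (B.Idx Sh n)

/-- The differential induced by `D` on the degree `n + 1` part. -/
noncomputable def dRed (n : ℕ) : (B.Idx Sh (n + 1) →₀ S) →ₗ[S] (B.Idx Sh n →₀ S) :=
  Finsupp.linearCombination S fun l : B.Idx Sh (n + 1) => B.red S Sh n (B.D (Finsupp.single l.1 1))

variable {S Sh}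

@[simp]
theorem red_apply (n : ℕ) (u : Words Q β γ) (l : B.Idx Sh n) :
    B.red S Sh n u l = algebraMap Q S (u l.1) := rfl

theorem red_eq_zero_iff (n : ℕ) (u : Words Q β γ) :
    B.red S Sh n u = 0 ↔ ∀ l ∈ Sh, B.wdeg l = n → algebraMap Q S (u l) = 0 :=
  ⟨fun h l hl hn => DFunLike.congr_fun h ⟨l, hl, hn⟩,
    fun h => Finsupp.ext fun l => h l.1 l.2.1 l.2.2⟩

theorem dRed_red (n : ℕ) {u : Words Q β γ} (hu : u ∈ Finsupp.supported Q Q Sh) :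
    B.dRed S Sh n (B.red S Sh (n + 1) u) = B.red S Sh n (B.D u) := by
  classical
  have hs : ∀ l ∈ Sh, B.dRed S Sh n (B.red S Sh (n + 1) (Finsupp.single l 1)) =
      B.red S Sh n (B.D (Finsupp.single l 1)) := by
    intro l hl
    by_cases hn : B.wdeg l = n + 1
    · have : B.red S Sh (n + 1) (Finsupp.single l 1) = Finsupp.single ⟨l, hl, hn⟩ 1 := by
        refine Finsupp.ext fun l' => ?_
        rw [red_apply, Finsupp.single_apply, Finsupp.single_apply]
        by_cases h : l = l'.1
        · rw [if_pos h, if_pos (Subtype.ext h), map_one]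
        · rw [if_neg h, if_neg fun h' => h (congrArg Subtype.val h'), map_zero]
      rw [this, dRed, Finsupp.linearCombination_single, one_smul]
    · have h1 : B.red S Sh (n + 1) (Finsupp.single l 1) = 0 := by
        rw [red_eq_zero_iff]
        intro l' _ h'
        rw [Finsupp.single_eq_of_ne, map_zero]
        rintro rfl
        exact hn h'
      have h2 : B.red S Sh n (B.D (Finsupp.single l 1)) = 0 := by
        rw [red_eq_zero_iff]
        intro l' _ h'
        rw [D_apply_eq_zero, map_zero]
        intro l'' h''
        rw [Finsupp.single_eq_of_ne]
        rintro rfl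
        exact hn (by rw [h'', h'])
      rw [h1, h2, map_zero]
  have h3 : u = ∑ l ∈ u.support, u l • Finsupp.single l (1 : Q) := by
    conv_lhs => rw [← Finsupp.sum_single u, Finsupp.sum]
    simp
  rw [h3]
  simp only [map_sum]
  refine sum_congr rfl fun l hl => ?_
  rw [(B.red S Sh (n + 1)).map_smul, (B.dRed S Sh n).map_smul_of_tower, hs l (hu hl), B.D.map_smul,
    (B.red S Sh n).map_smul]

theorem δ_apply (u : Words Q β γ) (l : List β × γ) : B.δ u l = B.d1 (B.uncons u l) := by
  obtain ⟨g, hg⟩ := B.exists_eq_ι_add_K u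
  rw [← δ_K_apply]
  conv_lhs => rw [hg, map_add, δ_ι, zero_add]

/-- The first letter uses up at least `2` of the degree. -/
theorem mem_short_of_homog {k n : ℕ} {u : Words Q β γ} (hu : u ∈ B.homog k (n + 1)) :
    u ∈ B.short n := by
  rw [mem_homog] at hu
  rw [mem_short]
  rintro ⟨_ | ⟨b, l⟩, c⟩ h
  · trivial
  · have h1 := B.wdeg_cons b (l, c)
    have h2 := B.two_le b
    have h3 := hu _ h
    dsimp only at h1
    change B.wdeg (l, c) < n
    omega

theorem exists_red_eq (hS : Function.Surjective (algebraMap Q S)) (n : ℕ) (x : B.Idx Sh n →₀ S) :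
    ∃ u ∈ Finsupp.supported Q Q Sh, u ∈ B.homog 0 n ∧ B.red S Sh n u = x := by
  induction x using Finsupp.induction_linear with
  | zero => exact ⟨0, Submodule.zero_mem _, Submodule.zero_mem _, map_zero _⟩
  | add x y hx hy =>
    obtain ⟨u, h1, h2, rfl⟩ := hx
    obtain ⟨v, h3, h4, rfl⟩ := hy
    exact ⟨u + v, Submodule.add_mem _ h1 h3, Submodule.add_mem _ h2 h4, map_add _ _ _⟩
  | single l s =>
    obtain ⟨q, rfl⟩ := hS s
    refine ⟨Finsupp.single l.1 q, Finsupp.single_mem_supported _ _ l.2.1, ?_, ?_⟩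
    · have := B.single_mem_homog l.1 q
      rwa [l.2.2] at this
    · classical
      refine Finsupp.ext fun l' => ?_
      rw [red_apply, Finsupp.single_apply, Finsupp.single_apply]
      by_cases h : l = l'
      · rw [if_pos h, if_pos (congrArg _ h)]
      · rw [if_neg h, if_neg fun h' => h (Subtype.ext h'), map_zero]

end Reduction

section Complex

variable {Q V W β γ : Type u} [CommRing Q] [AddCommGroup V] [Module Q V] [AddCommGroup W]
    [Module Q W] (B : BarData Q V W β γ) (S : Type u) [CommRing S] [Algebra Q S]
    (Sh : Set (List β × γ)) (k : ℕ)

/-- The condition for the words in `Sh` of degree at least `k` to span a complex over `S`. -/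
structure IsBarComplex : Prop where
  surj : Function.Surjective (algebraMap Q S)
  D_mem : ∀ u ∈ Finsupp.supported Q Q Sh, B.D u ∈ Finsupp.supported Q Q Sh
  red_δ : ∀ n, k ≤ n → ∀ u ∈ Finsupp.supported Q Q Sh, B.red S Sh n (B.δ u) = 0
  exact : ∀ n, k ≤ n → ∀ u ∈ Finsupp.supported Q Q Sh, u ∈ B.homog 0 (n + 1) →
    B.red S Sh n (B.D u) = 0 → ∃ u' ∈ Finsupp.supported Q Q Sh, B.D u' = u

variable {S Sh k} {B}

theorem IsBarComplex.dRed_dRed (hB : B.IsBarComplex S Sh k) (n : ℕ) (hn : k ≤ n)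
    (x : B.Idx Sh (n + 1 + 1) →₀ S) : B.dRed S Sh n (B.dRed S Sh (n + 1) x) = 0 := by
  obtain ⟨u, hu, -, rfl⟩ := B.exists_red_eq hB.surj _ x
  rw [B.dRed_red _ hu, B.dRed_red _ (hB.D_mem u hu), D_D, hB.red_δ n hn u hu]

theorem IsBarComplex.exists_dRed_eq (hB : B.IsBarComplex S Sh k) (n : ℕ) (hn : k ≤ n)
    (x : B.Idx Sh (n + 1) →₀ S) (hx : B.dRed S Sh n x = 0) : ∃ y, B.dRed S Sh (n + 1) y = x := by
  obtain ⟨u, hu, hu', rfl⟩ := B.exists_red_eq hB.surj _ x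
  rw [B.dRed_red _ hu] at hx
  obtain ⟨u', h1, rfl⟩ := hB.exact n hn u hu hu' hx
  exact ⟨B.red S Sh (n + 1 + 1) u', B.dRed_red _ h1⟩

/-- The complex of free modules on the words in `Sh` of degree at least `k`. -/
noncomputable def IsBarComplex.complex (hB : B.IsBarComplex S Sh k) :
    ChainComplex (ModuleCat.{u} S) ℕ :=
  ChainComplex.of (fun n => ModuleCat.of S (B.Idx Sh (k + n) →₀ S))
    (fun n => ModuleCat.ofHom (B.dRed S Sh (k + n))) fun n => ModuleCat.hom_ext <|
      LinearMap.ext fun x => hB.dRed_dRed (k + n) (by omega) x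

theorem IsBarComplex.complex_d (hB : B.IsBarComplex S Sh k) (n : ℕ) :
    hB.complex.d (n + 1) n = ModuleCat.ofHom (B.dRed S Sh (k + n)) :=
  ChainComplex.of_d (fun n => ModuleCat.of S (B.Idx Sh (k + n) →₀ S))
    (fun n => ModuleCat.ofHom (B.dRed S Sh (k + n))) n

theorem IsBarComplex.complex_projective (hB : B.IsBarComplex S Sh k) (n : ℕ) :
    Projective (hB.complex.X n) :=
  inferInstanceAs (Projective (ModuleCat.of S (B.Idx Sh (k + n) →₀ S)))

/-- A cycle over `S` satisfies `D u = 0` only up to coefficients in the image of `d1`. Lifting these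
through `d1`, one letter per tail, provides the correction `h` required by `exists_D_eq`; its tails
have degree `n < t`, so shortness is not lost. -/
theorem exists_D_eq_of_red (hker : ∀ q : Q, algebraMap Q S q = 0 ↔ ∃ v, B.d1 v = q)
    {n t : ℕ} (hn : n < t) {u : Words Q β γ} (hu : u ∈ B.short t) (hu' : u ∈ B.homog 0 (n + 1))
    (h : B.red S Set.univ n (B.D u) = 0) : ∃ u' ∈ B.short t, B.D u' = u := by
  classical
  rw [red_eq_zero_iff] at h
  have h1 : ∀ q : Q, ∃ v, (algebraMap Q S q = 0 → B.d1 v = -q) ∧ (q = 0 → v = 0) := fun q => by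
    by_cases hq : q = 0
    · exact ⟨0, by simp [hq]⟩
    · by_cases hq' : algebraMap Q S q = 0
      · obtain ⟨v, hv⟩ := (hker q).1 hq'
        exact ⟨-v, by simp [hv], fun h => absurd h hq⟩
      · exact ⟨0, fun h => absurd h hq', fun h => absurd h hq⟩
  choose c hc using h1
  have hDu := B.mem_homog.1 (B.D_mem_homog hu')
  refine B.exists_D_eq t u hu ((B.D u).mapRange c ((hc 0).2 rfl)) (fun l hl => ?_) ?_
    fun l hl => ?_
  · rw [Finsupp.mapRange_apply]
    refine (hc _).2 ?_
    by_contra h0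
    have := hDu l h0
    omega
  · ext l
    rw [Finsupp.add_apply, δ_K_apply, Finsupp.mapRange_apply, (hc _).1, add_neg_cancel]
    · rfl
    · by_cases h0 : B.D u l = 0
      · rw [h0, map_zero]
      · exact h l trivial (by have := hDu l h0; omega)
  · by_contra h0
    have := B.mem_homog.1 hu' l h0
    omega

/-- By `hker` the coefficients of `δ` die in `S`, so no restriction on the words is necessary. -/
theorem isBarComplex_of_ker (hS : Function.Surjective (algebraMap Q S))
    (hker : ∀ q : Q, algebraMap Q S q = 0 ↔ ∃ v, B.d1 v = q) (k : ℕ) :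
    B.IsBarComplex S Set.univ k where
  surj := hS
  D_mem u _ := by simp
  red_δ n _ u _ := by
    rw [red_eq_zero_iff]
    intro l _ _
    rw [δ_apply]
    exact (hker _).2 ⟨_, rfl⟩
  exact n _ u _ hu h := by
    obtain ⟨u', -, hu'⟩ := exists_D_eq_of_red hker (Nat.lt_succ_self n)
      (B.short_mono (Nat.le_succ n) (B.mem_short_of_homog hu)) hu h
    exact ⟨u', by simp, hu'⟩

/-- On these words `δ` only produces tails of degree `0`, so from degree `1` on `D` squares to zero
already over `Q`, and `exists_D_eq` applies without correction. -/
theorem isBarComplex_short : B.IsBarComplex Q {l | B.IsShort 1 l} 1 where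
  surj := Function.surjective_id
  D_mem u hu := B.D_mem_short hu
  red_δ n hn u hu := by
    rw [red_eq_zero_iff]
    intro l _ hl
    rw [δ_apply, B.mem_short_iff_uncons.1 hu l (by omega), map_zero, map_zero]
  exact n hn u hu hu' h := by
    rw [red_eq_zero_iff] at h
    have hDu := B.mem_homog.1 (B.D_mem_homog hu')
    have hD : B.D u = 0 := by
      ext l
      by_contra h0
      exact h0 (h l (B.mem_short.1 (B.D_mem_short hu) l h0) (by have := hDu l h0; omega))
    refine B.exists_D_eq 1 u hu 0 (fun _ _ => rfl) (by simp [hD]) fun l hl => ?_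
    by_contra h0
    have := B.mem_homog.1 hu' l h0
    omega

end Complex

end BarData

end AInf

/-! ### Minimality and injectivity in terms of words -/

namespace AInf

open Finset

namespace BarData

variable {Q V W β γ : Type*} [CommRing Q] [AddCommGroup V] [Module Q V] [AddCommGroup W]
    [Module Q W] (B : BarData Q V W β γ) (I : Ideal Q)

/-- Combinations of words with coefficients in an ideal. -/
def _root_.AInf.idealWords (β γ : Type*) (I : Ideal Q) : Submodule Q (Words Q β γ) where
  carrier := {u | ∀ l, u l ∈ I}
  add_mem' hu hv l := I.add_mem (hu l) (hv l)
  zero_mem' _ := I.zero_mem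
  smul_mem' q _ hu l := I.mul_mem_left q (hu l)

variable {I}

theorem ι_mem_idealWords {g : W} (hg : ∀ c, B.bW.repr g c ∈ I) : B.ι g ∈ idealWords β γ I := by
  rintro ⟨_ | ⟨b, l⟩, c⟩
  · rw [ι_apply_nil]
    exact hg c
  · rw [ι_apply_cons]
    exact I.zero_mem

theorem cons_mem_idealWords_left {v : V} (hv : ∀ b, B.bV.repr v b ∈ I) (u : Words Q β γ) :
    B.cons v u ∈ idealWords β γ I := by
  rintro ⟨_ | ⟨b, l⟩, c⟩
  · rw [cons_apply_nil]
    exact I.zero_mem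
  · rw [cons_apply_cons]
    exact I.mul_mem_right _ (hv b)

theorem cons_mem_idealWords_right (v : V) {u : Words Q β γ} (hu : u ∈ idealWords β γ I) :
    B.cons v u ∈ idealWords β γ I := by
  rintro ⟨_ | ⟨b, l⟩, c⟩
  · rw [cons_apply_nil]
    exact I.zero_mem
  · rw [cons_apply_cons]
    exact I.mul_mem_left _ (hu (l, c))

theorem D_mem_idealWords {u : Words Q β γ}
    (h : ∀ l, u l ≠ 0 → B.wordDiff l.1 l.2 ∈ idealWords β γ I) : B.D u ∈ idealWords β γ I := by
  intro l'
  rw [D_apply]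
  refine I.sum_mem fun l hl => I.mul_mem_left _ (h l (Finsupp.mem_support_iff.1 hl) l')

variable (I) in
/-- In degree `n`, no nonzero class of `W` modulo `I` is a boundary modulo `I`. -/
def WInjective (n : ℕ) : Prop :=
  ∀ (g : W) (u : Words Q β γ), (∀ l, B.wdeg l = n → (B.ι g - B.D u) l ∈ I) →
    ∀ c, B.degW c = n → B.bW.repr g c ∈ I

variable (I) in
/-- Short words: cycles of degree `n + 1` modulo `I` which are boundaries modulo `I` bound a
combination of short words modulo `I`. -/
def ShortInjective (n : ℕ) : Prop :=
  ∀ f ∈ B.short 1, (1 ≤ n → ∀ l, B.wdeg l = n → B.D f l ∈ I) →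
    ∀ u : Words Q β γ, (∀ l, B.wdeg l = n + 1 → (f - B.D u) l ∈ I) →
      ∃ f' ∈ B.short 1, ∀ l, B.wdeg l = n + 1 → (f - B.D f') l ∈ I

variable (I) in
/-- The structure maps vanish modulo `I`. -/
def IsMinimal : Prop :=
  (∀ n x b, B.bV.repr (B.m n x) b ∈ I) ∧ ∀ n x g c, B.bW.repr (B.mG n x g) c ∈ I

theorem IsMinimal.P_mem (h : B.IsMinimal I) (l : List β) (c : γ) :
    B.P (Finsupp.single (l, c) 1) ∈ idealWords β γ I := by
  rw [P_single]
  exact Submodule.add_mem _ (Submodule.sum_mem _ fun a _ =>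
    B.cons_mem_idealWords_left (h.1 _ _) _) (B.ι_mem_idealWords (h.2 _ _ _))

theorem IsMinimal.D_mem (h : B.IsMinimal I) (u : Words Q β γ) : B.D u ∈ idealWords β γ I := by
  refine B.D_mem_idealWords ?_
  rintro ⟨l, c⟩ -
  dsimp only
  induction l with
  | nil => exact h.P_mem B [] c
  | cons b l ih => exact Submodule.add_mem _ (h.P_mem B _ _) (B.cons_mem_idealWords_right _ ih)

theorem IsMinimal.wInjective (h : B.IsMinimal I) (n : ℕ) : B.WInjective I n := by
  intro g u hu c hc
  have h1 := I.add_mem (hu ([], c) (by simp [wdeg, hc])) (h.D_mem B u ([], c))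
  rwa [Finsupp.sub_apply, sub_add_cancel, ι_apply_nil] at h1

theorem IsMinimal.shortInjective (h : B.IsMinimal I) (n : ℕ) : B.ShortInjective I n := by
  intro f _ _ u hu
  -- Boundaries vanish modulo `I`, so `f` is already zero there.
  refine ⟨0, Submodule.zero_mem _, fun l hl => ?_⟩
  have h1 := I.add_mem (hu l hl) (h.D_mem B u l)
  rw [Finsupp.sub_apply, sub_add_cancel] at h1
  simpa using h1

theorem P_apply_nil (l : List β) (c d : γ) :
    B.P (Finsupp.single (l, c) 1) ([], d) = B.bW.repr (B.MG l.length (B.seq l) (B.bW c)) d := by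
  rw [P_single, prefixForm, Finsupp.add_apply, Finsupp.finsetSum_apply, ι_apply_nil,
    sum_eq_zero fun a _ => B.cons_apply_nil _ _ _, zero_add]

/-- Exactly one letter remains only when the operation takes the whole list, so the coefficients of
`m_n` are visible in `P`. -/
theorem P_apply_singleton (l : List β) (c : γ) (b : β) :
    B.P (Finsupp.single (l, c) 1) ([b], c) = B.bV.repr (B.M l.length (B.seq l)) b := by
  rw [P_single, prefixForm, Finsupp.add_apply, Finsupp.finsetSum_apply, ι_apply_cons, add_zero,
    sum_eq_single (l.length, 0)]
  · rw [cons_apply_cons, pre_zero, ι_basis]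
    simp
  · rintro ⟨i, r⟩ h1 h2
    rw [HasAntidiagonal.mem_antidiagonal] at h1
    dsimp only at h1
    cases r with
    | zero => exact absurd (by rw [← h1]; rfl) h2
    | succ r => rw [cons_apply_cons, pre_succ, cons_apply_nil, mul_zero]
  · intro h
    exact absurd (HasAntidiagonal.mem_antidiagonal.2 (add_zero _)) h

/-- `P` of a word is the difference of `wordDiff` of the word and a term built from `wordDiff` of
its tail. -/
theorem P_mem_of_wordDiff_mem {l : List β} {c : γ}
    (h : ∀ l' : List β, l'.length ≤ l.length → (l'.map B.degV).sum ≤ (l.map B.degV).sum →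
      B.wordDiff l' c ∈ idealWords β γ I) :
    B.P (Finsupp.single (l, c) 1) ∈ idealWords β γ I := by
  cases l with
  | nil => exact h [] le_rfl le_rfl
  | cons b l =>
    have h1 := h (b :: l) le_rfl le_rfl
    have h2 := B.cons_mem_idealWords_right (B.s (B.bV b)) (h l (by simp) (by simp))
    have := Submodule.sub_mem _ h1 h2
    rwa [wordDiff, add_sub_cancel_right] at this

/-- Coefficients at one-letter words ending in `c₀` give `m_n`, those at words without letters give
`m^G_n`. Some `c₀` must exist for `m_n` to be seen at all. -/
theorem isMinimal_of_wordDiff_mem {c₀ : γ} (h : ∀ l c, B.wordDiff l c ∈ idealWords β γ I) :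
    B.IsMinimal I := by
  have hseq : ∀ n (a : Fin n → β), (fun i : Fin n => B.seq (List.ofFn a) i) =
      fun i => B.bV (a i) := fun n a => funext fun i => B.seq_spec _ _ _ (by simp)
  have hP : ∀ l c, B.P (Finsupp.single (l, c) 1) ∈ idealWords β γ I := fun l c =>
    B.P_mem_of_wordDiff_mem fun l' _ _ => h l' c
  constructor
  · intro n x b
    let F : V →ₗ[Q] Q ⧸ I := I.mkQ ∘ₗ Finsupp.lapply b ∘ₗ B.bV.repr.toLinearMap
    have hF : F.compMultilinearMap (B.m n) = 0 := by
      refine Module.Basis.ext_multilinear (fun _ => B.bV) fun a => ?_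
      have h1 := hP (List.ofFn a) c₀ ([b], c₀)
      rw [P_apply_singleton, List.length_ofFn, M, hseq] at h1
      exact (Submodule.Quotient.mk_eq_zero I).2 h1
    exact (Submodule.Quotient.mk_eq_zero I).1 (DFunLike.congr_fun hF x)
  · intro n x g c
    let F : (W →ₗ[Q] W) →ₗ[Q] W →ₗ[Q] Q ⧸ I :=
      LinearMap.llcomp Q W W (Q ⧸ I) (I.mkQ ∘ₗ Finsupp.lapply c ∘ₗ B.bW.repr.toLinearMap)
    have hF : F.compMultilinearMap (B.mG n) = 0 := by
      refine Module.Basis.ext_multilinear (fun _ => B.bV) fun a => B.bW.ext fun d => ?_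
      have h1 := hP (List.ofFn a) d ([], c)
      rw [P_apply_nil, List.length_ofFn, MG, hseq] at h1
      exact (Submodule.Quotient.mk_eq_zero I).2 h1
    exact (Submodule.Quotient.mk_eq_zero I).1
      (LinearMap.congr_fun (DFunLike.congr_fun hF x) g)

/-- The part of the differential of a word that can be nonzero modulo `I` when the differential is
zero modulo `I` in smaller degrees. -/
noncomputable def leading (l : List β) (c : γ) : Words Q β γ :=
  (if B.degW c = 0 then B.cons (B.M l.length (B.seq l)) (B.ι (B.bW c)) else 0) +
    B.ι (B.MG l.length (B.seq l) (B.bW c))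

theorem leading_mem_short (l : List β) (c : γ) : B.leading l c ∈ B.short 1 := by
  refine Submodule.add_mem _ ?_ (B.ι_mem_short _ _)
  split_ifs with h
  · refine B.cons_mem_short _ (B.ι_mem_homog (k := 0) (a := 0) fun d hd => ?_) one_pos
    classical
    rw [Module.Basis.repr_self, Finsupp.single_apply] at hd
    by_cases hc : c = d
    · rw [← hc, h]
    · simp [hc] at hd
  · exact Submodule.zero_mem _

theorem leading_mem_homog (l : List β) (c : γ) : B.leading l c ∈ B.homog 1 (B.wdeg (l, c)) := by
  refine Submodule.add_mem _ ?_ (B.ι_mem_homog fun d hd => B.repr_MG_seq l c d hd)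
  split_ifs with h
  · have h1 := B.pre_seq_mem_homog l c l.length 0
    have := B.cons_mem_homog (B.repr_M_seq l l.length le_rfl) h1
    rwa [range_zero, sum_empty, zero_add, sum_dseq] at this
  · exact Submodule.zero_mem _

/-- Ending the word with `c₀` of degree `0` does not raise its degree, so the bound concerns the
letters alone. -/
theorem M_mem_of_wordDiff_mem {c₀ : γ} (hc₀ : B.degW c₀ = 0) {N : ℕ}
    (h : ∀ l c, B.wdeg (l, c) < N → B.wordDiff l c ∈ idealWords β γ I) (l : List β)
    (hl : (l.map B.degV).sum < N) (b : β) : B.bV.repr (B.M l.length (B.seq l)) b ∈ I := by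
  rw [← P_apply_singleton B l c₀ b]
  refine B.P_mem_of_wordDiff_mem (fun l' _ hl' => h l' c₀ ?_) _
  simp only [wdeg, hc₀]
  omega

/-- Operations on a proper prefix, or behind the first letter, already occur in words of smaller
degree and so vanish modulo `I`. The same holds for `m_n` on all letters unless `c` has degree `0`,
since otherwise replacing `c` by `c₀` lowers the degree. -/
theorem wordDiff_sub_leading_mem {c₀ : γ} (hc₀ : B.degW c₀ = 0) (b : β) (l : List β) (c : γ)
    (h : ∀ l' c', B.wdeg (l', c') < B.wdeg (b :: l, c) → B.wordDiff l' c' ∈ idealWords β γ I) :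
    B.wordDiff (b :: l) c - B.leading (b :: l) c ∈ idealWords β γ I := by
  have h2 := B.two_le b
  have h3 := B.wdeg_cons b (l, c)
  dsimp only at h3
  have h1 := B.cons_mem_idealWords_right (B.s (B.bV b)) (h l c (by omega))
  have hmem : (((b :: l).length, 0) : ℕ × ℕ) ∈ antidiagonal (b :: l).length :=
    HasAntidiagonal.mem_antidiagonal.2 (add_zero _)
  rw [wordDiff, P_single, prefixForm, leading, ← sum_erase_add _ _ hmem]
  dsimp only
  rw [pre_zero]
  have h4 : ∑ a ∈ (antidiagonal (b :: l).length).erase ((b :: l).length, 0),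
      B.cons (B.M a.1 (B.seq (b :: l))) (B.pre a.2 (fun t => B.seq (b :: l) (a.1 + t))
        (B.ι (B.bW c))) ∈ idealWords β γ I := by
    refine Submodule.sum_mem _ fun a ha => B.cons_mem_idealWords_left (fun d => ?_) _
    rw [mem_erase, HasAntidiagonal.mem_antidiagonal] at ha
    have ha2 : a.2 ≠ 0 := fun h => ha.1 (by ext <;> dsimp only <;> omega)
    have e1 : a.1 = ((b :: l).take a.1).length := by
      rw [List.length_take]
      omega
    have e2 : B.M a.1 (B.seq (b :: l)) =
        B.M ((b :: l).take a.1).length (B.seq ((b :: l).take a.1)) := by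
      rw [← e1]
      refine B.M_congr fun i hi => ?_
      rw [seq, seq, List.getElem?_take_of_lt hi]
    rw [e2]
    refine B.M_mem_of_wordDiff_mem hc₀ h _ ?_ d
    have e3 : ((b :: l).take a.1 ++ (b :: l).drop a.1) = b :: l := List.take_append_drop _ _
    have e4 : B.wdeg (b :: l, c) = (((b :: l).take a.1).map B.degV).sum +
        (((b :: l).drop a.1).map B.degV).sum + B.degW c := by
      rw [← List.sum_append, ← List.map_append, e3]
      rfl
    have e5 : 0 < (((b :: l).drop a.1).map B.degV).sum := by
      cases h6 : (b :: l).drop a.1 with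
      | nil =>
        rw [List.drop_eq_nil_iff] at h6
        omega
      | cons b' l' =>
        have := B.two_le b'
        simp
        omega
    omega
  have h5 : B.cons (B.M (b :: l).length (B.seq (b :: l))) (B.ι (B.bW c)) -
      (if B.degW c = 0 then B.cons (B.M (b :: l).length (B.seq (b :: l))) (B.ι (B.bW c)) else 0) ∈
      idealWords β γ I := by
    split_ifs with hc
    · rw [sub_self]
      exact Submodule.zero_mem _
    · rw [sub_zero]
      refine B.cons_mem_idealWords_left (B.M_mem_of_wordDiff_mem hc₀ h _ ?_) _
      simp only [wdeg]
      omega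
  convert Submodule.add_mem _ (Submodule.add_mem _ h4 h5) h1 using 1
  abel

/-- Modulo `I` the differential of a word is its leading part, a short cycle by induction and a
boundary by construction. `ShortInjective` makes it the differential of a short combination, and
those differentials vanish modulo `I`. -/
theorem wordDiff_mem_idealWords (hM : ∀ v b, B.bV.repr (B.M1 v) b ∈ I)
    (hMG : ∀ g c, B.bW.repr (B.MG 0 0 g) c ∈ I) {c₀ : γ} (hc₀ : B.degW c₀ = 0)
    (hW : ∀ n, B.WInjective I n) (hS : ∀ n, B.ShortInjective I n) (N : ℕ) :
    ∀ l c, B.wdeg (l, c) = N → B.wordDiff l c ∈ idealWords β γ I := by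
  induction N using Nat.strong_induction_on with
  | _ N ih =>
  have ih' : ∀ l c, B.wdeg (l, c) < N → B.wordDiff l c ∈ idealWords β γ I :=
    fun l c h => ih _ h l c rfl
  have hnil : ∀ c, B.wordDiff [] c ∈ idealWords β γ I := fun c => by
    rw [wordDiff, ← B.ι_basis, B.P_ι 0]
    exact B.ι_mem_idealWords (hMG _)
  -- The term with `m₁` vanishes by minimality of `A`. What remains is `m^G_2(b, c)`, an element of
  -- `W` that is a boundary modulo `I`, hence zero there by `hW`.
  have hone : ∀ b c, B.degW c = 0 → B.wdeg ([b], c) = N →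
      B.wordDiff [b] c ∈ idealWords β γ I := by
    intro b c hc hN
    have h1 := B.wordDiff_sub_leading_mem hc₀ b [] c fun l' c' h => ih' l' c' (hN ▸ h)
    have h2 : B.cons (B.M 1 (B.seq [b])) (B.ι (B.bW c)) ∈ idealWords β γ I := by
      refine B.cons_mem_idealWords_left (fun d => ?_) _
      rw [M_one]
      exact hM _ d
    rw [leading, if_pos hc] at h1
    have h3 := Submodule.add_mem _ h1 h2
    have h4 : B.wordDiff [b] c - B.ι (B.MG 1 (B.seq [b]) (B.bW c)) ∈ idealWords β γ I := by
      convert h3 using 1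
      simp only [List.length_singleton]
      abel
    have h5 : B.ι (B.MG 1 (B.seq [b]) (B.bW c)) ∈ idealWords β γ I := by
      refine B.ι_mem_idealWords fun d => ?_
      by_cases h0 : B.bW.repr (B.MG 1 (B.seq [b]) (B.bW c)) d = 0
      · rw [h0]
        exact I.zero_mem
      · refine hW (B.degW d) _ (Finsupp.single ([b], c) 1) (fun l _ => ?_) d rfl
        have := (idealWords β γ I).neg_mem h4 l
        rwa [neg_sub, ← D_single B ([b], c)] at this
    have := Submodule.add_mem _ h4 h5
    rwa [sub_add_cancel] at this
  intro l c hN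
  cases l with
  | nil => exact hnil c
  | cons b l =>
    have h1 := B.wordDiff_sub_leading_mem hc₀ b l c fun l' c' h => ih' l' c' (hN ▸ h)
    have h2 := B.two_le b
    have h3 := B.wdeg_cons b (l, c)
    have hh := B.mem_homog.1 (B.leading_mem_homog (b :: l) c)
    dsimp only at h3
    -- The leading part has degree `N - 1`, and `ShortInjective` at `n` concerns degree `n + 1`; a
    -- word with a letter has `N ≥ 2`.
    obtain ⟨f', hf', h4⟩ := hS (N - 2) (B.leading (b :: l) c) (B.leading_mem_short _ _)
      (fun _ l' _ => B.D_mem_idealWords (fun l hl => ih' l.1 l.2 (by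
        have h5 : B.wdeg (l.1, l.2) + 1 = _ := hh l hl
        omega)) l')
      (Finsupp.single (b :: l, c) 1) (fun l' _ => by
        have := (idealWords β γ I).neg_mem h1 l'
        rwa [neg_sub, ← D_single B (b :: l, c)] at this)
    have h5 : B.leading (b :: l) c ∈ idealWords β γ I := by
      intro l'
      by_cases h0 : B.leading (b :: l) c l' = 0
      · rw [h0]
        exact I.zero_mem
      · have h6 := hh l' h0
        have h7 := h4 l' (by omega)
        have h8 : B.D f' l' ∈ I := by
          rw [D_apply]
          refine I.sum_mem fun l'' hl'' => ?_
          by_cases h9 : B.wordDiff l''.1 l''.2 l' = 0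
          · rw [h9, mul_zero]
            exact I.zero_mem
          · have h10 := B.mem_homog.1 (B.wordDiff_mem_homog l''.1 l''.2) l' h9
            have h11 := B.mem_short.1 hf' l'' (Finsupp.mem_support_iff.1 hl'')
            refine I.mul_mem_left _ ?_
            -- With two letters the tail would have degree at least `2`, so a short word has at most
            -- one.
            obtain ⟨_ | ⟨b', _ | ⟨b'', l''⟩⟩, c'⟩ := l''
            · exact hnil c' l'
            · refine hone b' c' ?_ (by dsimp only at h10; omega) l'
              simpa [IsShort, wdeg] using h11
            · have := B.two_le b''
              simp [IsShort, wdeg] at h11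
              omega
        have := I.add_mem h7 h8
        rwa [Finsupp.sub_apply, sub_add_cancel] at this
    have := Submodule.add_mem _ h1 h5
    rwa [sub_add_cancel] at this

theorem injective_iff_isMinimal (hM : ∀ v b, B.bV.repr (B.M1 v) b ∈ I)
    (hMG : ∀ g c, B.bW.repr (B.MG 0 0 g) c ∈ I) {c₀ : γ} (hc₀ : B.degW c₀ = 0) :
    ((∀ n, B.WInjective I n) ∧ ∀ n, B.ShortInjective I n) ↔ B.IsMinimal I :=
  ⟨fun h => B.isMinimal_of_wordDiff_mem (c₀ := c₀) fun l c =>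
    B.wordDiff_mem_idealWords hM hMG hc₀ h.1 h.2 _ l c rfl,
    fun h => ⟨h.wInjective B, h.shortInjective B⟩⟩

end BarData

end AInf

/-! ### Bar data from A-infinity structures on resolutions -/

namespace AInf

open Finset DirectSum

section Graded

variable {Q : Type u} [CommRing Q] (X : ℕ → Type u) [∀ i, AddCommGroup (X i)]
    [∀ i, Module Q (X i)] [∀ i, Module.Free Q (X i)]

/-- The index set of a homogeneous basis of a graded free module. -/
abbrev GradedIndex : Type u := Σ i, Module.Free.ChooseBasisIndex Q (X i)

/-- A homogeneous basis of a graded free module. -/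
noncomputable def gradedBasis : Module.Basis (GradedIndex (Q := Q) X) Q (⨁ i, X i) :=
  DFinsupp.basis fun i => Module.Free.chooseBasis Q (X i)

theorem gradedBasis_repr (v : ⨁ i, X i) (b : GradedIndex (Q := Q) X) :
    (gradedBasis X).repr v b = (Module.Free.chooseBasis Q (X b.1)).repr (v b.1) b.2 := rfl

theorem gradedBasis_apply (b : GradedIndex (Q := Q) X) :
    gradedBasis X b = DirectSum.lof Q ℕ X b.1 (Module.Free.chooseBasis Q (X b.1) b.2) := by
  refine (gradedBasis (Q := Q) X).repr.injective (Finsupp.ext fun b' => ?_)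
  rw [Module.Basis.repr_self, gradedBasis_repr]
  obtain ⟨i, j⟩ := b
  obtain ⟨i', j'⟩ := b'
  by_cases h : i = i'
  · subst h
    dsimp only
    rw [DirectSum.lof_apply, Module.Basis.repr_self]
    by_cases hj : j = j'
    · rw [hj, Finsupp.single_eq_same, Finsupp.single_eq_same]
    · rw [Finsupp.single_eq_of_ne (Ne.symm hj), Finsupp.single_eq_of_ne]
      rintro h
      exact hj (eq_of_heq (Sigma.mk.inj h).2).symm
  · have h0 : DirectSum.lof Q ℕ X i (Module.Free.chooseBasis Q (X i) j) i' = 0 :=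
      (DirectSum.component.of (R := Q) (M := X) i' i _).trans (dif_neg h)
    dsimp only
    rw [h0, map_zero, Finsupp.single_eq_of_ne]
    · rfl
    · rintro h'
      exact h (Sigma.mk.inj h').1.symm

end Graded

variable {Q : Type u} [CommRing Q]

theorem dTot_apply (G : ChainComplex (ModuleCat.{u} Q) ℕ) (g : Tot G) (t : ℕ) :
    dTot G g t = G.d (t + 1) t (g (t + 1)) := by
  suffices h : DirectSum.component Q ℕ (fun i => G.X i) t ∘ₗ dTot G =
      (G.d (t + 1) t).hom ∘ₗ DirectSum.component Q ℕ (fun i => G.X i) (t + 1) from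
    LinearMap.congr_fun h g
  refine DirectSum.linearMap_ext Q fun i => LinearMap.ext fun x => ?_
  simp only [LinearMap.comp_apply, dTot, DirectSum.toModule_lof]
  by_cases h : i = t + 1
  · subst h
    rw [DirectSum.component.lof_self]
    exact DirectSum.component.lof_self Q _ _
  · rw [DirectSum.component.of _ (t + 1) i, dif_neg h, map_zero]
    cases i with
    | zero => rw [G.shape 0 (0 - 1) (by simp), ModuleCat.hom_zero, LinearMap.zero_apply, map_zero,
        map_zero]
    | succ i => exact (DirectSum.component.of _ t i _).trans (dif_neg fun h' => h (by rw [h']))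

theorem dPlus_apply (A : ChainComplex (ModuleCat.{u} Q) ℕ) (v : PlusShift A) (t : ℕ) :
    dPlus A v t = -A.d (t + 1 + 1) (t + 1) (v (t + 1)) := by
  suffices h : DirectSum.component Q ℕ (fun i => A.X (i + 1)) t ∘ₗ dPlus A =
      -((A.d (t + 1 + 1) (t + 1)).hom ∘ₗ
        DirectSum.component Q ℕ (fun i => A.X (i + 1)) (t + 1)) from
    LinearMap.congr_fun h v
  refine DirectSum.linearMap_ext Q fun i => LinearMap.ext fun x => ?_
  simp only [LinearMap.comp_apply, dPlus, DirectSum.toModule_lof, LinearMap.neg_apply, map_neg]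
  by_cases h : i = t + 1
  · subst h
    rw [DirectSum.component.lof_self]
    exact congrArg Neg.neg (DirectSum.component.lof_self Q _ _)
  · rw [DirectSum.component.of _ (t + 1) i, dif_neg h, map_zero]
    cases i with
    | zero => rw [A.shape (0 + 1) (0 - 1 + 1) (by simp), ModuleCat.hom_zero, LinearMap.zero_apply,
        map_zero, map_zero]
    | succ i =>
      exact congrArg Neg.neg
        ((DirectSum.component.of _ t i _).trans (dif_neg fun h' => h (by rw [h'])))

theorem sgn_apply (A : ChainComplex (ModuleCat.{u} Q) ℕ) (v : PlusShift A) (t : ℕ) :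
    sgn A v t = (-1 : Q) ^ (t + 2) • v t := by
  suffices h : DirectSum.component Q ℕ (fun i => A.X (i + 1)) t ∘ₗ sgn A =
      (-1 : Q) ^ (t + 2) • DirectSum.component Q ℕ (fun i => A.X (i + 1)) t from
    LinearMap.congr_fun h v
  refine DirectSum.linearMap_ext Q fun i => LinearMap.ext fun x => ?_
  simp only [LinearMap.comp_apply, sgn, DirectSum.toModule_lof, LinearMap.smul_apply, map_smul]
  by_cases h : i = t
  · subst h
    rfl
  · rw [DirectSum.component.of _ t i, dif_neg h, smul_zero, smul_zero]

theorem dTot_dTot (G : ChainComplex (ModuleCat.{u} Q) ℕ) (g : Tot G) : dTot G (dTot G g) = 0 := by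
  refine DFinsupp.ext fun t => ?_
  rw [dTot_apply, dTot_apply]
  exact ConcreteCategory.congr_hom (G.d_comp_d (t + 1 + 1) (t + 1) t) _

theorem dPlus_dPlus (A : ChainComplex (ModuleCat.{u} Q) ℕ) (v : PlusShift A) :
    dPlus A (dPlus A v) = 0 := by
  refine DFinsupp.ext fun t => ?_
  rw [dPlus_apply, dPlus_apply, map_neg, neg_neg]
  exact ConcreteCategory.congr_hom (A.d_comp_d (t + 1 + 1 + 1) (t + 1 + 1) (t + 1)) _

theorem exists_dTot_eq {Z : ModuleCat.{u} Q} (G : ProjectiveResolution Z) (g : Tot G.complex)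
    (hg : dTot G.complex g = 0) (h0 : g 0 = 0) : ∃ g', dTot G.complex g' = g := by
  classical
  have h : ∀ i, ∃ y, G.complex.d (i + 1) i y = g i := fun i => by
    cases i with
    | zero => exact ⟨0, by rw [map_zero, h0]⟩
    | succ i =>
      exact TorChange.resolution_exact_succ G i _ (by rw [← dTot_apply, hg]; rfl)
  choose y hy using h
  refine ⟨∑ i ∈ g.support, DirectSum.lof Q ℕ (fun i => G.complex.X i) (i + 1) (y i), ?_⟩
  rw [map_sum]
  conv_rhs => rw [← DirectSum.sum_support_of g]
  refine sum_congr rfl fun i _ => ?_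
  rw [dTot, DirectSum.toModule_lof, ← hy i]
  rfl

/-- The condition on `dOne` is the cycle condition in `A₁`, which `dPlus` does not see. Preimages
move up one degree, so `v'` has no component in `A₁` and `dOne` kills it. -/
theorem exists_dPlus_eq {Z : ModuleCat.{u} Q} (A : ProjectiveResolution Z)
    (e : A.complex.X 0 ≃ₗ[Q] Q) (v : PlusShift A.complex) (hv : dPlus A.complex v = 0)
    (h1 : dOne A.complex e v = 0) :
    ∃ v', dPlus A.complex v' = v ∧ dOne A.complex e v' = 0 := by
  classical
  have h : ∀ i, ∃ y, -A.complex.d (i + 1 + 1) (i + 1) y = v i := fun i => by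
    have : A.complex.d (i + 1) i (v i) = 0 := by
      cases i with
      | zero => exact e.map_eq_zero_iff.1 h1
      | succ i => rw [← neg_eq_zero, ← dPlus_apply, hv]; rfl
    obtain ⟨y, hy⟩ := TorChange.resolution_exact_succ A i _ this
    exact ⟨-y, by rw [map_neg, neg_neg, hy]⟩
  choose y hy using h
  refine ⟨∑ i ∈ v.support, DirectSum.lof Q ℕ (fun i => A.complex.X (i + 1)) (i + 1) (y i), ?_, ?_⟩
  · rw [map_sum]
    conv_rhs => rw [← DirectSum.sum_support_of v]
    refine sum_congr rfl fun i _ => ?_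
    rw [dPlus, DirectSum.toModule_lof, ← hy i, map_neg]
    rfl
  · rw [map_sum]
    refine sum_eq_zero fun i _ => ?_
    rw [dOne, LinearMap.comp_apply, LinearMap.comp_apply, DirectSum.component.of,
      dif_neg (Nat.succ_ne_zero i), map_zero, map_zero]

/-- The identification `e` need not carry the augmentation to `Q → R`. But the augmentation is
surjective, so it sends `e.symm 1` to a unit of `R`, and a unit does not change the kernel. -/
theorem exists_dOne_eq_iff {R : Type u} [CommRing R] [Algebra Q R]
    (A : ProjectiveResolution (ModuleCat.of Q R)) (e : A.complex.X 0 ≃ₗ[Q] Q) (q : Q) :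
    algebraMap Q R q = 0 ↔ ∃ v, dOne A.complex e v = q := by
  set r : R := TorChange.aug A (e.symm 1) with hr
  have h1 : ∀ q, TorChange.aug A (e.symm q) = algebraMap Q R q * r := fun q => by
    conv_lhs => rw [← mul_one q, ← smul_eq_mul, map_smul, map_smul]
    exact Algebra.smul_def _ _
  obtain ⟨x, hx⟩ := TorChange.aug_surjective A (1 : R)
  have hu : IsUnit r := by
    rw [← e.symm_apply_apply x, h1] at hx
    exact IsUnit.of_mul_eq_one _ ((mul_comm _ _).trans hx)
  rw [← hu.mul_left_eq_zero, ← h1]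
  constructor
  · intro h
    obtain ⟨y, hy⟩ := TorChange.resolution_exact_zero A _ h
    refine ⟨DirectSum.lof Q ℕ (fun i => A.complex.X (i + 1)) 0 y, ?_⟩
    rw [dOne, LinearMap.comp_apply, LinearMap.comp_apply, DirectSum.component.lof_self]
    exact (congrArg e hy).trans (e.apply_symm_apply q)
  · rintro ⟨v, rfl⟩
    rw [dOne, LinearMap.comp_apply, LinearMap.comp_apply]
    refine Eq.trans (congrArg _ (e.symm_apply_apply _)) ?_
    exact TorChange.aug_d A _

/-- `w` lives in degree `N - 1`, whose sign is opposite to that of `N`. With `N` the total degree of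
the arguments, this is the oddness of `m_n`. -/
theorem sgn_eq_of_degree (A : ChainComplex (ModuleCat.{u} Q) ℕ) (N : ℕ) (w : PlusShift A)
    (h : ∀ t, (t + 2) + 1 ≠ N → w t = 0) : sgn A w = -((-1 : Q) ^ N • w) := by
  refine DFinsupp.ext fun t => ?_
  rw [sgn_apply]
  change (-1 : Q) ^ (t + 2) • w t = -((-1 : Q) ^ N • w t)
  by_cases ht : (t + 2) + 1 = N
  · rw [← ht, pow_succ _ (t + 2), mul_neg_one, neg_smul, neg_neg]
  · rw [h t ht, smul_zero, smul_zero, neg_zero]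

theorem AlgStr.sgn_m {A : ChainComplex (ModuleCat.{u} Q) ℕ} {e : A.X 0 ≃ₗ[Q] Q}
    [∀ i, Module.Free Q (A.X i)] (m : AlgStr A e) (n : ℕ) (x : Fin n → PlusShift A) :
    sgn A (m.m n x) = -m.m n fun l => sgn A (x l) := by
  rcases Nat.eq_zero_or_pos n with rfl | hn
  · simp [m.m_zero]
  suffices h : (sgn A).compMultilinearMap (m.m n) =
      -(m.m n).compLinearMap fun _ => sgn A from MultilinearMap.congr_fun h x
  refine Module.Basis.ext_multilinear (fun _ => gradedBasis fun i => A.X (i + 1)) fun b => ?_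
  have hb : ∀ b : GradedIndex (Q := Q) fun i => A.X (i + 1), sgn A (gradedBasis (fun i => A.X (i + 1)) b) =
      (-1 : Q) ^ (b.1 + 2) • gradedBasis (fun i => A.X (i + 1)) b := fun b => by
    rw [gradedBasis_apply, sgn, DirectSum.toModule_lof, LinearMap.smul_apply]
  simp only [LinearMap.compMultilinearMap_apply, neg_apply,
    MultilinearMap.compLinearMap_apply, hb]
  rw [MultilinearMap.map_smul_univ, prod_pow_eq_pow_sum]
  simp only [gradedBasis_apply]
  exact sgn_eq_of_degree A _ _ fun t ht => m.degree n hn _ _ t ht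

/-- The data for the bar construction given by A-infinity structures on resolutions. -/
noncomputable def barData {R : Type u} [CommRing R] [Algebra Q R]
    (A : ProjectiveResolution (ModuleCat.of Q R)) [∀ i, Module.Free Q (A.complex.X i)]
    {e : A.complex.X 0 ≃ₗ[Q] Q} (m : AlgStr A.complex e) {Z : ModuleCat.{u} Q}
    (G : ProjectiveResolution Z) [∀ i, Module.Free Q (G.complex.X i)] (mG : ModStr m G.complex) :
    BarData Q (PlusShift A.complex) (Tot G.complex)
      (GradedIndex (Q := Q) fun i => A.complex.X (i + 1))
      (GradedIndex (Q := Q) fun i => G.complex.X i) where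
  bV := gradedBasis fun i => A.complex.X (i + 1)
  bW := gradedBasis fun i => G.complex.X i
  m := m.m
  mG := mG.mG
  s := sgn A.complex
  d1 := dOne A.complex e
  m_zero := m.m_zero
  s_s v := by
    refine DFinsupp.ext fun t => ?_
    rw [sgn_apply, sgn_apply, smul_smul, ← pow_add, Even.neg_one_pow ⟨t + 2, rfl⟩, one_smul]
  s_m := m.sgn_m
  -- `AlgStr` states relations from `n = 2` on; for `n = 1` the relation is `dPlus` squaring to
  -- zero, and for `n = 0` the sum is empty.
  rel n x := by
    rcases n with _ | _ | _ | n
    · simp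
    · simp only [zero_add, Icc_self, sum_singleton, Nat.sub_self, range_one]
      exact (m.m_one _).trans ((congrArg _ (m.m_one _)).trans (dPlus_dPlus _ _))
    · exact m.rel_two x
    · rw [if_neg (by omega)]
      exact m.rel _ (by omega) x
  relG p x g := by
    rcases p with _ | _ | p
    · simp only [zero_add, range_one, sum_singleton, mG.m_one, dTot_dTot]
      simp
    · exact mG.rel_two x g
    · rw [if_neg (by omega)]
      exact mG.rel _ (by omega) x g
  degV b := b.1 + 2
  degW c := c.1
  two_le b := Nat.le_add_left 2 b.1
  m_deg n a c h := by
    by_contra h'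
    rcases Nat.eq_zero_or_pos n with rfl | hn
    · simp [m.m_zero] at h
    · refine h ?_
      simp only [gradedBasis_apply]
      rw [gradedBasis_repr, m.degree n hn _ _ _ h', map_zero]
      rfl
  mG_deg n a g c h := by
    by_contra h'
    refine h ?_
    simp only [gradedBasis_apply]
    rw [gradedBasis_repr, mG.degree n _ _ _ _ _ h', map_zero]
    rfl
  s_basis b := by
    rw [gradedBasis_apply, sgn, DirectSum.toModule_lof, LinearMap.smul_apply]
  exact_V v hv h1 := by
    rw [m.m_one] at hv
    obtain ⟨v', h2, h3⟩ := exists_dPlus_eq A e v hv h1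
    exact ⟨v', (m.m_one _).trans h2, h3⟩
  exact_W w hw h0 := by
    rw [mG.m_one] at hw
    obtain ⟨w', h⟩ := exists_dTot_eq G w hw ((Module.Free.chooseBasis Q _).repr.map_eq_zero_iff.1
      (Finsupp.ext fun c => h0 ⟨0, c⟩ rfl))
    exact ⟨w', by rw [mG.m_one, h]⟩

end AInf

/-! ### Ideals in coordinates and extension of scalars -/

namespace TorChange

open TensorProduct

variable {Q R : Type u} [CommRing Q] [CommRing R] [Algebra Q R]

theorem mem_ideal_smul_top_iff_repr {S X σ : Type*} [CommRing S] [AddCommGroup X] [Module S X]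
    (b : Module.Basis σ S X) (I : Ideal S) (x : X) :
    x ∈ I • (⊤ : Submodule S X) ↔ ∀ i, b.repr x i ∈ I := by
  constructor
  · intro h i
    refine Submodule.smul_induction_on h (fun r hr y _ => ?_) fun y z hy hz => ?_
    · rw [map_smul]
      exact I.mul_mem_right _ hr
    · rw [map_add]
      exact I.add_mem hy hz
  · intro h
    rw [← b.linearCombination_repr x, Finsupp.linearCombination_apply]
    exact Submodule.sum_mem _ fun i _ => Submodule.smul_mem_smul (h i) trivial

theorem unit_surjective (hR : Function.Surjective (algebraMap Q R)) (X : ModuleCat.{u} Q) :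
    Function.Surjective ((ModuleCat.extendRestrictScalarsAdj (algebraMap Q R)).unit.app X) := by
  intro z
  let N := (ModuleCat.restrictScalars (algebraMap Q R)).obj (ModuleCat.of R R)
  let o : N := (1 : R)
  have ho : ∀ a : N, ∃ s : Q, s • o = a := fun a => by
    obtain ⟨q, hq⟩ := hR a
    exact ⟨q, (mul_one (algebraMap Q R q)).trans hq⟩
  obtain ⟨x, hx⟩ := exists_tmul_eq ho (TensorProduct.comm Q N X z)
  exact ⟨x, (TensorProduct.comm Q N X).injective hx⟩

theorem unit_eq_zero_iff (hR : Function.Surjective (algebraMap Q R)) (X : ModuleCat.{u} Q) (x : X) :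
    (ModuleCat.extendRestrictScalarsAdj (algebraMap Q R)).unit.app X x = 0 ↔
      x ∈ RingHom.ker (algebraMap Q R) • (⊤ : Submodule Q X) := by
  let N := (ModuleCat.restrictScalars (algebraMap Q R)).obj (ModuleCat.of R R)
  let o : N := (1 : R)
  have ho : ∀ a : N, ∃ s : Q, s • o = a := fun a => by
    obtain ⟨q, hq⟩ := hR a
    exact ⟨q, (mul_one (algebraMap Q R q)).trans hq⟩
  have hI : ∀ s : Q, s • o = 0 ↔ s ∈ RingHom.ker (algebraMap Q R) := fun s => by
    rw [RingHom.mem_ker, ← mul_one (algebraMap Q R s)]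
    rfl
  rw [← tmul_eq_zero_iff_of_cyclic ho hI]
  exact (TensorProduct.comm Q N X).map_eq_zero_iff (x := o ⊗ₜ x).symm

end TorChange

/-! ### Resolutions from augmented bar complexes -/

namespace AInf

open Finset DirectSum

namespace BarData

section General

variable {Q V W β γ : Type u} [CommRing Q] [AddCommGroup V] [Module Q V] [AddCommGroup W]
    [Module Q W] (B : BarData Q V W β γ) {S : Type u} [CommRing S] [Algebra Q S]
    {Sh : Set (List β × γ)} {k : ℕ}

theorem red_mem_smul_top_iff {I : Ideal Q} {J : Ideal S} (h : ∀ q, algebraMap Q S q ∈ J ↔ q ∈ I)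
    (n : ℕ) (u : Words Q β γ) :
    B.red S Sh n u ∈ J • (⊤ : Submodule S (B.Idx Sh n →₀ S)) ↔
      ∀ l ∈ Sh, B.wdeg l = n → u l ∈ I := by
  rw [TorChange.mem_ideal_smul_top_iff_repr Finsupp.basisSingleOne]
  exact ⟨fun h' l hl hn => (h _).1 (h' ⟨l, hl, hn⟩), fun h' l => (h _).2 (h' l.1 l.2.1 l.2.2)⟩

theorem K_apply_nil (h : (List β × γ) →₀ V) (c : γ) : B.K h ([], c) = 0 := by
  have : Finsupp.lapply ([], c) ∘ₗ B.K = 0 := Finsupp.lhom_ext fun l v => by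
    rw [LinearMap.comp_apply, K_single, Finsupp.lapply_apply, cons_apply_nil, LinearMap.zero_apply]
  exact LinearMap.congr_fun this h

/-- Letters have degree at least `2`, so words of degree at most `1` have none. -/
theorem exists_red_ι_eq (hS : Function.Surjective (algebraMap Q S)) {n : ℕ} (hn : n ≤ 1)
    (x : B.Idx Set.univ n →₀ S) : ∃ g, B.red S Set.univ n (B.ι g) = x := by
  obtain ⟨u, -, -, rfl⟩ := B.exists_red_eq hS n x
  obtain ⟨g, hg⟩ := B.exists_eq_ι_add_K u
  refine ⟨g, ?_⟩
  rw [← sub_eq_zero, ← map_sub, red_eq_zero_iff]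
  rintro ⟨_ | ⟨b, l⟩, c⟩ - hl
  · rw [hg, sub_add_cancel_left, Finsupp.neg_apply, K_apply_nil, neg_zero, map_zero]
  · have := B.two_le b
    simp [wdeg] at hl
    omega

/-- The resolution given by a bar complex and an augmentation. -/
noncomputable def IsBarComplex.resolution {B : BarData Q V W β γ} (hB : B.IsBarComplex S Sh k)
    {Z : ModuleCat.{u} S} (ε : (B.Idx Sh k →₀ S) →ₗ[S] Z) (hε : Function.Surjective ε)
    (hz : ∀ y, ε (B.dRed S Sh k y) = 0) (h0 : ∀ x, ε x = 0 → ∃ y, B.dRed S Sh k y = x) :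
    ProjectiveResolution Z :=
  TorChange.resolutionOfExact hB.complex hB.complex_projective (ModuleCat.ofHom ε) hε
    (by
      rw [hB.complex_d]
      exact ModuleCat.hom_ext (LinearMap.ext hz))
    (fun x hx => by
      obtain ⟨y, hy⟩ := h0 x hx
      refine ⟨y, ?_⟩
      rw [hB.complex_d]
      exact hy)
    (fun n x hx => by
      rw [hB.complex_d] at hx
      obtain ⟨y, hy⟩ := hB.exists_dRed_eq (k + n) (Nat.le_add_right k n) x hx
      refine ⟨y, ?_⟩
      rw [hB.complex_d]
      exact hy)

theorem IsBarComplex.aug_resolution {B : BarData Q V W β γ} (hB : B.IsBarComplex S Sh k)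
    {Z : ModuleCat.{u} S} (ε : (B.Idx Sh k →₀ S) →ₗ[S] Z) (hε : Function.Surjective ε)
    (hz : ∀ y, ε (B.dRed S Sh k y) = 0) (h0 : ∀ x, ε x = 0 → ∃ y, B.dRed S Sh k y = x)
    (x : B.Idx Sh k →₀ S) : TorChange.aug (hB.resolution ε hε hz h0) x = ε x :=
  LinearMap.congr_fun (congrArg ModuleCat.Hom.hom (TorChange.aug_resolutionOfExact hB.complex
    hB.complex_projective (ModuleCat.ofHom ε) hε _ _ _)) x

/-- The map induced on words with coefficients in `S` by the inclusion of a set of words. -/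
noncomputable def redMap (S : Type u) [CommRing S] [Algebra Q S] (Sh : Set (List β × γ)) (n : ℕ) :
    (B.Idx Sh n →₀ Q) →ₗ[Q] (B.Idx Set.univ n →₀ S) :=
  B.red S Set.univ n ∘ₗ Finsupp.lmapDomain Q Q Subtype.val

theorem redMap_red (n : ℕ) {u : Words Q β γ} (hu : u ∈ Finsupp.supported Q Q Sh) :
    B.redMap S Sh n (B.red Q Sh n u) = B.red S Set.univ n u := by
  refine Finsupp.ext fun l => ?_
  rw [redMap, LinearMap.comp_apply, red_apply, red_apply, Finsupp.lmapDomain_apply]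
  by_cases h : l.1 ∈ Sh
  · rw [show l.1 = (⟨l.1, h, l.2.2⟩ : B.Idx Sh n).1 from rfl,
      Finsupp.mapDomain_apply Subtype.val_injective]
    rfl
  · rw [Finsupp.mapDomain_of_notMem_range, Finsupp.notMem_support_iff.1 fun h' => h (hu h')]
    rintro ⟨l', h'⟩
    exact h (h' ▸ l'.2.1)

end General

end BarData

end AInf

/-! ### Bar resolutions of the module and of its syzygy -/

namespace AInf

open Finset DirectSum

namespace BarData

variable {Q R V β γ : Type u} [CommRing Q] [CommRing R] [Algebra Q R] [AddCommGroup V] [Module Q V]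
    {C : ChainComplex (ModuleCat.{u} Q) ℕ} {M : ModuleCat.{u} R}

/-- The data comes from the complex `C`, with its differential and its grading. -/
structure IsGraded (B : BarData Q V (Tot C) β γ) : Prop where
  mG_zero : ∀ x, B.mG 0 x = dTot C
  mem_smul_top_iff : ∀ (I : Ideal Q) (g : Tot C) (t : ℕ),
    g t ∈ I • (⊤ : Submodule Q (C.X t)) ↔ ∀ c, B.degW c = t → B.bW.repr g c ∈ I

/-- A presentation of the augmentation `g ↦ h (j g)` of `C`, where `j` is, up to isomorphism, the
map `C₀ → R ⊗ C₀`. -/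
structure Presentation (C : ChainComplex (ModuleCat.{u} Q) ℕ) (R : Type u) [CommRing R]
    [Algebra Q R] (M : ModuleCat.{u} R) where
  E : ModuleCat.{u} R
  j : C.X 0 →ₛₗ[algebraMap Q R] E
  h : E →ₗ[R] M
  j_surjective : Function.Surjective j
  j_eq_zero_iff : ∀ x, j x = 0 ↔ x ∈ RingHom.ker (algebraMap Q R) • (⊤ : Submodule Q (C.X 0))
  h_j_d : ∀ y, h (j (C.d 1 0 y)) = 0
  exists_d_eq : ∀ x, h (j x) = 0 → ∃ y, C.d 1 0 y = x
  h_surjective : Function.Surjective h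

variable {B : BarData Q V (Tot C) β γ}

theorem IsGraded.D_ι (hB : B.IsGraded) (g : Tot C) : B.D (B.ι g) = B.ι (dTot C g) := by
  rw [B.D_ι 0, MG, hB.mG_zero]

theorem IsGraded.red_ι_eq_zero_iff (hB : B.IsGraded) (n : ℕ) (g : Tot C) :
    B.red R Set.univ n (B.ι g) = 0 ↔
      g n ∈ RingHom.ker (algebraMap Q R) • (⊤ : Submodule Q (C.X n)) := by
  rw [red_eq_zero_iff, hB.mem_smul_top_iff]
  constructor
  · intro h c hc
    have := h ([], c) trivial (by simpa [wdeg] using hc)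
    rwa [ι_apply_nil] at this
  · rintro h ⟨_ | ⟨b, l⟩, c⟩ - hl
    · rw [ι_apply_nil]
      exact h c (by simpa [wdeg] using hl)
    · rw [ι_apply_cons, map_zero]

theorem IsGraded.red_ι_eq (hB : B.IsGraded) (n : ℕ) {g g' : Tot C} (h : g n = g' n) :
    B.red R Set.univ n (B.ι g) = B.red R Set.univ n (B.ι g') := by
  rw [← sub_eq_zero, ← map_sub, ← map_sub, hB.red_ι_eq_zero_iff]
  rw [show (g - g') n = g n - g' n from rfl, h, sub_self]
  exact Submodule.zero_mem _

theorem IsGraded.dRed_red_ι (hB : B.IsGraded) (n : ℕ) (g : Tot C) :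
    B.dRed R Set.univ n (B.red R Set.univ (n + 1) (B.ι g)) =
      B.red R Set.univ n (B.ι (dTot C g)) := by
  rw [B.dRed_red n (by simp), hB.D_ι]

theorem basis_apply_eq_zero_of_degW_ne (hB : B.IsGraded) {c : γ} {t : ℕ} (h : B.degW c ≠ t) :
    B.bW c t = 0 := by
  have := (hB.mem_smul_top_iff ⊥ (B.bW c) t).2 fun c' hc' => by
    rw [Module.Basis.repr_self, Finsupp.single_eq_of_ne]
    · exact Submodule.zero_mem _
    · rintro rfl
      exact h hc'
  simpa using this

/-- The isomorphism of the degree `0` part of the bar complex with `R ⊗ C₀`. -/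
noncomputable def zeroMap (B : BarData Q V (Tot C) β γ) (p : Presentation C R M) :
    (B.Idx Set.univ 0 →₀ R) →ₗ[R] p.E :=
  Finsupp.linearCombination R fun l => p.j (B.bW l.1.2 0)

theorem IsGraded.zeroMap_red_ι (hB : B.IsGraded) (p : Presentation C R M) (g : Tot C) :
    B.zeroMap p (B.red R Set.univ 0 (B.ι g)) = p.j (g 0) := by
  have hg : g ∈ Submodule.span Q (Set.range B.bW) := B.bW.span_eq ▸ trivial
  induction hg using Submodule.span_induction with
  | mem g h =>
    obtain ⟨c, rfl⟩ := h
    by_cases hc : B.degW c = 0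
    · have : B.red R Set.univ 0 (B.ι (B.bW c)) =
          Finsupp.single ⟨([], c), trivial, by simpa [wdeg] using hc⟩ 1 := by
        classical
        refine Finsupp.ext fun l => ?_
        rw [red_apply, ι_basis, Finsupp.single_apply, Finsupp.single_apply]
        by_cases h : ([], c) = l.1
        · rw [if_pos h, if_pos (Subtype.ext h), map_one]
        · rw [if_neg h, if_neg fun h' => h (congrArg Subtype.val h'), map_zero]
      rw [this, zeroMap, Finsupp.linearCombination_single, one_smul]
    · have h0 : B.bW c 0 = 0 := basis_apply_eq_zero_of_degW_ne hB hc
      rw [(hB.red_ι_eq_zero_iff 0 _).2 (h0 ▸ Submodule.zero_mem _), h0, map_zero, map_zero]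
  | zero =>
    rw [map_zero, map_zero, map_zero]
    exact (map_zero p.j).symm
  | add x y _ _ hx hy =>
    rw [map_add, map_add, map_add, hx, hy]
    exact (map_add p.j _ _).symm
  | smul q x _ hx =>
    rw [map_smul, map_smul, ← algebraMap_smul R q (B.red R Set.univ 0 (B.ι x)), map_smul, hx]
    exact (p.j.map_smulₛₗ q (x 0)).symm

/-- The degree `0` part and `p.E` are both `C₀` modulo the kernel of `Q → R` times `C₀`. -/
theorem IsGraded.zeroMap_injective (hB : B.IsGraded) (hR : Function.Surjective (algebraMap Q R))
    (p : Presentation C R M) : Function.Injective (B.zeroMap p) := by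
  refine (injective_iff_map_eq_zero _).2 fun x hx => ?_
  obtain ⟨g, rfl⟩ := B.exists_red_ι_eq hR (Nat.zero_le 1) x
  rw [hB.zeroMap_red_ι, p.j_eq_zero_iff] at hx
  exact (hB.red_ι_eq_zero_iff 0 g).2 hx

theorem IsGraded.h_zeroMap_dRed (hB : B.IsGraded) (hR : Function.Surjective (algebraMap Q R))
    (p : Presentation C R M) (y : B.Idx Set.univ 1 →₀ R) :
    p.h (B.zeroMap p (B.dRed R Set.univ 0 y)) = 0 := by
  obtain ⟨g, rfl⟩ := B.exists_red_ι_eq hR le_rfl y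
  rw [hB.dRed_red_ι, hB.zeroMap_red_ι, dTot_apply, p.h_j_d]

theorem IsGraded.exists_zeroMap_dRed_eq (hB : B.IsGraded) (p : Presentation C R M) (z : p.E)
    (hz : p.h z = 0) :
    ∃ g, B.zeroMap p (B.dRed R Set.univ 0 (B.red R Set.univ 1 (B.ι g))) = z := by
  obtain ⟨x, rfl⟩ := p.j_surjective z
  obtain ⟨y, rfl⟩ := p.exists_d_eq x hz
  refine ⟨DirectSum.lof Q ℕ (fun i => C.X i) 1 y, ?_⟩
  rw [hB.dRed_red_ι, hB.zeroMap_red_ι, dTot_apply, DirectSum.lof_apply]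

section Resolutions

variable (hB : B.IsGraded) (hR : Function.Surjective (algebraMap Q R)) (p : Presentation C R M)

/-- The augmentation of the bar resolution of the syzygy. -/
noncomputable def syzygyAug : (B.Idx Set.univ 1 →₀ R) →ₗ[R] LinearMap.ker p.h :=
  (B.zeroMap p ∘ₗ B.dRed R Set.univ 0).codRestrict _ (hB.h_zeroMap_dRed hR p)

theorem syzygyAug_eq_zero_iff (x : B.Idx Set.univ 1 →₀ R) :
    syzygyAug hB hR p x = 0 ↔ B.dRed R Set.univ 0 x = 0 := by
  rw [← (hB.zeroMap_injective hR p).eq_iff, map_zero]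
  exact Subtype.ext_iff

theorem exists_syzygyAug_red_ι_eq (z : LinearMap.ker p.h) :
    ∃ g, syzygyAug hB hR p (B.red R Set.univ 1 (B.ι g)) = z := by
  obtain ⟨g, hg⟩ := hB.exists_zeroMap_dRed_eq p z.1 z.2
  exact ⟨g, Subtype.ext hg⟩

theorem syzygyAug_dRed (hker : ∀ q : Q, algebraMap Q R q = 0 ↔ ∃ v, B.d1 v = q)
    (y : B.Idx Set.univ 2 →₀ R) :
    syzygyAug hB hR p (B.dRed R Set.univ 1 y) = 0 :=
  (syzygyAug_eq_zero_iff hB hR p _).2 ((B.isBarComplex_of_ker hR hker 0).dRed_dRed 0 le_rfl y)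

variable (hker : ∀ q : Q, algebraMap Q R q = 0 ↔ ∃ v, B.d1 v = q)

/-- The bar resolution of `M` over `R`. -/
noncomputable def resolution : ProjectiveResolution M :=
  (B.isBarComplex_of_ker hR hker 0).resolution (p.h ∘ₗ B.zeroMap p)
    (fun m => by
      obtain ⟨z, rfl⟩ := p.h_surjective m
      obtain ⟨x, rfl⟩ := p.j_surjective z
      exact ⟨B.red R Set.univ 0 (B.ι (DirectSum.lof Q ℕ (fun i => C.X i) 0 x)), by
        rw [LinearMap.comp_apply, hB.zeroMap_red_ι, DirectSum.lof_apply]⟩)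
    (hB.h_zeroMap_dRed hR p)
    (fun x hx => by
      obtain ⟨g, hg⟩ := hB.exists_zeroMap_dRed_eq p _ hx
      exact ⟨_, hB.zeroMap_injective hR p hg⟩)

/-- The bar resolution of the syzygy over `R`. -/
noncomputable def syzygyResolution : ProjectiveResolution (ModuleCat.of R (LinearMap.ker p.h)) :=
  (B.isBarComplex_of_ker hR hker 1).resolution (syzygyAug hB hR p)
    (fun z => by
      obtain ⟨g, hg⟩ := exists_syzygyAug_red_ι_eq hB hR p z
      exact ⟨_, hg⟩)
    (syzygyAug_dRed hB hR p hker)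
    (fun x hx => (B.isBarComplex_of_ker hR hker 0).exists_dRed_eq 0 le_rfl x
      ((syzygyAug_eq_zero_iff hB hR p x).1 hx))

/-- The resolution of the syzygy over `Q` by short words. -/
noncomputable def shortResolution :
    ProjectiveResolution ((TorChange.res Q R).obj (ModuleCat.of R (LinearMap.ker p.h))) :=
  B.isBarComplex_short.resolution
    (({ toFun := fun x => syzygyAug hB hR p x
        map_add' := map_add _
        map_smul' := fun q x => by
          rw [← algebraMap_smul R q x, map_smul]
          rfl } : (B.Idx Set.univ 1 →₀ R) →ₗ[Q]
        (TorChange.res Q R).obj (ModuleCat.of R (LinearMap.ker p.h))) ∘ₗ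
      B.redMap R {l | B.IsShort 1 l} 1)
    (fun z => by
      obtain ⟨g, hg⟩ := exists_syzygyAug_red_ι_eq hB hR p z
      refine ⟨B.red Q _ 1 (B.ι g), Eq.trans (congrArg (syzygyAug hB hR p) ?_) hg⟩
      exact B.redMap_red 1 (B.ι_mem_short 1 g))
    (fun y => by
      obtain ⟨u, hu, -, rfl⟩ := B.exists_red_eq Function.surjective_id _ y
      refine Eq.trans (congrArg (syzygyAug hB hR p) ?_)
        (syzygyAug_dRed hB hR p hker (B.red R Set.univ 2 u))
      rw [B.dRed_red 1 hu, B.redMap_red 1 (B.D_mem_short hu), B.dRed_red 1 (by simp)])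
    (fun x hx => by
      obtain ⟨u, hu, hu', rfl⟩ := B.exists_red_eq Function.surjective_id _ x
      have h1 : syzygyAug hB hR p (B.redMap R {l | B.IsShort 1 l} 1 (B.red Q _ 1 u)) = 0 := hx
      rw [B.redMap_red 1 hu, syzygyAug_eq_zero_iff, B.dRed_red 0 (by simp)] at h1
      -- Here `D u` vanishes only modulo the image of `d1`. The correcting words have tails of
      -- degree `0 < 1`, so the bounding element is still short and `u` bounds over `Q`.
      obtain ⟨u', h2, rfl⟩ := exists_D_eq_of_red hker Nat.one_pos hu hu' h1
      exact ⟨B.red Q _ 2 u', B.dRed_red 1 h2⟩)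

theorem aug_resolution (x : B.Idx Set.univ 0 →₀ R) :
    TorChange.aug (resolution hB hR p hker) x = p.h (B.zeroMap p x) :=
  IsBarComplex.aug_resolution _ _ _ _ _ x

theorem aug_syzygyResolution (x : B.Idx Set.univ 1 →₀ R) :
    TorChange.aug (syzygyResolution hB hR p hker) x = syzygyAug hB hR p x :=
  IsBarComplex.aug_resolution _ _ _ _ _ x

theorem aug_shortResolution (x : B.Idx {l | B.IsShort 1 l} 1 →₀ Q) :
    TorChange.aug (shortResolution hB hR p hker) x =
      syzygyAug hB hR p (B.redMap R {l | B.IsShort 1 l} 1 x) :=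
  IsBarComplex.aug_resolution _ _ _ _ _ x

end Resolutions

end BarData

end AInf

/-! ### The change of rings map of the syzygy -/

namespace AInf

open Finset DirectSum IsLocalRing

namespace BarData

variable {Q R V β γ : Type u} [CommRing Q] [CommRing R] [Algebra Q R] [AddCommGroup V] [Module Q V]
    {C : ChainComplex (ModuleCat.{u} Q) ℕ} {M : ModuleCat.{u} R} {B : BarData Q V (Tot C) β γ}

section Inclusions

variable (hB : B.IsGraded) (hR : Function.Surjective (algebraMap Q R)) (p : Presentation C R M)
    (hker : ∀ q : Q, algebraMap Q R q = 0 ↔ ∃ v, B.d1 v = q)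

theorem resolution_d (n : ℕ) : (resolution hB hR p hker).complex.d (n + 1) n =
    ModuleCat.ofHom (B.dRed R Set.univ (0 + n)) :=
  (B.isBarComplex_of_ker hR hker 0).complex_d n

theorem syzygyResolution_d (n : ℕ) : (syzygyResolution hB hR p hker).complex.d (n + 1) n =
    ModuleCat.ofHom (B.dRed R Set.univ (1 + n)) :=
  (B.isBarComplex_of_ker hR hker 1).complex_d n

theorem shortResolution_d (n : ℕ) : (shortResolution hB hR p hker).complex.d (n + 1) n =
    ModuleCat.ofHom (B.dRed Q {l | B.IsShort 1 l} (1 + n)) :=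
  B.isBarComplex_short.complex_d n

/-- The inclusion of `C` into the bar resolution as the words without letters. -/
noncomputable def inclusion :
    C ⟶ TorChange.resComplex (Q := Q) (resolution hB hR p hker).complex where
  f n := ModuleCat.ofHom (Y := (TorChange.res Q R).obj (ModuleCat.of R (B.Idx Set.univ (0 + n) →₀ R)))
    { toFun := fun x => B.red R Set.univ (0 + n) (B.ι (DirectSum.lof Q ℕ (fun i => C.X i) n x))
      map_add' := fun x y => by rw [map_add, map_add, map_add]; rfl
      map_smul' := fun q x => by
        rw [map_smul, map_smul, map_smul, ← algebraMap_smul R q]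
        rfl }
  comm' := by
    rintro _ n rfl
    refine ModuleCat.hom_ext (LinearMap.ext fun x => ?_)
    refine Eq.trans (congrArg (fun d : (resolution hB hR p hker).complex.X (n + 1) ⟶
      (resolution hB hR p hker).complex.X n =>
        d (B.red R Set.univ (0 + n + 1) (B.ι (DirectSum.lof Q ℕ (fun i => C.X i) (n + 1) x))))
      (resolution_d hB hR p hker n)) ?_
    refine (hB.dRed_red_ι (0 + n) _).trans (hB.red_ι_eq (0 + n) ?_)
    rw [dTot, DirectSum.toModule_lof]
    rfl

/-- The map from the resolution of the syzygy by short words to the bar resolution. -/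
noncomputable def shortInclusion : (shortResolution hB hR p hker).complex ⟶
    TorChange.resComplex (Q := Q) (syzygyResolution hB hR p hker).complex where
  f n := ModuleCat.ofHom (Y := (TorChange.res Q R).obj (ModuleCat.of R (B.Idx Set.univ (1 + n) →₀ R)))
    { toFun := fun x => B.redMap R {l | B.IsShort 1 l} (1 + n) x
      map_add' := fun x y => map_add _ _ _
      map_smul' := fun q x => by
        rw [map_smul, ← algebraMap_smul R q]
        rfl }
  comm' := by
    rintro _ n rfl
    refine ModuleCat.hom_ext (LinearMap.ext fun x => ?_)
    refine Eq.trans (congrArg (fun d : (syzygyResolution hB hR p hker).complex.X (n + 1) ⟶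
      (syzygyResolution hB hR p hker).complex.X n =>
        d (B.redMap R {l | B.IsShort 1 l} (1 + n + 1) x)) (syzygyResolution_d hB hR p hker n)) ?_
    refine Eq.trans ?_ (congrArg (fun d : (shortResolution hB hR p hker).complex.X (n + 1) ⟶
      (shortResolution hB hR p hker).complex.X n => B.redMap R {l | B.IsShort 1 l} (1 + n) (d x))
        (shortResolution_d hB hR p hker n)).symm
    obtain ⟨u, hu, -, rfl⟩ := B.exists_red_eq Function.surjective_id (1 + n + 1) x
    refine Eq.trans (congrArg (B.dRed R Set.univ (1 + n)) (B.redMap_red (1 + n + 1) hu)) ?_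
    refine (B.dRed_red (1 + n) (by simp)).trans ?_
    refine Eq.trans ?_ (congrArg (B.redMap R {l | B.IsShort 1 l} (1 + n))
      (B.dRed_red (1 + n) hu)).symm
    exact (B.redMap_red (1 + n) (B.D_mem_short hu)).symm

theorem shortInclusion_aug : (shortInclusion hB hR p hker).f 0 ≫
    TorChange.resAug Q (syzygyResolution hB hR p hker) =
      TorChange.aug (shortResolution hB hR p hker) := by
  refine ModuleCat.hom_ext (LinearMap.ext fun x => ?_)
  refine Eq.trans ?_ (aug_shortResolution hB hR p hker x).symm
  exact aug_syzygyResolution hB hR p hker (B.redMap R {l | B.IsShort 1 l} 1 x)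

end Inclusions

/-- The inclusion of short words into all words lifts the identity of the syzygy, so it computes the
map. Both resolutions start in word degree `1`, whence the shift to `n + 1` in `ShortInjective`. -/
theorem changeOfRings_syzygy_injective_iff [IsLocalRing Q] [IsLocalRing R] (hB : B.IsGraded)
    (hR : Function.Surjective (algebraMap Q R)) (p : Presentation C R M)
    (hker : ∀ q : Q, algebraMap Q R q = 0 ↔ ∃ v, B.d1 v = q) (n : ℕ) :
    Function.Injective (TorChange.changeOfRings Q (ModuleCat.of R (LinearMap.ker p.h))
      (ModuleCat.of R (ResidueField R)) n) ↔ B.ShortInjective (maximalIdeal Q) n := by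
  have : IsLocalHom (algebraMap Q R) := IsLocalHom.of_surjective _ hR
  have hI : ∀ q, algebraMap Q R q ∈ maximalIdeal R ↔ q ∈ maximalIdeal Q := fun q => by
    rw [mem_maximalIdeal, mem_maximalIdeal, mem_nonunits_iff, mem_nonunits_iff, isUnit_map_iff]
  have hQ : ∀ q, algebraMap Q Q q ∈ maximalIdeal Q ↔ q ∈ maximalIdeal Q := fun _ => Iff.rfl
  rw [TorChange.changeOfRings_injective_iff _ _ _ (shortInclusion_aug hB hR p hker),
    TorChange.mono_homologyMap_residueField_iff hR]
  have hd : ∀ n, (shortResolution hB hR p hker).complex.d (n + 1) n =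
    ModuleCat.ofHom (B.dRed Q {l | B.IsShort 1 l} (1 + n)) := fun n => shortResolution_d hB hR p hker n
  have hd' : ∀ n, (syzygyResolution hB hR p hker).complex.d (n + 1) n =
    ModuleCat.ofHom (B.dRed R Set.univ (1 + n)) := fun n => syzygyResolution_d hB hR p hker n
  rw [hd, hd']
  constructor
  · intro h f hf hf' u hu
    obtain ⟨z, hz⟩ := h (B.red Q _ (1 + n) f) (fun j hj => by
        subst hj
        rw [hd]
        refine Eq.mpr (congrArg (· ∈ _) (B.dRed_red (1 + j) hf)) ?_
        refine (B.red_mem_smul_top_iff hQ (1 + j) (B.D f)).2 fun l _ hl => ?_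
        exact hf' (by omega) l (by omega))
      (B.red R _ (1 + n + 1) u) (by
        refine Eq.mpr (congrArg (· ∈ _) (congrArg₂ (fun a b : B.Idx Set.univ (1 + n) →₀ R => a - b)
          (B.redMap_red (1 + n) hf) (B.dRed_red (S := R) (1 + n) (u := u) (by simp)))) ?_
        rw [← map_sub]
        refine (B.red_mem_smul_top_iff hI (1 + n) (f - B.D u)).2 fun l _ hl => ?_
        exact hu l (by omega))
    obtain ⟨f', h1, -, rfl⟩ := B.exists_red_eq Function.surjective_id (1 + n + 1) z
    refine ⟨f', h1, fun l hl => ?_⟩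
    have h2 : B.red Q {l | B.IsShort 1 l} (1 + n) f -
      B.dRed Q {l | B.IsShort 1 l} (1 + n) (B.red Q _ (1 + n + 1) f') ∈
      maximalIdeal Q • (⊤ : Submodule Q (B.Idx {l | B.IsShort 1 l} (1 + n) →₀ Q)) := hz
    rw [B.dRed_red _ h1, ← map_sub, B.red_mem_smul_top_iff hQ] at h2
    by_cases hl' : B.IsShort 1 l
    · exact h2 l hl' (by omega)
    · have h3 : (f - B.D f') l = 0 := by
        by_contra h0
        exact hl' (B.mem_short.1 (Submodule.sub_mem _ hf (B.D_mem_short h1)) l h0)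
      rw [h3]
      exact Ideal.zero_mem _
  · intro h x hx y hy
    obtain ⟨f, hf, -, rfl⟩ := B.exists_red_eq Function.surjective_id (1 + n) x
    obtain ⟨u, -, -, rfl⟩ := B.exists_red_eq hR (1 + n + 1) y
    have hy' : B.redMap R {l | B.IsShort 1 l} (1 + n) (B.red Q {l | B.IsShort 1 l} (1 + n) f) -
      B.dRed R Set.univ (1 + n) (B.red R Set.univ (1 + n + 1) u) ∈
      maximalIdeal R • (⊤ : Submodule R (B.Idx Set.univ (1 + n) →₀ R)) := hy
    rw [B.redMap_red _ hf, B.dRed_red _ (by simp), ← map_sub, B.red_mem_smul_top_iff hI] at hy'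
    obtain ⟨f', h1, h2⟩ := h f hf (fun hn l hl => by
        obtain ⟨j, rfl⟩ : ∃ j, n = j + 1 := ⟨n - 1, by omega⟩
        have h3 := hx j rfl
        rw [hd] at h3
        have h4 : B.dRed Q {l | B.IsShort 1 l} (1 + j) (B.red Q {l | B.IsShort 1 l} (1 + j + 1) f) ∈
          maximalIdeal Q • (⊤ : Submodule Q (B.Idx {l | B.IsShort 1 l} (1 + j) →₀ Q)) := h3
        rw [B.dRed_red _ hf, B.red_mem_smul_top_iff hQ] at h4
        by_cases hl' : B.IsShort 1 l
        · exact h4 l hl' (by omega)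
        · have h5 : B.D f l = 0 := by
            by_contra h0
            exact hl' (B.mem_short.1 (B.D_mem_short hf) l h0)
          rw [h5]
          exact Ideal.zero_mem _)
      u (fun l hl => hy' l trivial (by omega))
    refine ⟨B.red Q _ (1 + n + 1) f', ?_⟩
    show B.red Q {l | B.IsShort 1 l} (1 + n) f -
      B.dRed Q {l | B.IsShort 1 l} (1 + n) (B.red Q _ (1 + n + 1) f') ∈
      maximalIdeal Q • (⊤ : Submodule Q (B.Idx {l | B.IsShort 1 l} (1 + n) →₀ Q))
    rw [B.dRed_red _ h1, ← map_sub, B.red_mem_smul_top_iff hQ]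
    exact fun l _ hl => h2 l (by omega)

end BarData

end AInf

/-! ### The change of rings map of the module, and structure maps modulo the maximal ideal -/

namespace AInf

open Finset DirectSum IsLocalRing TensorProduct

namespace BarData

variable {Q R V β γ : Type u} [CommRing Q] [CommRing R] [Algebra Q R] [AddCommGroup V] [Module Q V]
    {M : ModuleCat.{u} R} {G : ProjectiveResolution ((TorChange.res Q R).obj M)}
    {B : BarData Q V (Tot G.complex) β γ}

theorem inclusion_aug (hB : B.IsGraded) (hR : Function.Surjective (algebraMap Q R))
    (p : Presentation G.complex R M) (hker : ∀ q : Q, algebraMap Q R q = 0 ↔ ∃ v, B.d1 v = q)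
    (hp : ∀ x, p.h (p.j x) = TorChange.aug G x) :
    (inclusion hB hR p hker).f 0 ≫ TorChange.resAug Q (resolution hB hR p hker) =
      TorChange.aug G := by
  refine ModuleCat.hom_ext (LinearMap.ext fun x => ?_)
  refine Eq.trans (aug_resolution hB hR p hker (B.red R Set.univ 0
    (B.ι (DirectSum.lof Q ℕ (fun i => G.complex.X i) 0 x)))) ?_
  rw [hB.zeroMap_red_ι, DirectSum.lof_apply]
  exact hp x

/-- By minimality of `G`, every element of `G ⊗ k` is a cycle and only zero is a boundary. So the
kernel consists of the elements of `G` that become boundaries in the bar complex. -/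
theorem changeOfRings_injective_iff [IsLocalRing Q] [IsLocalRing R] (hB : B.IsGraded)
    (hR : Function.Surjective (algebraMap Q R)) (p : Presentation G.complex R M)
    (hker : ∀ q : Q, algebraMap Q R q = 0 ↔ ∃ v, B.d1 v = q)
    (hp : ∀ x, p.h (p.j x) = TorChange.aug G x)
    (hmin : ∀ i, IsMinimalMap (G.complex.d (i + 1) i).hom) (n : ℕ) :
    Function.Injective (TorChange.changeOfRings Q M (ModuleCat.of R (ResidueField R)) n) ↔
      B.WInjective (maximalIdeal Q) n := by
  have : IsLocalHom (algebraMap Q R) := IsLocalHom.of_surjective _ hR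
  have hI : ∀ q, algebraMap Q R q ∈ maximalIdeal R ↔ q ∈ maximalIdeal Q := fun q => by
    rw [mem_maximalIdeal, mem_maximalIdeal, mem_nonunits_iff, mem_nonunits_iff, isUnit_map_iff]
  rw [TorChange.changeOfRings_injective_iff _ _ _ (inclusion_aug hB hR p hker hp),
    TorChange.mono_homologyMap_residueField_iff hR, resolution_d]
  constructor
  · intro h g u hu
    obtain ⟨z, hz⟩ := h (g n) (fun j hj => by
        subst hj
        exact hmin j ⟨_, rfl⟩)
      (B.red R _ (0 + n + 1) u) (by
        refine Eq.mpr (congrArg (· ∈ _) (congrArg₂ (fun a b : B.Idx Set.univ (0 + n) →₀ R => a - b)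
          (hB.red_ι_eq (0 + n) (g' := g) ?_)
          (B.dRed_red (S := R) (0 + n) (u := u) (by simp)))) ?_
        · rw [zero_add, DirectSum.lof_apply]
        · rw [← map_sub]
          refine (B.red_mem_smul_top_iff hI (0 + n) (B.ι g - B.D u)).2 fun l _ hl => ?_
          exact hu l (by omega))
    refine (hB.mem_smul_top_iff _ g n).1 ?_
    have := Submodule.add_mem _ hz (hmin n ⟨z, rfl⟩)
    rwa [sub_add_cancel] at this
  · intro h x _ y hy
    refine ⟨0, ?_⟩
    obtain ⟨u, -, -, rfl⟩ := B.exists_red_eq hR (0 + n + 1) y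
    have hy' : B.red R Set.univ (0 + n) (B.ι (DirectSum.lof Q ℕ (fun i => G.complex.X i) n x)) -
      B.dRed R Set.univ (0 + n) (B.red R Set.univ (0 + n + 1) u) ∈
      maximalIdeal R • (⊤ : Submodule R (B.Idx Set.univ (0 + n) →₀ R)) := hy
    rw [B.dRed_red _ (by simp), ← map_sub, B.red_mem_smul_top_iff hI] at hy'
    rw [map_zero, sub_zero]
    have h1 := (hB.mem_smul_top_iff _ _ n).2 (h _ u fun l hl => hy' l trivial (by omega))
    rwa [DirectSum.lof_apply] at h1

end BarData

theorem isGraded_barData {Q R : Type u} [CommRing Q] [CommRing R] [Algebra Q R]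
    (A : ProjectiveResolution (ModuleCat.of Q R)) [∀ i, Module.Free Q (A.complex.X i)]
    {e : A.complex.X 0 ≃ₗ[Q] Q} (m : AlgStr A.complex e) {Z : ModuleCat.{u} Q}
    (G : ProjectiveResolution Z) [∀ i, Module.Free Q (G.complex.X i)] (mG : ModStr m G.complex) :
    (barData A m G mG).IsGraded where
  mG_zero := mG.m_one
  mem_smul_top_iff I g t := by
    rw [TorChange.mem_ideal_smul_top_iff_repr (Module.Free.chooseBasis Q (G.complex.X t))]
    constructor
    · rintro h ⟨t', c⟩ rfl
      exact h c
    · exact fun h c => h ⟨t, c⟩ rfl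

/-- The presentation of the augmentation of `G` through `R ⊗ G₀`. -/
noncomputable def presentation {Q R : Type u} [CommRing Q] [CommRing R] [Algebra Q R]
    (hR : Function.Surjective (algebraMap Q R)) {M : ModuleCat.{u} R}
    (G : ProjectiveResolution ((TorChange.res Q R).obj M)) :
    BarData.Presentation G.complex R M :=
  -- Composing the unit of the adjunction with the transpose of the augmentation gives the
  -- augmentation back.
  have hj : ∀ x, (((ModuleCat.extendRestrictScalarsAdj (algebraMap Q R)).homEquiv _ _).symm
      (TorChange.aug G)).hom
      ((ModuleCat.extendRestrictScalarsAdj (algebraMap Q R)).unit.app (G.complex.X 0) x) =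
        TorChange.aug G x :=
    fun x => ConcreteCategory.congr_hom (((ModuleCat.extendRestrictScalarsAdj
      (algebraMap Q R)).homEquiv _ _).apply_symm_apply (TorChange.aug G)) x
  { E := (ModuleCat.extendScalars (algebraMap Q R)).obj (G.complex.X 0)
    j := 
      { toFun := (ModuleCat.extendRestrictScalarsAdj (algebraMap Q R)).unit.app (G.complex.X 0)
        map_add' := map_add _
        map_smul' := fun q x => map_smul ((ModuleCat.extendRestrictScalarsAdj
          (algebraMap Q R)).unit.app (G.complex.X 0)).hom q x }
    h := (((ModuleCat.extendRestrictScalarsAdj (algebraMap Q R)).homEquiv _ _).symm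
      (TorChange.aug G)).hom
    j_surjective := TorChange.unit_surjective hR _
    j_eq_zero_iff := TorChange.unit_eq_zero_iff hR _
    h_j_d := fun y => (hj _).trans (TorChange.aug_d G y)
    exists_d_eq := fun x hx => TorChange.resolution_exact_zero G x ((hj x).symm.trans hx)
    h_surjective := fun m => by
      obtain ⟨x, hx⟩ := TorChange.aug_surjective G m
      exact ⟨_, (hj x).trans hx⟩ }

theorem presentation_h_j {Q R : Type u} [CommRing Q] [CommRing R] [Algebra Q R]
    (hR : Function.Surjective (algebraMap Q R)) {M : ModuleCat.{u} R}
    (G : ProjectiveResolution ((TorChange.res Q R).obj M)) (x : G.complex.X 0) :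
    (presentation hR G).h ((presentation hR G).j x) = TorChange.aug G x :=
  ConcreteCategory.congr_hom (((ModuleCat.extendRestrictScalarsAdj
      (algebraMap Q R)).homEquiv _ _).apply_symm_apply (TorChange.aug G)) x

theorem rTensor_residueField_eq_zero_iff {Q X Y σ : Type*} [CommRing Q] [IsLocalRing Q]
    [AddCommGroup X] [Module Q X] [AddCommGroup Y] [Module Q Y] (b : Module.Basis σ Q Y)
    (f : X →ₗ[Q] Y) :
    f.rTensor (ResidueField Q) = 0 ↔ ∀ x i, b.repr (f x) i ∈ maximalIdeal Q := by
  have ho : ∀ a : ResidueField Q, ∃ s : Q, s • (1 : ResidueField Q) = a := fun a => by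
    obtain ⟨s, rfl⟩ := residue_surjective a
    exact ⟨s, by rw [Algebra.smul_def, mul_one]; rfl⟩
  have hI : ∀ s : Q, s • (1 : ResidueField Q) = 0 ↔ s ∈ maximalIdeal Q := fun s => by
    rw [Algebra.smul_def, mul_one]
    exact residue_eq_zero_iff s
  simp only [← TorChange.mem_ideal_smul_top_iff_repr b,
    ← TorChange.tmul_eq_zero_iff_of_cyclic ho hI]
  constructor
  · intro h x
    exact LinearMap.congr_fun h (x ⊗ₜ 1)
  · intro h
    refine LinearMap.ext fun z => ?_
    obtain ⟨x, rfl⟩ := TorChange.exists_tmul_eq ho z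
    exact h x

theorem mem_of_tensor_left {Q V Y : Type*} [CommRing Q] [AddCommGroup V] [Module Q V]
    [AddCommGroup Y] [Module Q Y] {n : ℕ} (f : MultilinearMap Q (fun _ : Fin n => V) Y)
    (N : Submodule Q Y) (h : ∀ x, f x ∈ N) (z : ⨂[Q] _ : Fin n, V) :
    PiTensorProduct.lift f z ∈ N := by
  induction z using PiTensorProduct.induction_on with
  | smul_tprod r x =>
    rw [map_smul, PiTensorProduct.lift.tprod]
    exact N.smul_mem r (h x)
  | add x y hx hy =>
    rw [map_add]
    exact N.add_mem hx hy

section MultilinearMap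

variable {Q V W Y σ : Type*} [CommRing Q] [IsLocalRing Q] [AddCommGroup V] [Module Q V]
    [AddCommGroup W] [Module Q W] [AddCommGroup Y] [Module Q Y] (b : Module.Basis σ Q Y) {n : ℕ}

theorem lift_rTensor_eq_zero_iff (f : MultilinearMap Q (fun _ : Fin n => V) Y) :
    (PiTensorProduct.lift f).rTensor (ResidueField Q) = 0 ↔
      ∀ x i, b.repr (f x) i ∈ maximalIdeal Q := by
  rw [rTensor_residueField_eq_zero_iff b]
  simp only [← TorChange.mem_ideal_smul_top_iff_repr b]
  refine ⟨fun h x => ?_, mem_of_tensor_left f _⟩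
  rw [← PiTensorProduct.lift.tprod (R := Q) (φ := f)]
  exact h _

theorem lift_lift_rTensor_eq_zero_iff (f : MultilinearMap Q (fun _ : Fin n => V) (W →ₗ[Q] Y)) :
    (TensorProduct.lift (PiTensorProduct.lift f)).rTensor (ResidueField Q) = 0 ↔
      ∀ x g i, b.repr (f x g) i ∈ maximalIdeal Q := by
  rw [rTensor_residueField_eq_zero_iff b]
  simp only [← TorChange.mem_ideal_smul_top_iff_repr b]
  constructor
  · intro h x g
    rw [← PiTensorProduct.lift.tprod (R := Q) (φ := f), ← TensorProduct.lift.tmul]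
    exact h _
  · intro h z
    induction z with
    | zero =>
      rw [map_zero]
      exact Submodule.zero_mem _
    | add z z' hz hz' =>
      rw [map_add]
      exact Submodule.add_mem _ hz hz'
    | tmul z g =>
      rw [TensorProduct.lift.tmul]
      exact mem_of_tensor_left f ((maximalIdeal Q • (⊤ : Submodule Q Y)).comap
        (LinearMap.applyₗ g)) (fun x => h x g) z

end MultilinearMap

end AInf

/-! ### Checking the criterion for the given structures -/

namespace AInf

open Finset DirectSum IsLocalRing TensorProduct

section BarData

variable {Q R : Type u} [CommRing Q] [CommRing R] [Algebra Q R]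
    (A : ProjectiveResolution (ModuleCat.of Q R)) [∀ i, Module.Free Q (A.complex.X i)]
    {e : A.complex.X 0 ≃ₗ[Q] Q} (m : AlgStr A.complex e) {Z : ModuleCat.{u} Q}
    (G : ProjectiveResolution Z) [∀ i, Module.Free Q (G.complex.X i)] (mG : ModStr m G.complex)

theorem repr_M1_barData_mem [IsLocalRing Q] (h : ∀ i, IsMinimalMap (A.complex.d (i + 1) i).hom)
    (v : PlusShift A.complex) (b) :
    (barData A m G mG).bV.repr ((barData A m G mG).M1 v) b ∈ maximalIdeal Q := by
  rw [← BarData.M_one _ fun _ => v]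
  refine Eq.mpr (congrArg (fun w => (gradedBasis fun i => A.complex.X (i + 1)).repr w b ∈ _)
    (m.m_one _)) ?_
  rw [gradedBasis_repr, dPlus_apply]
  exact (TorChange.mem_ideal_smul_top_iff_repr _ _ _).1 (Submodule.neg_mem _ (h _ ⟨_, rfl⟩)) _

theorem repr_MG_zero_barData_mem [IsLocalRing Q]
    (h : ∀ i, IsMinimalMap (G.complex.d (i + 1) i).hom) (g : Tot G.complex) (c) :
    (barData A m G mG).bW.repr ((barData A m G mG).MG 0 0 g) c ∈ maximalIdeal Q := by
  refine Eq.mpr (congrArg (fun w => (gradedBasis fun i => G.complex.X i).repr w c ∈ _)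
    (LinearMap.congr_fun (mG.m_one _) g)) ?_
  rw [gradedBasis_repr, dTot_apply]
  exact (TorChange.mem_ideal_smul_top_iff_repr _ _ _).1 (h _ ⟨_, rfl⟩) _

/-- If `G₀` had rank zero, its quotient `Z` would be zero. This supplies the `c₀` of the word
criterion and is where `M ≠ 0` enters. -/
theorem exists_degW_eq_zero [Nontrivial Z] : ∃ c, (barData A m G mG).degW c = 0 := by
  by_cases h : Nonempty (Module.Free.ChooseBasisIndex Q (G.complex.X 0))
  · exact ⟨⟨0, h.some⟩, rfl⟩
  · rw [not_nonempty_iff] at h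
    have := (Module.Free.chooseBasis Q (G.complex.X 0)).repr.toEquiv.subsingleton
    have := (TorChange.aug_surjective G).subsingleton
    exact absurd this (not_subsingleton Z)

theorem isMinimal_barData_iff [IsLocalRing Q] :
    (barData A m G mG).IsMinimal (maximalIdeal Q) ↔
      (∀ n : ℕ, 1 ≤ n → (m.lin n).rTensor (ResidueField Q) = 0) ∧
        ∀ p : ℕ, (mG.lin p).rTensor (ResidueField Q) = 0 := by
  refine and_congr ⟨fun h n _ => ?_, fun h n => ?_⟩ (forall_congr' fun p => ?_)
  · exact (lift_rTensor_eq_zero_iff (gradedBasis fun i => A.complex.X (i + 1)) (m.m n)).2 (h n)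
  · rcases Nat.eq_zero_or_pos n with rfl | hn
    · intro x b
      have h0 : m.m 0 x = 0 := by rw [m.m_zero, _root_.zero_apply]
      have h1 : ∀ w : PlusShift A.complex, w = 0 →
          (gradedBasis fun i => A.complex.X (i + 1)).repr w b ∈ maximalIdeal Q := by
        rintro _ rfl
        rw [map_zero]
        exact Ideal.zero_mem _
      exact h1 _ h0
    · exact (lift_rTensor_eq_zero_iff (gradedBasis fun i => A.complex.X (i + 1)) (m.m n)).1 (h n hn)
  · exact (lift_lift_rTensor_eq_zero_iff (gradedBasis fun i => G.complex.X i) (mG.mG p)).symm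

end BarData

end AInf

theorem mainTheorem9 {Q R : Type u} [CommRing Q] [IsLocalRing Q] [IsNoetherianRing Q]
    [CommRing R] [IsLocalRing R] [Algebra Q R] (hR : Function.Surjective (algebraMap Q R))
    (M : ModuleCat.{u} R) [Module.Finite R M] [Nontrivial M]
    (A : ProjectiveResolution (ModuleCat.of Q R)) (hA : AInf.IsMinimalFree A.complex)
    (e : A.complex.X 0 ≃ₗ[Q] Q) (m : AInf.AlgStr A.complex e)
    (G : ProjectiveResolution ((TorChange.res Q R).obj M)) (hG : AInf.IsMinimalFree G.complex)
    (mG : AInf.ModStr m G.complex) :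
    ((∀ q : ℕ, Function.Injective
        (TorChange.changeOfRings Q M (ModuleCat.of R (IsLocalRing.ResidueField R)) q)) ∧
      (∀ q : ℕ, Function.Injective
        (TorChange.changeOfRings Q (TorChange.syzygy G)
          (ModuleCat.of R (IsLocalRing.ResidueField R)) q))) ↔
    ((∀ n : ℕ, 1 ≤ n → (m.lin n).rTensor (IsLocalRing.ResidueField Q) = 0) ∧
      (∀ p : ℕ, (mG.lin p).rTensor (IsLocalRing.ResidueField Q) = 0)) := by
  have := hA.1
  have := hG.1
  have : Nontrivial ((TorChange.res Q R).obj M) := inferInstanceAs (Nontrivial M)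
  have hB := AInf.isGraded_barData A m G mG
  have hker := AInf.exists_dOne_eq_iff (R := R) A e
  obtain ⟨c₀, hc₀⟩ := AInf.exists_degW_eq_zero A m G mG
  -- Both sides become statements about words, after which the two maps are matched degree by
  -- degree.
  rw [← AInf.isMinimal_barData_iff, ← AInf.BarData.injective_iff_isMinimal _
    (AInf.repr_M1_barData_mem A m G mG hA.2) (AInf.repr_MG_zero_barData_mem A m G mG hG.2) hc₀]
  refine and_congr (forall_congr' fun n => ?_) (forall_congr' fun n => ?_)
  · exact AInf.BarData.changeOfRings_injective_iff hB hR (AInf.presentation hR G) hker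
      (AInf.presentation_h_j hR G) hG.2 n
  · exact AInf.BarData.changeOfRings_syzygy_injective_iff hB hR (AInf.presentation hR G) hker n
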